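/- **Fourier transform of $-\log|x|$ on a local field.** Let $K$ be $\mathbb R$, $\mathbb C$ or a finite extension of some $\mathbb Q_p$ (so $K$ may be any completion of a number field). Let $|x|$ be the module of $x\in K$, $d(xa)=|x|\,da$ (so $|z|=z\bar z$ on $\mathbb C$). Let $\lambda(x)=e^{-2\pi i\,\mathrm{Tr}_{K/\mathbb R}(x)}$ in the archimedean case and $\lambda(x)=e^{2\pi i\{\mathrm{Tr}_{K/\mathbb Q_p}(x)\}}$ in the $p$-adic case, where $\{\cdot\}$ is the fractional part in $\mathbb Z[1/p]\cap[0,1)$. Let $dx$ be the self-dual additive Haar measure for $\lambda$ (Lebesgue measure on $\mathbb R$, twice Lebesgue measure on $\mathbb C$) and $\widetilde\varphi(y)=\int_K\varphi(x)\lambda(xy)\,dx$. Test functions are the Schwartz functions (archimedean case) or the locally constant functions with compact support ($p$-adic case). For a test function $\varphi$, and for a function $\omega$ with $\omega(0)=1$, put $$G(\varphi)=\int_K(-\log|y|)\,\widetilde\varphi(y)\,dy,\qquad P_\omega(\varphi)=\int_K(\varphi(x)-\varphi(0)\omega(x))\frac{dx}{|x|},\qquad \Delta_s(\varphi)=\int_K\varphi(x)|x|^{s-1}\,dx\quad(\mathrm{Re}\,s>0).$$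 For a function $F$ on $K^\times$ which is smooth (locally constant in the $p$-adic case) with compact support in $K^\times$, and is extended by $0$ to $K$, let $W(F)=(G*F)(1)=G(x\mapsto F(1-x))$ be Weil's local term. Below $\gamma_e$ is Euler's constant and $q^{-1}=|\pi|$ for a uniformizer $\pi$ of a $p$-adic $K$ with ring of integers $\mathcal O$; $\delta$ is the largest integer such that $\mathrm{Tr}(\pi^{-\delta}\mathcal O)\subset\mathbb Z_p$. All integrals below converge absolutely. **(1) All places.** Let $$R=q^{-\delta/2}\,\frac{1-1/q}{\log q}\ (p\text{-adic}),\qquad R=2\ (\text{real}),\qquad R=2\pi\ (\text{complex}),$$ $$\tau=\frac{\log q}{q-1}-\delta\log q-\tfrac12\log q\ (p\text{-adic}),\qquad \tau=\log(2\pi)+\gamma_e\ (\text{real}),\qquad \tau=2(\log(2\pi)+\gamma_e)\ (\text{complex}),$$ and $\gamma=1/R$. For every test function $\varphi$, the function $s\mapsto\Delta_s(\varphi)-R\varphi(0)/s$ extends analytically to a neighbourhood of $s=0$; let $P(\varphi)$ be the value of this extension at $0$. For all test functions $\varphi,\omega$ with $\omega(0)=1$: * $P(\varphi)=P_\omega(\varphi)+P(\omega)\varphi(0)$;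 * $G(\varphi)=\gamma P_\omega(\varphi)+G(\omega)\varphi(0)$ and $G(\varphi)=\gamma P(\varphi)+\tau\varphi(0)$; * $G(\varphi)=-\frac{\partial}{\partial s}\big|_{s=1}\Delta_s(\widetilde\varphi)$, and $G(\varphi_t)=G(\varphi)-\log|t|\,\varphi(0)$ for $t\in K^\times$, $\varphi_t(x)=\varphi(tx)$; * the measure $d^\times u=\gamma\,du/|u|$ satisfies $\int_{1\le|x|<|X|}d^\times x=\log|X|$ for all $X\in K$ with $|X|\ge1$. **(2) $p$-adic places.** One has $\mathrm{Vol}(\mathcal O)=q^{-\delta/2}$, and the units have volume $\log q$ for $d^\times u$. If $\omega$ is the characteristic function of $\mathcal O$, and $\omega_1$ is $\omega$ minus the characteristic function of $\{x:|x-1|\le 1/q\}$, then $G(\omega)=\frac{\log q}{q-1}-\delta\log q$ and $$G(\varphi)=\gamma\bigl(P_\omega(\varphi)+q^{-\delta/2-1}\varphi(0)\bigr)-\delta\log q\,\varphi(0)=\gamma P_{\omega_1}(\varphi)-\delta\log q\,\varphi(0),$$ $$W(F)=\int_K\bigl(F(1-x)-F(1)\omega_1(x)\bigr)\gamma\frac{dx}{|x|}-\delta\log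 q\,F(1)$$ $$=\int_{|u|=1}\Bigl(F(\tfrac1u)-F(1)\Bigr)\frac{d^\times u}{|1-u|}+\int_{|u|\ne1}F(\tfrac1u)\frac{d^\times u}{|1-u|}-\delta\log q\,F(1).$$ If $F(u)=f(|u|)\chi(u)^{-1}$ with $f$ smooth with compact support in $(0,\infty)$ and $\chi$ a continuous unitary character of $K^\times$, then the integral over $|u|=1$ vanishes if $\chi$ is trivial on the units, and the integral over $|u|\ne1$ vanishes otherwise. **(3) Real place.** $$G(\varphi)=\int_{|x|\le1}(\varphi(x)-\varphi(0))\frac{dx}{2|x|}+\int_{|x|>1}\varphi(x)\frac{dx}{2|x|}+(\log(2\pi)+\gamma_e)\varphi(0)$$ $$=\int_{\mathbb R}\Bigl(\varphi(x)-\varphi(0)\frac{\sin\pi x}{\pi x}\Bigr)\frac{dx}{2|x|}+(1+\log2)\varphi(0) =\int_{\mathbb R}\Bigl(\varphi(x)-\varphi(0)\frac{\sin2\pi ex}{2\pi ex}\Bigr)\frac{dx}{2|x|}$$ $$=\int_{\mathbb R}\Bigl(\varphi(x)-\varphi(0)\Bigl(\frac{\sin\pi x}{\pi x}\Bigr)^2\Bigr)\frac{dx}{2|x|}+\tfrac32\varphi(0),$$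 and, with $d^\times u=\frac{du}{2|u|}$ and $S(u)=\frac{(u/\pi)\sin(\pi/u)}{u-1}$, $$W(F)=\int_{1/2}^\infty\Bigl(F(\tfrac1u)-F(1)\Bigr)\frac{d^\times u}{|1-u|}+\int_{-\infty}^{1/2}F(\tfrac1u)\frac{d^\times u}{|1-u|}+(\log(2\pi)+\gamma_e)F(1)$$ $$=\int_{\mathbb R^\times}\Bigl(F(\tfrac1u)-S(u)F(1)\Bigr)\frac{d^\times u}{|1-u|}+(1+\log2)F(1) =\int_{\mathbb R^\times}\Bigl(F(\tfrac1u)-S(u)^2F(1)\Bigr)\frac{d^\times u}{|1-u|}+\tfrac32F(1).$$ **(4) Complex place.** With $dx$ twice Lebesgue measure, $|z|=z\bar z$ and $d^\times u=\frac{du}{2\pi|u|}$, $$G(\varphi)=\int_{|x|\le1}(\varphi(x)-\varphi(0))\frac{dx}{2\pi|x|}+\int_{|x|>1}\varphi(x)\frac{dx}{2\pi|x|}+2(\log(2\pi)+\gamma_e)\varphi(0),$$ $$W(F)=\int_{\mathrm{Re}(u)\ge1/2}\Bigl(F(\tfrac1u)-F(1)\Bigr)\frac{d^\times u}{|1-u|}+\int_{\mathrm{Re}(u)\le1/2}F(\tfrac1u)\frac{d^\times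 u}{|1-u|}+2(\log(2\pi)+\gamma_e)F(1).$$ -/

import Mathlib

open MeasureTheory Complex
open scoped SchwartzMap ContDiff

namespace LocalLog

noncomputable section

/-! ### Module, additive characters, test functions -/

section Module

variable (K : Type*) [NormedField K] [LocallyCompactSpace K]

/-- The module `|x|` of an element of a locally compact field: the factor by which multiplication
by `x` scales additive Haar measure, `d(xa) = |x| da`, and `|0| = 0`. -/
def localModule (x : K) : ℝ :=
  open Classical in
  if h : x = 0 then 0 else (distribHaarChar K (Units.mk0 x h) : ℝ)

end Module

/-- On `ℝ` the module is the absolute value. -/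
theorem localModule_real (x : ℝ) : localModule ℝ x = |x| := by
  unfold localModule
  split_ifs with h
  · simp [h]
  · have := distribHaarChar_eq_of_measure_smul_eq_mul (A := ℝ) (μ := volume) (s := Set.Icc 0 1)
      (by simp) (by simp) (g := Units.mk0 x h) (r := ‖x‖₊) (by
        have := Measure.addHaar_smul (volume : Measure ℝ) x (Set.Icc 0 1)
        simp only [Module.finrank_self, pow_one] at this
        have e : ENNReal.ofReal |x| = (‖x‖₊ : ENNReal) := by
          rw [← Real.norm_eq_abs, ofReal_norm, enorm_eq_nnnorm]
        rw [← e, ← this]; rfl)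
    rw [this]; simp

/-- On `ℂ` the module is `z * conj z`. -/
theorem localModule_complex (z : ℂ) : localModule ℂ z = normSq z := by
  unfold localModule
  split_ifs with h
  · simp [h]
  · have := distribHaarChar_eq_of_measure_smul_eq_mul (A := ℂ) (μ := volume)
      (s := Metric.ball 0 1)
      (Metric.measure_ball_pos _ _ one_pos).ne' measure_ball_lt_top.ne
      (g := Units.mk0 z h) (r := ‖z‖₊ ^ 2) (by
        have := Measure.addHaar_image_linearMap (volume : Measure ℂ)
          (LinearMap.mulLeft ℝ z) (Metric.ball 0 1)
        have hd : LinearMap.det (LinearMap.mulLeft ℝ z) = normSq z := by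
          rw [← Algebra.norm_complex_apply]; rfl
        rw [hd, abs_of_nonneg (normSq_nonneg z)] at this
        have e : ENNReal.ofReal (normSq z) = ((‖z‖₊ ^ 2 : NNReal) : ENNReal) := by
          rw [normSq_eq_norm_sq, ENNReal.ofReal, Real.toNNReal_pow (norm_nonneg z),
            norm_toNNReal]
        rw [← e, ← this]; rfl)
    rw [this, normSq_eq_norm_sq]; simp

/-- The additive character `x ↦ exp (-2 π i Tr x)` of `K = ℝ` or `K = ℂ`. -/
def archChar (K : Type*) [Field K] [Algebra ℝ K] (x : K) : ℂ :=
  exp (-(2 * Real.pi * I * (Algebra.trace ℝ K x : ℝ)))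

theorem exists_padicFract (p : ℕ) [Fact p.Prime] (x : ℚ_[p]) :
    ∃ r : ℚ, 0 ≤ r ∧ r < 1 ∧ (∃ m k : ℕ, r = m / (p : ℚ) ^ k) ∧ ‖x - (r : ℚ_[p])‖ ≤ 1 := by
  have hp : 0 < p := (Fact.out : p.Prime).pos
  have hp0 : (p : ℚ_[p]) ≠ 0 := by exact_mod_cast hp.ne'
  obtain ⟨k, hk⟩ : ∃ k : ℕ, ‖(p : ℚ_[p]) ^ k * x‖ ≤ 1 := by
    have h1 : ‖(p : ℚ_[p])‖ < 1 := by simpa using Padic.norm_p_lt_one (p := p)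
    have ht : Filter.Tendsto (fun k : ℕ => ‖(p : ℚ_[p]) ^ k * x‖) Filter.atTop (nhds 0) := by
      simpa using (tendsto_pow_atTop_nhds_zero_of_lt_one (norm_nonneg _) h1).mul_const ‖x‖
    exact (ht.eventually (ge_mem_nhds one_pos)).exists
  set y : ℤ_[p] := ⟨(p : ℚ_[p]) ^ k * x, hk⟩ with hy
  obtain ⟨c, hc⟩ := Ideal.mem_span_singleton.mp (PadicInt.appr_spec k y)
  have hpk : (0 : ℚ) < (p : ℚ) ^ k := by positivity
  refine ⟨(y.appr k : ℚ) / (p : ℚ) ^ k, by positivity, ?_, ⟨y.appr k, k, rfl⟩, ?_⟩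
  · rw [div_lt_one hpk]
    exact_mod_cast PadicInt.appr_lt y k
  · have hc' : (p : ℚ_[p]) ^ k * x - (y.appr k : ℚ_[p]) = (p : ℚ_[p]) ^ k * (c : ℚ_[p]) := by
      have := congrArg (fun z : ℤ_[p] => (z : ℚ_[p])) hc
      rw [PadicInt.coe_sub] at this
      simpa [hy] using this
    have : x - (((y.appr k : ℚ) / (p : ℚ) ^ k : ℚ) : ℚ_[p]) = c := by
      push_cast
      field_simp
      linear_combination hc'
    rw [this]; exact c.2

/-- The fractional part `{x}` of a `p`-adic number: the element of `ℤ[1/p] ∩ [0, 1)` that is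
congruent to `x` modulo `ℤ_p`. -/
def padicFract (p : ℕ) [Fact p.Prime] (x : ℚ_[p]) : ℚ :=
  (exists_padicFract p x).choose

/-- The additive character `x ↦ exp (2 π i {Tr x})` of a finite extension `L` of `ℚ_p`. -/
def padicChar (p : ℕ) [Fact p.Prime] (L : Type*) [Field L] [Algebra ℚ_[p] L] (x : L) : ℂ :=
  exp (2 * Real.pi * I * (padicFract p (Algebra.trace ℚ_[p] L x) : ℚ))

/-- Test functions at an archimedean place: Schwartz functions. -/
def schwartzTest (K : Type*) [NormedAddCommGroup K] [NormedSpace ℝ K] : Set (K → ℂ) :=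
  {φ | ∃ f : 𝓢(K, ℂ), φ = f}

/-- Test functions at a finite place: locally constant functions with compact support. -/
def bruhatTest (K : Type*) [TopologicalSpace K] : Set (K → ℂ) :=
  {φ | IsLocallyConstant φ ∧ HasCompactSupport φ}

/-- Smooth functions with compact support in `Kˣ`, extended by `0` to `K` (`K = ℝ` or `ℂ`). -/
def smoothMulTest (K : Type*) [NormedField K] [NormedSpace ℝ K] : Set (K → ℂ) :=
  {F | ContDiff ℝ ∞ F ∧ HasCompactSupport F ∧ 0 ∉ tsupport F}

/-- Locally constant functions with compact support in `Kˣ`, extended by `0` to `K`. -/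
def bruhatMulTest (K : Type*) [NormedField K] : Set (K → ℂ) :=
  {F | IsLocallyConstant F ∧ HasCompactSupport F ∧ 0 ∉ tsupport F}

/-- `f` is absolutely integrable on `S`, with integral `c`. -/
def HasIntegralOn {X : Type*} [MeasurableSpace X] (μ : Measure X) (S : Set X) (f : X → ℂ)
    (c : ℂ) : Prop :=
  IntegrableOn f S μ ∧ ∫ x in S, f x ∂μ = c

/-! ### Fourier transform and distributions -/

section Distributions

variable {K : Type*} [NormedField K] [LocallyCompactSpace K] [MeasurableSpace K]

/-- The Fourier transform for the additive character `lam` and the measure `μ`. -/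
def fourier (lam : K → ℂ) (μ : Measure K) (φ : K → ℂ) (y : K) : ℂ :=
  ∫ x, φ x * lam (x * y) ∂μ

/-- `μ` is self-dual for `lam`: Fourier inversion holds without a constant. -/
def IsSelfDual (lam : K → ℂ) (μ : Measure K) (T : Set (K → ℂ)) : Prop :=
  ∀ φ ∈ T, ∀ x, fourier lam μ (fourier lam μ φ) x = φ (-x)

/-- The distribution `G`, Fourier transform of `-log |x|`: `G(φ) = ∫ (-log |y|) φ~(y) dy`. -/
def G (lam : K → ℂ) (μ : Measure K) (φ : K → ℂ) : ℂ :=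
  ∫ y, ((-Real.log (localModule K y) : ℝ) : ℂ) * fourier lam μ φ y ∂μ

/-- Weil's local term `W(F) = (G * F)(1)`, with `*` the additive convolution. -/
def weilTerm (lam : K → ℂ) (μ : Measure K) (F : K → ℂ) : ℂ :=
  G lam μ (fun x => F (1 - x))

/-- The integrand `(φ(x) - φ(0) w(x)) / |x|` of `P_w(φ)`. -/
def PIntegrand (w φ : K → ℂ) (x : K) : ℂ :=
  (φ x - φ 0 * w x) / (localModule K x : ℂ)

/-- `P_w(φ) = ∫ (φ(x) - φ(0) w(x)) dx / |x|`. -/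
def P (μ : Measure K) (w φ : K → ℂ) : ℂ :=
  ∫ x, PIntegrand w φ x ∂μ

/-- The homogeneous distribution `Δ_s(φ) = ∫ φ(x) |x|^(s-1) dx` (for `Re s > 0`). -/
def Delta (μ : Measure K) (s : ℂ) (φ : K → ℂ) : ℂ :=
  ∫ x, φ x * (localModule K x : ℂ) ^ (s - 1) ∂μ

/-- `Δ_s(φ) = r / s + c + O(s)` at `s = 0`: the analytic continuation of `s ↦ Δ_s(φ)` from
`Re s > 0` has at most a simple pole at `0`, with residue `r` and constant term `c`. -/
def HasLaurent (μ : Measure K) (φ : K → ℂ) (r c : ℂ) : Prop :=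
  ∃ E : ℂ → ℂ, AnalyticAt ℂ E 0 ∧ E 0 = c ∧
    ∀ᶠ s in nhds (0 : ℂ), 0 < s.re → Delta μ s φ = r / s + E s

/-- The multiplicative Haar measure `d×u = γ du / |u|`, as a measure on `K`. -/
def mulHaar (μ : Measure K) (γ : ℝ) : Measure K :=
  μ.withDensity (fun u => ENNReal.ofReal (γ / localModule K u))

/-- The part of the result that has the same form at all places, for the residue constant `R`
and the constant `τ`. -/
structure UniformFormula (lam : K → ℂ) (μ : Measure K) (T : Set (K → ℂ)) (R τ : ℝ) : Prop where
  /-- `Δ_s(φ)` converges absolutely for `Re s > 0`. -/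
  delta_integrable : ∀ φ ∈ T, ∀ s : ℂ, 0 < s.re →
    Integrable (fun x => φ x * (localModule K x : ℂ) ^ (s - 1)) μ
  /-- `Δ_s` has a simple pole at `0` with residue `R` times the Dirac mass at the origin. -/
  residue : ∀ φ ∈ T, ∃ c, HasLaurent μ φ (R * φ 0) c
  /-- The integral `P_w(φ)` converges absolutely. -/
  P_integrable : ∀ w ∈ T, w 0 = 1 → ∀ φ ∈ T, Integrable (PIntegrand w φ) μ
  /-- The finite part of `Δ_s` at `0` is `P_w + P(w) · Dirac`. -/
  finite_part : ∀ w ∈ T, w 0 = 1 → ∀ c, HasLaurent μ w R c → ∀ φ ∈ T,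
    HasLaurent μ φ (R * φ 0) (P μ w φ + c * φ 0)
  /-- The integral that defines `G(φ)` converges absolutely. -/
  G_integrable : ∀ φ ∈ T, Integrable
    (fun y => ((-Real.log (localModule K y) : ℝ) : ℂ) * fourier lam μ φ y) μ
  /-- `G = γ P_w + G(w) · Dirac`, with `γ = 1 / R`. -/
  formula : ∀ w ∈ T, w 0 = 1 → ∀ φ ∈ T,
    G lam μ φ = ((1 / R : ℝ) : ℂ) * P μ w φ + G lam μ w * φ 0
  /-- `G = γ P + τ · Dirac`, with `P` the finite part of `Δ_s` at `0`. -/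
  formula_finite_part : ∀ φ ∈ T, ∀ c, HasLaurent μ φ (R * φ 0) c →
    G lam μ φ = ((1 / R : ℝ) : ℂ) * c + τ * φ 0
  /-- `G(φ)` is minus the derivative of `Δ_s(φ~)` at `s = 1`. -/
  deriv_delta : ∀ φ ∈ T, HasDerivAt (fun s => Delta μ s (fourier lam μ φ)) (-G lam μ φ) 1
  /-- `G(φ_t) = G(φ) - log |t| φ(0)` for `φ_t(x) = φ(t x)`. -/
  dilation : ∀ φ ∈ T, ∀ t : K, t ≠ 0 →
    G lam μ (fun x => φ (t * x)) = G lam μ φ - (Real.log (localModule K t) : ℝ) * φ 0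
  /-- The shell `1 ≤ |x| < |X|` has volume `log |X|` for `d×u = γ du / |u|`. -/
  shell_volume : ∀ X : K, 1 ≤ localModule K X →
    mulHaar μ (1 / R) {x | 1 ≤ localModule K x ∧ localModule K x < localModule K X} =
      ENNReal.ofReal (Real.log (localModule K X))

end Distributions

/-! ### Finite places -/

section Finite

variable {L : Type*} [NormedField L] [LocallyCompactSpace L]

/-- A uniformizer: an element of largest module `< 1`. -/
def IsUniformizer (ϖ : L) : Prop :=
  localModule L ϖ < 1 ∧ ∀ x : L, localModule L x < 1 → localModule L x ≤ localModule L ϖ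

/-- `δ` is the different exponent: the largest integer such that the trace maps `ϖ^(-δ) 𝒪`
into `ℤ_p`. -/
def IsDifferentExponent (p : ℕ) [Fact p.Prime] [Algebra ℚ_[p] L] (ϖ : L) (δ : ℤ) : Prop :=
  IsGreatest {d : ℤ | ∀ a : L, localModule L a ≤ 1 →
    ‖Algebra.trace ℚ_[p] L (ϖ ^ (-d) * a)‖ ≤ 1} δ

/-- The characteristic function of the ring of integers. -/
def omegaInt : L → ℂ :=
  Set.indicator {x | localModule L x ≤ 1} 1

/-- `ω₁`: the characteristic function of the ring of integers minus that of the ball of radius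
`r` (used for `r = 1/q`) centered at `1`. -/
def omegaOne (r : ℝ) (x : L) : ℂ :=
  omegaInt x - Set.indicator {x : L | localModule L (x - 1) ≤ r} 1 x

/-- The function `F(u) = f(|u|) χ(u)⁻¹` on `Lˣ`, extended by `0`. -/
def heckeTest (f : ℝ → ℂ) (χ : Lˣ →* Circle) (u : L) : ℂ :=
  open Classical in
  if h : u = 0 then 0 else f (localModule L u) * ((χ (Units.mk0 u h))⁻¹ : Circle)

end Finite

end

end LocalLog

namespace LocalLog

noncomputable section

set_option linter.unusedSectionVars false

/-! ### The module and the scaling of additive Haar measure. -/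

section ModuleBasics

variable {K : Type*} [NormedField K] [LocallyCompactSpace K]

/-! The engine is Tate's local functional equation, differentiated at `s = 1`. Fubini and a dilation
give, for test functions `φ`, `w` and `0 < Re s < 1`, `Δ_s(φ~) Δ_{1-s}(w) = Δ_s(w~) Δ_{1-s}(φ)`
(`functional_equation`). At `s = 1` the first factors are regular: Fourier inversion gives `Δ_1(φ~)
= φ(0)`, and differentiation under the integral gives the derivative `-G(φ)`. The second factors
have a simple pole, `Δ_s(φ) = R φ(0) / s + P(φ) + O(s)`. Multiplying out the pole and comparing
derivatives (`deriv_relation`) yields, when `w(0) = 1`, `R G(φ) + φ(0) P(w) = R φ(0) G(w) + P(φ)`.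
Since `P(φ) - P(w) φ(0) = P_w(φ)`, this is `G(φ) = P_w(φ) / R + G(w) φ(0)`.

What remains is to find the pole and to evaluate `G` at one function. For the pole, the
characteristic function `ω` of `|x| ≤ 1` is enough: `φ - φ(0) ω` is integrable against `|x|^(s-1)`
in a strip around `Re s = 0`, so it only adds an analytic term (`Admissible.hasLaurent`). At a
finite place `Δ_s(ω) (1 - q^(-s))` is the volume of the units, and `ω~` is a multiple of the
characteristic function of another ball, so `G(ω)` is an elementary logarithmic derivative
(`HasConductor.G_omegaInt`). At an archimedean place `Δ_s(ω) = V / s` exactly, with `V` the volume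
of the unit ball, and the self-dual Gaussian has a `Δ_s` given by the Gamma function. The constant
then comes from the logarithmic derivatives of Gamma at `1` and at half the real dimension
(`IsTestSpace.G_eq_cutoff`).

The formulas with `sin` use an auxiliary `w` that is not a test function. If `w = h~` with `∫ h =
1`, the functional equation for `φ~` and `h` gives the same formula, with `∫ -log|y| h(y) dy` in
place of `G(w)` (`IsTestSpace.G_eq_of_fourier`). The box on `[-a, a]` and the triangle on `[-1, 1]`
give the constants `1 - log a` and `3/2`.

Weil's integrals come from the substitution `x = 1 - 1/u`, which sends `dx / |x|` to `du / (|u| |1 -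
u|)`. It rests on the invariance of `du / |u|` under inversion (`measurePreserving_inv_mulHaar`). It
turns `|x| ≤ 1` into `Re u ≥ 1/2` at the archimedean places, and `ω₁` into the characteristic
function of the units at the finite ones. -/

theorem localModule_of_ne {x : K} (h : x ≠ 0) :
    localModule K x = (distribHaarChar K (Units.mk0 x h) : ℝ) := by
  simp [localModule, h]

@[simp] theorem localModule_zero : localModule K 0 = 0 := by simp [localModule]

theorem localModule_pos {x : K} (h : x ≠ 0) : 0 < localModule K x := by
  rw [localModule_of_ne h]
  exact_mod_cast distribHaarChar_pos

theorem localModule_nonneg (x : K) : 0 ≤ localModule K x := by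
  by_cases h : x = 0
  · simp [h]
  · exact (localModule_pos h).le

@[simp] theorem localModule_eq_zero {x : K} : localModule K x = 0 ↔ x = 0 :=
  ⟨fun h => by_contra fun hx => (localModule_pos hx).ne' h, fun h => by simp [h]⟩

theorem localModule_mul (x y : K) :
    localModule K (x * y) = localModule K x * localModule K y := by
  by_cases hx : x = 0
  · simp [hx]
  by_cases hy : y = 0
  · simp [hy]
  rw [localModule_of_ne hx, localModule_of_ne hy, localModule_of_ne (mul_ne_zero hx hy),
    ← NNReal.coe_mul, ← map_mul]
  congr 3
  ext
  rfl

@[simp] theorem localModule_one : localModule K 1 = 1 := by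
  rw [localModule_of_ne one_ne_zero]
  have : Units.mk0 (1 : K) one_ne_zero = 1 := by ext; rfl
  rw [this, map_one]; rfl

theorem localModule_inv (x : K) : localModule K x⁻¹ = (localModule K x)⁻¹ := by
  by_cases hx : x = 0
  · simp [hx]
  · refine eq_inv_of_mul_eq_one_left ?_
    rw [← localModule_mul, inv_mul_cancel₀ hx, localModule_one]

theorem localModule_pow (x : K) (n : ℕ) : localModule K (x ^ n) = localModule K x ^ n := by
  induction n with
  | zero => simp
  | succ n ih => rw [pow_succ, localModule_mul, ih, pow_succ]

theorem localModule_zpow (x : K) (n : ℤ) : localModule K (x ^ n) = localModule K x ^ n := by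
  cases n with
  | ofNat n => simpa using localModule_pow x n
  | negSucc n => rw [zpow_negSucc, zpow_negSucc, localModule_inv, localModule_pow]

@[simp] theorem localModule_neg (x : K) : localModule K (-x) = localModule K x := by
  have h : localModule K (-1 : K) = 1 := by
    have h1 : localModule K (-1 : K) * localModule K (-1 : K) = 1 := by
      rw [← localModule_mul]; simp
    nlinarith [localModule_nonneg (-1 : K)]
  rw [← neg_one_mul, localModule_mul, h, one_mul]

variable [MeasurableSpace K] [BorelSpace K] [SecondCountableTopology K]
  (μ : Measure K) [μ.IsAddHaarMeasure]

open scoped Pointwise in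
-- The preimage of `s` under `t * ·` is the dilate of `s` by the inverse unit, so the factor is the
-- Haar character of `t⁻¹`.
theorem map_mul_left {t : K} (ht : t ≠ 0) :
    μ.map (t * ·) = ENNReal.ofReal (localModule K t)⁻¹ • μ := by
  ext s hs
  rw [Measure.map_apply (measurable_const_mul t) hs, Measure.smul_apply, smul_eq_mul]
  have h := distribHaarChar_mul μ (Units.mk0 t ht)⁻¹ s
  have e : ((Units.mk0 t ht)⁻¹ : Kˣ) • s = (t * ·) ⁻¹' s := by
    ext x
    rw [Set.mem_inv_smul_set_iff]
    rfl
  rw [← e, ← h, map_inv, localModule_of_ne ht, ← NNReal.coe_inv, ENNReal.ofReal_coe_nnreal]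

theorem measurableEmbedding_mul_left {t : K} (ht : t ≠ 0) :
    MeasurableEmbedding (fun x : K => t * x) :=
  (Homeomorph.mulLeft₀ t ht).measurableEmbedding

theorem integral_comp_mul_smul {E : Type*} [NormedAddCommGroup E] [NormedSpace ℝ E] {t : K}
    (ht : t ≠ 0) (f : K → E) :
    ∫ x, f (t * x) ∂μ = (localModule K t)⁻¹ • ∫ x, f x ∂μ := by
  rw [← (measurableEmbedding_mul_left ht).integral_map, map_mul_left μ ht, integral_smul_measure,
    ENNReal.toReal_ofReal (inv_nonneg.2 (localModule_nonneg t))]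

theorem integral_comp_mul {t : K} (ht : t ≠ 0) (f : K → ℂ) :
    ∫ x, f (t * x) ∂μ = ((localModule K t)⁻¹ : ℝ) * ∫ x, f x ∂μ := by
  rw [integral_comp_mul_smul μ ht, Complex.real_smul]

theorem integrable_comp_mul {t : K} (ht : t ≠ 0) {f : K → ℂ} :
    Integrable (fun x => f (t * x)) μ ↔ Integrable f μ := by
  have h := (measurableEmbedding_mul_left ht).integrable_map_iff (μ := μ) (g := f)
  rw [map_mul_left μ ht, integrable_smul_measure] at h
  · exact h.symm
  · simpa using localModule_pos ht
  · simp

theorem lintegral_comp_mul {t : K} (ht : t ≠ 0) (f : K → ENNReal) :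
    ∫⁻ x, f (t * x) ∂μ = ENNReal.ofReal (localModule K t)⁻¹ * ∫⁻ x, f x ∂μ := by
  rw [← (measurableEmbedding_mul_left ht).lintegral_map, map_mul_left μ ht,
    lintegral_smul_measure, smul_eq_mul]

end ModuleBasics

/-! ### Multiplicative Haar measure: invariance under dilation and inversion. -/

section MulHaar

variable {K : Type*} [NormedField K] [LocallyCompactSpace K]
  [MeasurableSpace K] [BorelSpace K] [SecondCountableTopology K]
  (μ : Measure K) [μ.IsAddHaarMeasure] (hm : Measurable (localModule K))

include hm

theorem measurable_mulHaar_density (γ : ℝ) :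
    Measurable fun u : K => ENNReal.ofReal (γ / localModule K u) :=
  (measurable_const.div hm).ennreal_ofReal

theorem lintegral_mulHaar (γ : ℝ) {f : K → ENNReal} (hf : Measurable f) :
    ∫⁻ u, f u ∂(mulHaar μ γ) = ∫⁻ u, ENNReal.ofReal (γ / localModule K u) * f u ∂μ := by
  rw [mulHaar, lintegral_withDensity_eq_lintegral_mul _ (measurable_mulHaar_density hm γ) hf]
  rfl

theorem integrable_mulHaar_iff {γ : ℝ} (hγ : 0 ≤ γ) {f : K → ℂ} :
    Integrable f (mulHaar μ γ) ↔
      Integrable (fun u => ((γ / localModule K u : ℝ) : ℂ) * f u) μ := by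
  rw [mulHaar, integrable_withDensity_iff_integrable_smul' (measurable_mulHaar_density hm γ)
    (by simp)]
  refine integrable_congr (Filter.Eventually.of_forall fun u => ?_)
  dsimp only
  rw [ENNReal.toReal_ofReal (div_nonneg hγ (localModule_nonneg u)), Complex.real_smul]

theorem integral_mulHaar {γ : ℝ} (hγ : 0 ≤ γ) (f : K → ℂ) :
    ∫ u, f u ∂(mulHaar μ γ) = ∫ u, ((γ / localModule K u : ℝ) : ℂ) * f u ∂μ := by
  rw [mulHaar, integral_withDensity_eq_integral_toReal_smul (measurable_mulHaar_density hm γ)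
    (by simp)]
  refine integral_congr_ae (Filter.Eventually.of_forall fun u => ?_)
  dsimp only
  rw [ENNReal.toReal_ofReal (div_nonneg hγ (localModule_nonneg u)), Complex.real_smul]

theorem hasIntegralOn_mulHaar_iff {γ : ℝ} (hγ : 0 ≤ γ) {S : Set K} (hS : MeasurableSet S)
    {f : K → ℂ} {c : ℂ} :
    HasIntegralOn (mulHaar μ γ) S f c ↔
      HasIntegralOn μ S (fun u => ((γ / localModule K u : ℝ) : ℂ) * f u) c := by
  unfold HasIntegralOn
  rw [← integrable_indicator_iff hS, ← integrable_indicator_iff hS, ← integral_indicator hS,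
    ← integral_indicator hS, integrable_mulHaar_iff μ hm hγ, integral_mulHaar μ hm hγ]
  have : (fun u => ((γ / localModule K u : ℝ) : ℂ) * S.indicator f u) =
      S.indicator fun u => ((γ / localModule K u : ℝ) : ℂ) * f u := by
    ext u
    by_cases h : u ∈ S <;> simp [h]
  rw [this]

theorem lintegral_mulHaar_comp_mul (γ : ℝ) {t : K} (ht : t ≠ 0) {f : K → ENNReal}
    (hf : Measurable f) :
    ∫⁻ u, f (t * u) ∂(mulHaar μ γ) = ∫⁻ u, f u ∂(mulHaar μ γ) := by
  rw [lintegral_mulHaar μ hm γ hf,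
    lintegral_mulHaar μ hm γ (f := fun u => f (t * u)) (hf.comp (measurable_const_mul t))]
  have h := lintegral_comp_mul μ ht
    (fun u => ENNReal.ofReal (γ / localModule K u) * f u)
  have h0 := localModule_pos ht
  have h2 : ∀ u : K, ENNReal.ofReal (γ / localModule K u) * f (t * u) =
      ENNReal.ofReal (localModule K t) *
        (ENNReal.ofReal (γ / localModule K (t * u)) * f (t * u)) := by
    intro u
    rw [← mul_assoc, ← ENNReal.ofReal_mul h0.le, localModule_mul]
    congr 2
    rw [mul_div_assoc', mul_div_mul_left _ _ h0.ne']
  simp_rw [h2]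
  rw [lintegral_const_mul' _ _ ENNReal.ofReal_ne_top, h, ← mul_assoc,
    ← ENNReal.ofReal_mul h0.le, mul_inv_cancel₀ h0.ne', ENNReal.ofReal_one, one_mul]

theorem mulHaar_preimage_mul (γ : ℝ) {t : K} (ht : t ≠ 0) {S : Set K} (hS : MeasurableSet S) :
    mulHaar μ γ ((t * ·) ⁻¹' S) = mulHaar μ γ S := by
  have h := lintegral_mulHaar_comp_mul μ hm γ ht (f := S.indicator 1)
    (measurable_one.indicator hS)
  rw [lintegral_indicator_one hS] at h
  rw [← h, ← lintegral_indicator_one (measurable_const_mul t hS)]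
  rfl

theorem measurePreserving_mul_mulHaar (γ : ℝ) {t : K} (ht : t ≠ 0) :
    MeasurePreserving (t * ·) (mulHaar μ γ) (mulHaar μ γ) :=
  ⟨measurable_const_mul t, by
    ext S hS
    rw [Measure.map_apply (measurable_const_mul t) hS, mulHaar_preimage_mul μ hm γ ht hS]⟩

variable (h0 : μ {0} = 0)

include h0

/-- The uniqueness argument for Haar measure, made explicit: integrate `f x⁻¹ * g (x * y)` in both
orders. Integrating over `y` first splits off `∫ g`. In the other order, dilating `x` turns the
integrand into `f (y * x⁻¹) * g x`, and invariance in `y` gives `∫ f` times `∫ g`. The factor `∫ g`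
then cancels. -/
theorem lintegral_mulHaar_comp_inv {f : K → ENNReal} (hf : Measurable f) :
    ∫⁻ u, f u⁻¹ ∂(mulHaar μ 1) = ∫⁻ u, f u ∂(mulHaar μ 1) := by
  set ν := mulHaar μ 1 with hν
  have : SFinite ν := by rw [hν]; unfold mulHaar; infer_instance
  have hac : ∀ᵐ u ∂ν, u ≠ 0 := by
    have h1 : ∀ᵐ u ∂μ, u ≠ 0 := by simpa [ae_iff] using h0
    exact (withDensity_absolutelyContinuous μ _).ae_le h1
  obtain ⟨B, hBc, hB0⟩ := exists_compact_mem_nhds (0 : K)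
  have hBm : MeasurableSet B := hBc.isClosed.measurableSet
  -- The factor `|x|` cancels the density `1 / |x|`, so `∫ g dν = μ B`, which is positive and finite
  -- because `B` is a compact neighbourhood of `0`.
  let g : K → ENNReal := B.indicator fun x => ENNReal.ofReal (localModule K x)
  have hg : Measurable g := hm.ennreal_ofReal.indicator hBm
  have hgB : ∫⁻ u, g u ∂ν = μ B := by
    rw [hν, lintegral_mulHaar μ hm 1 hg, ← lintegral_indicator_one hBm]
    refine lintegral_congr_ae ?_
    have h1 : ∀ᵐ u ∂μ, u ≠ 0 := by simpa [ae_iff] using h0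
    filter_upwards [h1] with u hu
    by_cases h : u ∈ B
    · have := localModule_pos hu
      simp only [g, h, Set.indicator_of_mem, Pi.one_apply]
      rw [← ENNReal.ofReal_mul (by positivity), one_div, inv_mul_cancel₀ this.ne',
        ENNReal.ofReal_one]
    · simp [g, h]
  have hg0 : ∫⁻ u, g u ∂ν ≠ 0 := by
    rw [hgB]; exact (Measure.measure_pos_of_mem_nhds μ hB0).ne'
  have hgt : ∫⁻ u, g u ∂ν ≠ ⊤ := by
    rw [hgB]; exact hBc.measure_lt_top.ne
  have key : (∫⁻ x, f x⁻¹ ∂ν) * ∫⁻ y, g y ∂ν = (∫⁻ y, f y ∂ν) * ∫⁻ x, g x ∂ν := by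
    calc (∫⁻ x, f x⁻¹ ∂ν) * ∫⁻ y, g y ∂ν
        = ∫⁻ x, ∫⁻ y, f x⁻¹ * g (x * y) ∂ν ∂ν := by
          rw [← lintegral_mul_const _ (f := fun x => f x⁻¹) (hf.comp measurable_inv)]
          refine lintegral_congr_ae ?_
          filter_upwards [hac] with x hx
          rw [lintegral_const_mul _ (f := fun y => g (x * y)) (hg.comp (measurable_const_mul x)), hν,
            lintegral_mulHaar_comp_mul μ hm 1 hx hg]
      _ = ∫⁻ y, ∫⁻ x, f x⁻¹ * g (x * y) ∂ν ∂ν := by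
          refine lintegral_lintegral_swap (Measurable.aemeasurable ?_)
          exact (hf.comp (measurable_fst.inv)).mul (hg.comp measurable_mul)
      _ = ∫⁻ y, ∫⁻ x, f (y * x⁻¹) * g x ∂ν ∂ν := by
          refine lintegral_congr_ae ?_
          filter_upwards [hac] with y hy
          rw [hν, ← lintegral_mulHaar_comp_mul μ hm 1 hy (f := fun x => f (y * x⁻¹) * g x)
            ((hf.comp (measurable_const.mul measurable_inv)).mul hg)]
          refine lintegral_congr fun x => ?_
          by_cases hx : x = 0
          · simp [hx]
          · congr 2
            · field_simp
            · rw [mul_comm]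
      _ = ∫⁻ x, ∫⁻ y, f (y * x⁻¹) * g x ∂ν ∂ν := by
          refine lintegral_lintegral_swap (Measurable.aemeasurable ?_)
          exact (hf.comp (measurable_fst.mul measurable_snd.inv)).mul (hg.comp measurable_snd)
      _ = (∫⁻ y, f y ∂ν) * ∫⁻ x, g x ∂ν := by
          rw [← lintegral_const_mul _ hg]
          refine lintegral_congr_ae ?_
          filter_upwards [hac] with x hx
          rw [lintegral_mul_const _ (f := fun y => f (y * x⁻¹)) (hf.comp (measurable_id.mul_const _)), hν]
          simp_rw [mul_comm _ x⁻¹]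
          rw [lintegral_mulHaar_comp_mul μ hm 1 (inv_ne_zero hx) hf]
  exact (ENNReal.mul_left_inj hg0 hgt).1 key

theorem measurePreserving_inv_mulHaar :
    MeasurePreserving (fun u : K => u⁻¹) (mulHaar μ 1) (mulHaar μ 1) :=
  ⟨measurable_inv, by
    ext S hS
    rw [Measure.map_apply measurable_inv hS]
    have h := lintegral_mulHaar_comp_inv μ hm h0 (f := S.indicator 1) (measurable_one.indicator hS)
    rw [lintegral_indicator_one hS] at h
    rw [← h, ← lintegral_indicator_one (measurable_inv hS)]
    rfl⟩

/-- Inversion invariance of `du / |u|`, applied to `|u| f(u)`, produces the Jacobian `|u|⁻²` for the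
additive measure. -/
theorem integrable_comp_inv_iff {f : K → ℂ} :
    Integrable (fun u => f u⁻¹ * (((localModule K u)⁻¹ ^ 2 : ℝ) : ℂ)) μ ↔ Integrable f μ := by
  have e := (measurePreserving_inv_mulHaar μ hm h0).integrable_comp_emb
    (MeasurableEquiv.inv K).measurableEmbedding (g := fun u => (localModule K u : ℂ) * f u)
  rw [integrable_mulHaar_iff μ hm zero_le_one, integrable_mulHaar_iff μ hm zero_le_one] at e
  have hae : ∀ᵐ u ∂μ, u ≠ 0 := by simpa [ae_iff] using h0
  have e1 : (fun u => ((1 / localModule K u : ℝ) : ℂ) * ((localModule K u : ℂ) * f u)) =ᵐ[μ] f := by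
    filter_upwards [hae] with u hu
    have : (localModule K u : ℂ) ≠ 0 := by exact_mod_cast (localModule_pos hu).ne'
    push_cast
    field_simp
  rw [integrable_congr e1] at e
  rw [← e]
  refine integrable_congr (Filter.Eventually.of_forall fun u => ?_)
  simp only [Function.comp, localModule_inv]
  push_cast
  ring

theorem integral_comp_inv (f : K → ℂ) :
    ∫ u, f u⁻¹ * (((localModule K u)⁻¹ ^ 2 : ℝ) : ℂ) ∂μ = ∫ u, f u ∂μ := by
  have e := (measurePreserving_inv_mulHaar μ hm h0).integral_comp
    (MeasurableEquiv.inv K).measurableEmbedding (fun u => (localModule K u : ℂ) * f u)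
  rw [integral_mulHaar μ hm zero_le_one, integral_mulHaar μ hm zero_le_one] at e
  have hae : ∀ᵐ u ∂μ, u ≠ 0 := by simpa [ae_iff] using h0
  have e1 : (fun u => ((1 / localModule K u : ℝ) : ℂ) * ((localModule K u : ℂ) * f u)) =ᵐ[μ] f := by
    filter_upwards [hae] with u hu
    have : (localModule K u : ℂ) ≠ 0 := by exact_mod_cast (localModule_pos hu).ne'
    push_cast
    field_simp
  rw [integral_congr_ae e1] at e
  rw [← e]
  refine integral_congr_ae (Filter.Eventually.of_forall fun u => ?_)
  simp only [localModule_inv]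
  push_cast
  ring

/-- The map is inversion followed by the reflection `v ↦ 1 - v`. The reflection preserves `μ`, so
only inversion contributes a Jacobian. -/
theorem hasIntegralOn_comp_one_sub_inv {S : Set K} (hS : MeasurableSet S) {f : K → ℂ} {c : ℂ}
    (h : HasIntegralOn μ S f c) :
    HasIntegralOn μ {u | 1 - u⁻¹ ∈ S}
      (fun u => f (1 - u⁻¹) * (((localModule K u)⁻¹ ^ 2 : ℝ) : ℂ)) c := by
  have hmeas : Measurable fun u : K => 1 - u⁻¹ := measurable_const.sub measurable_inv
  have hS' : MeasurableSet {u : K | 1 - u⁻¹ ∈ S} := hmeas hS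
  unfold HasIntegralOn at h ⊢
  rw [← integrable_indicator_iff hS, ← integral_indicator hS] at h
  rw [← integrable_indicator_iff hS', ← integral_indicator hS']
  have e : {u : K | 1 - u⁻¹ ∈ S}.indicator
      (fun u => f (1 - u⁻¹) * (((localModule K u)⁻¹ ^ 2 : ℝ) : ℂ)) =
      fun u => (fun v => S.indicator f (1 - v)) u⁻¹ *
        (((localModule K u)⁻¹ ^ 2 : ℝ) : ℂ) := by
    ext u
    by_cases hu : 1 - u⁻¹ ∈ S <;> simp [hu]
  rw [e, integrable_comp_inv_iff μ hm h0 (f := fun v => S.indicator f (1 - v)),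
    integral_comp_inv μ hm h0 (fun v => S.indicator f (1 - v)),
    integral_sub_left_eq_self (S.indicator f)]
  exact ⟨h.1.comp_sub_left 1, h.2⟩

end MulHaar

/-! ### Holomorphy of `Δ_s` in vertical strips. -/

theorem abs_log_mul_rpow_le {m σ c η : ℝ} (hm : 0 < m) (hη : 0 < η) (hc : |c - σ| < η) :
    |Real.log m| * m ^ (c - 1) ≤
      η⁻¹ * (m ^ (σ + 2 * η - 1) + m ^ (σ - 2 * η - 1)) := by
  rw [abs_lt] at hc
  have hp1 := Real.rpow_pos_of_pos hm (σ + 2 * η - 1)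
  have hp2 := Real.rpow_pos_of_pos hm (σ - 2 * η - 1)
  have hp3 := Real.rpow_pos_of_pos hm (c - 1)
  have hη' := inv_pos.2 hη
  -- The logarithm costs one `η` in the exponent and moving from `σ` to `c` costs at most another,
  -- whence `σ ± 2η`. The sign depends on whether `m ≥ 1`.
  rcases le_total 1 m with h | h
  · rw [abs_of_nonneg (Real.log_nonneg h)]
    calc Real.log m * m ^ (c - 1) ≤ (m ^ η / η) * m ^ (c - 1) := by
          gcongr; exact Real.log_le_rpow_div hm.le hη
      _ = η⁻¹ * m ^ (η + (c - 1)) := by rw [Real.rpow_add hm]; ring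
      _ ≤ η⁻¹ * m ^ (σ + 2 * η - 1) := by gcongr; linarith
      _ ≤ _ := by gcongr; linarith
  · rw [abs_of_nonpos (Real.log_nonpos hm.le h), ← Real.log_inv]
    calc Real.log m⁻¹ * m ^ (c - 1) ≤ (m⁻¹ ^ η / η) * m ^ (c - 1) := by
          gcongr; exact Real.log_le_rpow_div (by positivity) hη
      _ = η⁻¹ * m ^ (-η + (c - 1)) := by
          rw [Real.rpow_add hm, Real.rpow_neg hm.le, Real.inv_rpow hm.le]; ring
      _ ≤ η⁻¹ * m ^ (σ - 2 * η - 1) := by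
          gcongr η⁻¹ * ?_
          exact Real.rpow_le_rpow_of_exponent_ge hm h (by linarith)
      _ ≤ _ := by gcongr; linarith

section Strip

variable {K : Type*} [NormedField K] [LocallyCompactSpace K]
  [MeasurableSpace K] [BorelSpace K] [SecondCountableTopology K]

/-- `Δ_s(ψ)` converges absolutely for `a < Re s < b`. -/
def ConvergesOn (μ : Measure K) (ψ : K → ℂ) (a b : ℝ) : Prop :=
  ∀ s : ℂ, a < s.re → s.re < b →
    Integrable (fun x => ψ x * (localModule K x : ℂ) ^ (s - 1)) μ

theorem norm_localModule_cpow {x : K} (hx : x ≠ 0) (s : ℂ) :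
    ‖(localModule K x : ℂ) ^ s‖ = localModule K x ^ s.re :=
  norm_cpow_eq_rpow_re_of_pos (localModule_pos hx) s

theorem measurable_localModule_cpow (hm : Measurable (localModule K)) (s : ℂ) :
    Measurable fun x : K => (localModule K x : ℂ) ^ s :=
  (measurable_ofReal.comp hm).pow_const s

theorem ae_ne_zero (μ : Measure K) (h0 : μ {0} = 0) : ∀ᵐ u ∂μ, u ≠ 0 := by
  simpa [ae_iff] using h0

variable (μ : Measure K) [μ.IsAddHaarMeasure]

/-- Differentiation under the integral. On a disc of radius `η` around `s₀` the derivative is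
dominated by the integrands at the two real points `Re s₀ ± 2η`, which still lie in the strip when
`η` is a third of the distance to its edges. -/
theorem ConvergesOn.hasDerivAt {μ : Measure K} {ψ : K → ℂ} {a b : ℝ} (h : ConvergesOn μ ψ a b)
    (hm : Measurable (localModule K)) (h0 : μ {0} = 0) {s₀ : ℂ} (ha : a < s₀.re)
    (hb : s₀.re < b) :
    Integrable (fun x => (ψ x * (localModule K x : ℂ) ^ (s₀ - 1)) *
      (Real.log (localModule K x) : ℂ)) μ ∧
    HasDerivAt (fun s => Delta μ s ψ) (∫ x, (ψ x * (localModule K x : ℂ) ^ (s₀ - 1)) *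
      (Real.log (localModule K x) : ℂ) ∂μ) s₀ := by
  obtain ⟨η, hη, hη1, hη2⟩ : ∃ η > 0, a < s₀.re - 2 * η ∧ s₀.re + 2 * η < b := by
    refine ⟨min (s₀.re - a) (b - s₀.re) / 3, by
      have : 0 < min (s₀.re - a) (b - s₀.re) := lt_min (by linarith) (by linarith)
      positivity, ?_, ?_⟩
    · linarith [min_le_left (s₀.re - a) (b - s₀.re), min_le_right (s₀.re - a) (b - s₀.re)]
    · linarith [min_le_left (s₀.re - a) (b - s₀.re), min_le_right (s₀.re - a) (b - s₀.re)]
  have hre : ∀ s ∈ Metric.ball s₀ η, |s.re - s₀.re| < η := fun s hs => by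
    rw [Metric.mem_ball, dist_eq] at hs
    exact (by simpa using abs_re_le_norm (s - s₀) : |s.re - s₀.re| ≤ ‖s - s₀‖).trans_lt hs
  have hae : ∀ᵐ u ∂μ, u ≠ 0 := ae_ne_zero μ h0
  unfold Delta
  refine hasDerivAt_integral_of_dominated_loc_of_deriv_le (s := Metric.ball s₀ η)
    (F' := fun s x => (ψ x * (localModule K x : ℂ) ^ (s - 1)) *
      (Real.log (localModule K x) : ℂ))
    (bound := fun x => η⁻¹ *
      (‖ψ x * (localModule K x : ℂ) ^ (((s₀.re + 2 * η : ℝ) : ℂ) - 1)‖ +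
        ‖ψ x * (localModule K x : ℂ) ^ (((s₀.re - 2 * η : ℝ) : ℂ) - 1)‖))
    (Metric.ball_mem_nhds s₀ hη) ?_ (h s₀ ha hb) ?_ ?_ ?_ ?_
  · filter_upwards [Metric.ball_mem_nhds s₀ hη] with s hs
    have := abs_lt.1 (hre s hs)
    exact (h s (by linarith) (by linarith)).aestronglyMeasurable
  · exact (h s₀ ha hb).aestronglyMeasurable.mul
      (measurable_ofReal.comp (Real.measurable_log.comp hm)).aestronglyMeasurable
  · filter_upwards [hae] with x hx s hs
    have := abs_log_mul_rpow_le (localModule_pos hx) hη (hre s hs)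
    simp only [norm_mul, norm_localModule_cpow hx, sub_re, ofReal_re, one_re, norm_real,
      Real.norm_eq_abs]
    calc ‖ψ x‖ * localModule K x ^ (s.re - 1) * |Real.log (localModule K x)|
        = ‖ψ x‖ * (|Real.log (localModule K x)| * localModule K x ^ (s.re - 1)) := by ring
      _ ≤ ‖ψ x‖ * _ := mul_le_mul_of_nonneg_left this (norm_nonneg _)
      _ = _ := by ring
  · refine ((h _ ?_ ?_).norm.add (h _ ?_ ?_).norm).const_mul _ <;> simp only [ofReal_re] <;>
      linarith
  · filter_upwards [hae] with x hx s _
    have hx' : (localModule K x : ℂ) ≠ 0 := by exact_mod_cast (localModule_pos hx).ne'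
    have h1 : HasDerivAt (fun s : ℂ => s - 1) 1 s := (hasDerivAt_id s).sub_const 1
    have := (h1.const_cpow (c := (localModule K x : ℂ)) (Or.inl hx')).const_mul (ψ x)
    refine this.congr_deriv ?_
    rw [ofReal_log (localModule_nonneg x)]
    ring

theorem ConvergesOn.analyticAt {μ : Measure K} {ψ : K → ℂ} {a b : ℝ} (h : ConvergesOn μ ψ a b)
    (hm : Measurable (localModule K)) (h0 : μ {0} = 0) {s₀ : ℂ} (ha : a < s₀.re)
    (hb : s₀.re < b) : AnalyticAt ℂ (fun s => Delta μ s ψ) s₀ := by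
  have ho : IsOpen {s : ℂ | a < s.re ∧ s.re < b} :=
    (isOpen_lt continuous_const continuous_re).inter (isOpen_lt continuous_re continuous_const)
  have hd : DifferentiableOn ℂ (fun s => Delta μ s ψ) {s : ℂ | a < s.re ∧ s.re < b} :=
    fun s hs => (h.hasDerivAt hm h0 hs.1 hs.2).2.differentiableAt.differentiableWithinAt
  exact hd.analyticAt (ho.mem_nhds ⟨ha, hb⟩)

theorem ConvergesOn.mono {ψ : K → ℂ} {a b a' b' : ℝ} (h : ConvergesOn μ ψ a b) (ha : a ≤ a')
    (hb : b' ≤ b) : ConvergesOn μ ψ a' b' :=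
  fun s h1 h2 => h s (ha.trans_lt h1) (h2.trans_le hb)

/-- The size of `|x|`-balls around `0`, as recorded by the Laurent expansion of `Δ_s` at the
characteristic function of `{|x| ≤ 1}`. -/
structure HasModuleResidue (μ : Measure K) (R : ℝ) (c₀ : ℂ) : Prop where
  measurable : Measurable (localModule K)
  null_zero : μ {0} = 0
  pos : 0 < R
  integrable : ∀ s : ℂ, 0 < s.re →
    Integrable (fun x : K => omegaInt x * (localModule K x : ℂ) ^ (s - 1)) μ
  laurent : HasLaurent μ (omegaInt : K → ℂ) R c₀

theorem omegaInt_of_le {x : K} (h : localModule K x ≤ 1) : omegaInt x = 1 := by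
  simp [omegaInt, h]

theorem omegaInt_of_lt {x : K} (h : 1 < localModule K x) : omegaInt x = 0 := by
  simp [omegaInt, h]

@[simp] theorem omegaInt_zero : omegaInt (0 : K) = 1 := omegaInt_of_le (by simp)

theorem measurable_omegaInt (hm : Measurable (localModule K)) :
    Measurable (omegaInt : K → ℂ) :=
  measurable_one.indicator (measurableSet_le hm measurable_const)

variable {μ} {R : ℝ} {c₀ : ℂ} (H : HasModuleResidue μ R c₀)

include H

/-- Inversion exchanges `|x| > 1` with `|x| < 1` and replaces the exponent `s` by `-s`. -/
theorem HasModuleResidue.integrable_outer {s : ℂ} (hs : s.re < 0) :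
    Integrable (fun x : K => (1 - omegaInt x) * (localModule K x : ℂ) ^ (s - 1)) μ := by
  have h := (integrable_comp_inv_iff μ H.measurable H.null_zero).2 (H.integrable (-s) (by simpa))
  refine (h.norm).mono' ?_ ?_
  · exact ((measurable_const.sub (measurable_omegaInt H.measurable)).mul
      (measurable_localModule_cpow H.measurable _)).aestronglyMeasurable
  · filter_upwards [ae_ne_zero μ H.null_zero] with x hx
    have hp := localModule_pos hx
    rcases le_or_gt (localModule K x) 1 with h1 | h1
    · simp only [omegaInt_of_le h1, sub_self, zero_mul, norm_zero, norm_nonneg]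
    · have h2 : localModule K x⁻¹ ≤ 1 := by
        rw [localModule_inv]; exact inv_le_one_of_one_le₀ h1.le
      rw [omegaInt_of_lt h1, omegaInt_of_le h2, sub_zero, one_mul, one_mul, norm_mul,
        norm_localModule_cpow hx, norm_localModule_cpow (inv_ne_zero hx), localModule_inv,
        norm_real, Real.norm_of_nonneg (by positivity), ← Real.rpow_neg_one (localModule K x),
        ← Real.rpow_mul hp.le, ← Real.rpow_natCast (localModule K x ^ (-1 : ℝ)),
        ← Real.rpow_mul hp.le, ← Real.rpow_add hp]
      apply le_of_eq
      congr 1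
      simp
      ring

/-- Comparison with the model integrals: inside the unit ball with exponent `s + α`, outside with
exponent `s - β`. -/
theorem HasModuleResidue.convergesOn_of_bounds {ψ : K → ℂ} (hψ : AEStronglyMeasurable ψ μ)
    {C α β : ℝ} (h1 : ∀ x, x ≠ 0 → localModule K x ≤ 1 → ‖ψ x‖ ≤ C * localModule K x ^ α)
    (h2 : ∀ x, 1 < localModule K x → ‖ψ x‖ ≤ C * localModule K x ^ (-β)) :
    ConvergesOn μ ψ (-α) β := by
  intro s ha hb
  have i1 := (H.integrable (s + (α : ℂ)) (by simp; linarith)).norm.const_mul C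
  have i2 := (H.integrable_outer (s := s - (β : ℂ)) (by simp; linarith)).norm.const_mul C
  refine (i1.add i2).mono' (hψ.mul
    (measurable_localModule_cpow H.measurable _).aestronglyMeasurable) ?_
  filter_upwards [ae_ne_zero μ H.null_zero] with x hx
  have hp := localModule_pos hx
  simp only [Pi.add_apply, norm_mul, norm_localModule_cpow hx]
  rcases le_or_gt (localModule K x) 1 with h | h
  · rw [omegaInt_of_le h, sub_self, norm_zero, zero_mul, mul_zero, add_zero, norm_one, one_mul]
    have e : (s + (α : ℂ) - 1).re = α + (s - 1).re := by simp; ring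
    rw [e, Real.rpow_add hp, ← mul_assoc]
    gcongr
    exact h1 x hx h
  · rw [omegaInt_of_lt h, sub_zero, norm_zero, zero_mul, mul_zero, zero_add, norm_one, one_mul]
    have e : (s - (β : ℂ) - 1).re = -β + (s - 1).re := by simp; ring
    rw [e, Real.rpow_add hp, ← mul_assoc]
    gcongr
    exact h2 x h

end Strip

/-! ### The pole at `s = 0` and the finite part. -/

section Laurent

variable {K : Type*} [NormedField K] [LocallyCompactSpace K]
  [MeasurableSpace K] [BorelSpace K] [SecondCountableTopology K]
  {μ : Measure K} [μ.IsAddHaarMeasure] {R : ℝ} {c₀ : ℂ}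

/-- `φ - φ(0) · 1_{|x| ≤ 1}` can be integrated against `|x|^(s-1)` for `|Re s| < ε`. -/
def Admissible (μ : Measure K) (φ : K → ℂ) (ε : ℝ) : Prop :=
  0 < ε ∧ ConvergesOn μ (fun x => φ x - φ 0 * omegaInt x) (-ε) ε

/-- This identifies `P_w(φ)` with the value at `s = 0` of `Δ_s(φ - φ(0) w)`. It also holds at `x =
0`, where both sides are `0` by convention. -/
theorem PIntegrand_eq (w φ : K → ℂ) (x : K) :
    PIntegrand w φ x = (φ x - φ 0 * w x) * (localModule K x : ℂ) ^ ((0 : ℂ) - 1) := by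
  rw [PIntegrand, zero_sub, cpow_neg_one, div_eq_mul_inv]

theorem Admissible.integrable_PIntegrand {φ : K → ℂ} {ε : ℝ} (h : Admissible μ φ ε) :
    Integrable (PIntegrand omegaInt φ) μ := by
  have := h.2 0 (by simpa using h.1) (by simpa using h.1)
  exact this.congr (Filter.Eventually.of_forall fun x => (PIntegrand_eq _ _ x).symm)

theorem PIntegrand_sub {w φ : K → ℂ} (hw : w 0 = 1) (x : K) :
    PIntegrand w φ x = PIntegrand omegaInt φ x - φ 0 * PIntegrand omegaInt w x := by
  simp only [PIntegrand, hw]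
  ring

theorem integrable_PIntegrand {w φ : K → ℂ} (hw : w 0 = 1) {ε ε' : ℝ} (h : Admissible μ w ε)
    (h' : Admissible μ φ ε') : Integrable (PIntegrand w φ) μ :=
  (h'.integrable_PIntegrand.sub (h.integrable_PIntegrand.const_mul (φ 0))).congr
    (Filter.Eventually.of_forall fun x => (PIntegrand_sub hw x).symm)

theorem P_eq_sub {w φ : K → ℂ} (hw : w 0 = 1) {ε ε' : ℝ} (h : Admissible μ w ε)
    (h' : Admissible μ φ ε') : P μ w φ = P μ omegaInt φ - φ 0 * P μ omegaInt w := by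
  unfold P
  rw [← integral_const_mul, ← integral_sub h'.integrable_PIntegrand
    (h.integrable_PIntegrand.const_mul (φ 0))]
  exact integral_congr_ae (Filter.Eventually.of_forall fun x => PIntegrand_sub hw x)

theorem Admissible.integrable {φ : K → ℂ} {ε : ℝ} (h : Admissible μ φ ε)
    (H : HasModuleResidue μ R c₀) : ConvergesOn μ φ 0 ε := by
  intro s hs hs'
  have i1 := h.2 s (by linarith) hs'
  have i2 := (H.integrable s hs).const_mul (φ 0)
  refine (i1.add i2).congr (Filter.Eventually.of_forall fun x => ?_)
  simp only [Pi.add_apply]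
  ring

/-- In `φ = (φ - φ(0) ω) + φ(0) ω` the second term carries the whole pole. The first contributes a
function analytic at `0`, with value `P_ω(φ)` there. -/
theorem Admissible.hasLaurent {φ : K → ℂ} {ε : ℝ} (h : Admissible μ φ ε)
    (H : HasModuleResidue μ R c₀) :
    HasLaurent μ φ (R * φ 0) (P μ omegaInt φ + c₀ * φ 0) := by
  obtain ⟨E, hE, hE0, hEs⟩ := H.laurent
  refine ⟨fun s => Delta μ s (fun x => φ x - φ 0 * omegaInt x) + E s * φ 0, ?_, ?_, ?_⟩
  · exact (h.2.analyticAt H.measurable H.null_zero (by simpa using h.1)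
      (by simpa using h.1)).add (hE.mul analyticAt_const)
  · simp only [hE0, P, Delta, PIntegrand_eq]
  · have hn : ∀ᶠ s : ℂ in nhds 0, s.re < ε :=
      (continuous_re.tendsto 0).eventually (gt_mem_nhds (by simpa using h.1))
    filter_upwards [hEs, hn] with s h1 h2 h3
    have i1 := h.2 s (by linarith [h.1]) h2
    have i2 := (H.integrable s h3).const_mul (φ 0)
    have e : Delta μ s φ = Delta μ s (fun x => φ x - φ 0 * omegaInt x) +
        φ 0 * Delta μ s omegaInt := by
      unfold Delta
      rw [← integral_const_mul, ← integral_add i1 i2]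
      refine integral_congr_ae (Filter.Eventually.of_forall fun x => ?_)
      dsimp only
      ring
    rw [e, h1 h3]
    ring

theorem tendsto_ofReal_nhdsGT_zero :
    Filter.Tendsto (fun t : ℝ => (t : ℂ)) (nhdsWithin 0 (Set.Ioi 0)) (nhds 0) := by
  have : Filter.Tendsto (fun t : ℝ => (t : ℂ)) (nhds 0) (nhds 0) := by
    simpa using (continuous_ofReal.tendsto (0 : ℝ))
  exact this.mono_left nhdsWithin_le_nhds

/-- Both regular parts agree on small positive reals, and they are continuous at `0`. -/
theorem HasLaurent.unique {φ : K → ℂ} {r c c' : ℂ} (h : HasLaurent μ φ r c)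
    (h' : HasLaurent μ φ r c') : c = c' := by
  obtain ⟨E, hE, rfl, hEs⟩ := h
  obtain ⟨E', hE', rfl, hEs'⟩ := h'
  have ht := tendsto_ofReal_nhdsGT_zero
  refine tendsto_nhds_unique (hE.continuousAt.tendsto.comp ht)
    ((hE'.continuousAt.tendsto.comp ht).congr' ?_)
  filter_upwards [ht.eventually hEs, ht.eventually hEs', self_mem_nhdsWithin] with t h1 h2 h3
  have h3' : 0 < (t : ℂ).re := by simpa using h3
  have := (h2 h3').symm.trans (h1 h3')
  simpa using this

/-- Comparison of the derivatives at `s = 1` of two functions that are related by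
`A₁(s) Δ_{1-s}(f₂) = A₂(s) Δ_{1-s}(f₁)`. -/
theorem deriv_relation {f₁ f₂ : K → ℂ} {A₁ A₂ : ℂ → ℂ} {G₁ G₂ r₁ r₂ c₁ c₂ : ℂ}
    (h₁ : HasLaurent μ f₁ r₁ c₁) (h₂ : HasLaurent μ f₂ r₂ c₂)
    (hA₁ : HasDerivAt A₁ (-G₁) 1) (hA₂ : HasDerivAt A₂ (-G₂) 1)
    (h : ∀ᶠ s : ℂ in nhds 0, 0 < s.re →
      A₁ (1 - s) * Delta μ s f₂ = A₂ (1 - s) * Delta μ s f₁) :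
    G₁ * r₂ + A₁ 1 * c₂ = G₂ * r₁ + A₂ 1 * c₁ := by
  obtain ⟨E₁, hE₁, rfl, hs₁⟩ := h₁
  obtain ⟨E₂, hE₂, rfl, hs₂⟩ := h₂
  -- `D` is the difference of the two sides with the pole multiplied out. It is known to vanish only
  -- for `Re s > 0`, but it is differentiable at `0`, so its derivative there is its right
  -- derivative along the reals, which is `0`.
  let D : ℂ → ℂ := fun s => A₁ (1 - s) * (r₂ + s * E₂ s) - A₂ (1 - s) * (r₁ + s * E₁ s)
  have hD0 : ∀ᶠ t : ℝ in nhdsWithin 0 (Set.Ioi 0), D t = 0 := by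
    have ht := tendsto_ofReal_nhdsGT_zero
    filter_upwards [ht.eventually h, ht.eventually hs₁, ht.eventually hs₂,
      self_mem_nhdsWithin] with t k k1 k2 k3
    have k3' : 0 < (t : ℂ).re := by simpa using k3
    have k4 : (t : ℂ) ≠ 0 := by
      have : (0 : ℝ) < t := k3
      exact_mod_cast this.ne'
    have := k k3'
    rw [k1 k3', k2 k3'] at this
    have e1 : r₂ + (t : ℂ) * E₂ t = t * (r₂ / t + E₂ t) := by field_simp
    have e2 : r₁ + (t : ℂ) * E₁ t = t * (r₁ / t + E₁ t) := by field_simp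
    simp only [D, e1, e2]
    linear_combination (t : ℂ) * this
  have d0 : HasDerivAt (fun s : ℂ => 1 - s) (-1) 0 := (hasDerivAt_id (0 : ℂ)).const_sub 1
  have d1 : HasDerivAt (fun s => A₁ (1 - s)) (-G₁ * -1) 0 :=
    HasDerivAt.comp (0 : ℂ) (by simpa using hA₁) d0
  have d2 : HasDerivAt (fun s => A₂ (1 - s)) (-G₂ * -1) 0 :=
    HasDerivAt.comp (0 : ℂ) (by simpa using hA₂) d0
  have d3 : HasDerivAt (fun s => r₂ + s * E₂ s) (1 * E₂ 0 + 0 * deriv E₂ 0) 0 :=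
    ((hasDerivAt_id (0 : ℂ)).mul hE₂.differentiableAt.hasDerivAt).const_add r₂
  have d4 : HasDerivAt (fun s => r₁ + s * E₁ s) (1 * E₁ 0 + 0 * deriv E₁ 0) 0 :=
    ((hasDerivAt_id (0 : ℂ)).mul hE₁.differentiableAt.hasDerivAt).const_add r₁
  have hD : HasDerivAt D _ 0 := (d1.mul d3).sub (d2.mul d4)
  have hDr : HasDerivWithinAt (fun t : ℝ => D t) _ (Set.Ioi 0) 0 :=
    (HasDerivAt.comp_ofReal (by simpa using hD)).hasDerivWithinAt
  have hD00 : D 0 = 0 := by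
    have ht : Filter.Tendsto (fun t : ℝ => D t) (nhdsWithin 0 (Set.Ioi 0)) (nhds (D 0)) :=
      hD.continuousAt.tendsto.comp tendsto_ofReal_nhdsGT_zero
    exact tendsto_nhds_unique ht (tendsto_const_nhds.congr' (by
      filter_upwards [hD0] with t ht using ht.symm))
  have hz : HasDerivWithinAt (fun t : ℝ => D t) 0 (Set.Ioi 0) 0 :=
    (hasDerivWithinAt_const (0 : ℝ) (Set.Ioi 0) (0 : ℂ)).congr_of_eventuallyEq hD0
      (by simpa using hD00)
  have := (uniqueDiffWithinAt_Ioi (0 : ℝ)).eq_deriv _ hDr hz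
  linear_combination this

end Laurent

/-! ### Tate's local functional equation. -/

section Tate

variable {K : Type*} [NormedField K] [LocallyCompactSpace K]
  [MeasurableSpace K] [BorelSpace K] [SecondCountableTopology K]
  {μ : Measure K} [μ.IsAddHaarMeasure] {lam : K → ℂ}

theorem measurable_fourier (hl : Measurable lam) {f : K → ℂ} (hf : Measurable f) :
    Measurable (fourier lam μ f) := by
  have : StronglyMeasurable (Function.uncurry fun y x : K => f x * lam (x * y)) := by
    apply Measurable.stronglyMeasurable
    exact (hf.comp measurable_snd).mul (hl.comp (measurable_snd.mul measurable_fst))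
  exact (this.integral_prod_right).measurable

/-- Fubini for the kernel `f(z) g(y) λ(x y z)`, which is symmetric in the two functions. -/
theorem integral_mul_fourier_comm (hl : Measurable lam) (hl1 : ∀ x, ‖lam x‖ ≤ 1)
    {f g : K → ℂ} (hf : Integrable f μ) (hg : Integrable g μ) (x : K) :
    ∫ y, g y * fourier lam μ f (y * x) ∂μ = ∫ y, f y * fourier lam μ g (y * x) ∂μ := by
  unfold fourier
  simp_rw [← integral_const_mul]
  rw [integral_integral_swap]
  · refine integral_congr_ae (Filter.Eventually.of_forall fun z =>
      integral_congr_ae (Filter.Eventually.of_forall fun y => ?_))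
    dsimp only
    rw [show z * (y * x) = y * (z * x) by ring]
    ring
  · refine ((hg.mul_prod hf).norm).mono' ?_ (Filter.Eventually.of_forall fun z => ?_)
    · refine (hg.aestronglyMeasurable.comp_fst).mul ((hf.aestronglyMeasurable.comp_snd).mul ?_)
      exact (hl.comp (measurable_snd.mul
        (measurable_fst.mul_const x))).aestronglyMeasurable
    · simp only [Function.uncurry, norm_mul]
      calc _ ≤ ‖g z.1‖ * (‖f z.2‖ * 1) := by gcongr; exact hl1 _
        _ = _ := by ring

/-- For fixed `y ≠ 0`, a dilation gives `∫ F(y x) |x|^(s-1) dx = |y|^(-s) Δ_s(F)`. Integrating this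
against `g(y)` produces the factor `Δ_{1-s}(g)`, and Fubini exchanges the two integrals. -/
theorem Delta_mul_Delta (hm : Measurable (localModule K)) (h0 : μ {0} = 0)
    {F g : K → ℂ} (hF : Measurable F) {s : ℂ} (hg : Measurable g)
    (h1 : Integrable (fun x => F x * (localModule K x : ℂ) ^ (s - 1)) μ)
    (h2 : Integrable (fun x => g x * (localModule K x : ℂ) ^ ((1 - s) - 1)) μ) :
    Delta μ s F * Delta μ (1 - s) g =
      ∫ x, (localModule K x : ℂ) ^ (s - 1) * ∫ y, g y * F (y * x) ∂μ ∂μ := by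
  have hscale : ∀ y : K, y ≠ 0 → ∀ x, F (y * x) * (localModule K x : ℂ) ^ (s - 1) =
      (localModule K y : ℂ) ^ (1 - s) *
        (F (y * x) * (localModule K (y * x) : ℂ) ^ (s - 1)) := by
    intro y hy x
    have hy' : (localModule K y : ℂ) ≠ 0 := by exact_mod_cast (localModule_pos hy).ne'
    rw [localModule_mul, ofReal_mul, mul_cpow_ofReal_nonneg (localModule_nonneg y)
      (localModule_nonneg x)]
    have : (localModule K y : ℂ) ^ (1 - s) * (localModule K y : ℂ) ^ (s - 1) = 1 := by
      rw [← cpow_add _ _ hy']; simp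
    linear_combination (-(F (y * x) * (localModule K x : ℂ) ^ (s - 1))) * this
  have hpow : ∀ y : K, y ≠ 0 → (localModule K y : ℂ) ^ (1 - s) * (((localModule K y)⁻¹ : ℝ) : ℂ) =
      (localModule K y : ℂ) ^ ((1 - s) - 1) := by
    intro y hy
    have hy' : (localModule K y : ℂ) ≠ 0 := by exact_mod_cast (localModule_pos hy).ne'
    rw [cpow_sub (1 - s) 1 hy', cpow_one, ofReal_inv, div_eq_mul_inv]
  have hae := ae_ne_zero μ h0
  have hint : Integrable (Function.uncurry fun y x : K =>
      g y * F (y * x) * (localModule K x : ℂ) ^ (s - 1)) (μ.prod μ) := by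
    rw [integrable_prod_iff]
    · constructor
      · filter_upwards [hae] with y hy
        simp only [Function.uncurry, mul_assoc, hscale y hy]
        exact (((integrable_comp_mul μ hy (f := fun x =>
          F x * (localModule K x : ℂ) ^ (s - 1))).2 h1).const_mul _).const_mul _
      · refine (h2.norm.mul_const
          (∫ x, ‖F x * (localModule K x : ℂ) ^ (s - 1)‖ ∂μ)).congr ?_
        filter_upwards [hae] with y hy
        simp only [Function.uncurry, mul_assoc, hscale y hy]
        simp only [norm_mul (g y), norm_mul ((localModule K y : ℂ) ^ (1 - s))]
        rw [integral_const_mul, integral_const_mul, integral_comp_mul_smul μ hy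
          (fun x => ‖F x * (localModule K x : ℂ) ^ (s - 1)‖), ← hpow y hy, norm_mul, norm_real,
          Real.norm_of_nonneg (inv_nonneg.2 (localModule_nonneg y)), smul_eq_mul]
        ring
    · exact (((hg.comp measurable_fst).mul (hF.comp measurable_mul)).mul
        ((measurable_localModule_cpow hm _).comp measurable_snd)).aestronglyMeasurable
  calc Delta μ s F * Delta μ (1 - s) g
      = ∫ y, ∫ x, g y * F (y * x) * (localModule K x : ℂ) ^ (s - 1) ∂μ ∂μ := by
        rw [mul_comm]
        unfold Delta
        rw [← integral_mul_const]
        refine integral_congr_ae ?_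
        filter_upwards [hae] with y hy
        simp only [mul_assoc, hscale y hy]
        rw [integral_const_mul, integral_const_mul, integral_comp_mul μ hy
          (fun x => F x * (localModule K x : ℂ) ^ (s - 1)), ← hpow y hy]
        ring
    _ = ∫ x, ∫ y, g y * F (y * x) * (localModule K x : ℂ) ^ (s - 1) ∂μ ∂μ :=
        integral_integral_swap hint
    _ = _ := by
        refine integral_congr_ae (Filter.Eventually.of_forall fun x => ?_)
        dsimp only
        rw [integral_mul_const, mul_comm]

/-- By `Delta_mul_Delta` each side is the integral of `|x|^(s-1)` against an inner integral. The two
inner integrals agree by `integral_mul_fourier_comm`. -/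
theorem functional_equation (hm : Measurable (localModule K)) (h0 : μ {0} = 0)
    (hl : Measurable lam) (hl1 : ∀ x, ‖lam x‖ ≤ 1) {f g : K → ℂ} (hfm : Measurable f)
    (hgm : Measurable g) (hf : Integrable f μ) (hg : Integrable g μ) {s : ℂ}
    (f1 : Integrable (fun x => fourier lam μ f x * (localModule K x : ℂ) ^ (s - 1)) μ)
    (g1 : Integrable (fun x => fourier lam μ g x * (localModule K x : ℂ) ^ (s - 1)) μ)
    (f2 : Integrable (fun x => f x * (localModule K x : ℂ) ^ ((1 - s) - 1)) μ)
    (g2 : Integrable (fun x => g x * (localModule K x : ℂ) ^ ((1 - s) - 1)) μ) :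
    Delta μ s (fourier lam μ f) * Delta μ (1 - s) g =
      Delta μ s (fourier lam μ g) * Delta μ (1 - s) f := by
  rw [Delta_mul_Delta hm h0 (measurable_fourier hl hfm) hgm f1 g2,
    Delta_mul_Delta hm h0 (measurable_fourier hl hgm) hfm g1 f2]
  simp_rw [integral_mul_fourier_comm hl hl1 hf hg]

end Tate

/-! ### The formula for `G` from an auxiliary function. -/

section Uniform

variable {K : Type*} [NormedField K] [LocallyCompactSpace K]
  [MeasurableSpace K] [BorelSpace K] [SecondCountableTopology K]
  {μ : Measure K} [μ.IsAddHaarMeasure] {lam : K → ℂ} {T : Set (K → ℂ)} {R : ℝ} {c₀ : ℂ}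

/-- The properties of the character, the self-dual measure and the space of test functions that
the proof of the uniform formula uses. -/
structure IsTestSpace (lam : K → ℂ) (μ : Measure K) (T : Set (K → ℂ)) : Prop where
  measurable_char : Measurable lam
  norm_char : ∀ x, ‖lam x‖ ≤ 1
  char_zero : lam 0 = 1
  measurable : ∀ φ ∈ T, Measurable φ
  fourier_mem : ∀ φ ∈ T, fourier lam μ φ ∈ T
  convergesOn : ∀ φ ∈ T, ∀ b, ConvergesOn μ φ 0 b
  admissible : ∀ φ ∈ T, ∃ ε, Admissible μ φ ε
  self_dual : IsSelfDual lam μ T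

variable (hT : IsTestSpace lam μ T) (H : HasModuleResidue μ R c₀)

include hT

theorem IsTestSpace.integrable {φ : K → ℂ} (hφ : φ ∈ T) : Integrable φ μ := by
  simpa using hT.convergesOn φ hφ 2 1 (by simp) (by simp)

/-- At `s = 1` the weight is `1`, so this is Fourier inversion at the origin. -/
theorem IsTestSpace.Delta_fourier_one {φ : K → ℂ} (hφ : φ ∈ T) :
    Delta μ 1 (fourier lam μ φ) = φ 0 := by
  have := hT.self_dual φ hφ 0
  rw [fourier] at this
  simpa [Delta, hT.char_zero] using this

include H

theorem IsTestSpace.integrable_G {φ : K → ℂ} (hφ : φ ∈ T) : Integrable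
    (fun y => ((-Real.log (localModule K y) : ℝ) : ℂ) * fourier lam μ φ y) μ := by
  have := ((hT.convergesOn _ (hT.fourier_mem φ hφ) 2).hasDerivAt H.measurable H.null_zero
    (s₀ := 1) (by simp) (by simp)).1
  refine this.neg.congr (Filter.Eventually.of_forall fun x => ?_)
  simp [mul_comm]

theorem IsTestSpace.hasDerivAt_Delta_fourier {φ : K → ℂ} (hφ : φ ∈ T) :
    HasDerivAt (fun s => Delta μ s (fourier lam μ φ)) (-G lam μ φ) 1 := by
  refine ((hT.convergesOn _ (hT.fourier_mem φ hφ) 2).hasDerivAt H.measurable H.null_zero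
    (s₀ := 1) (by simp) (by simp)).2.congr_deriv ?_
  rw [G, ← integral_neg]
  refine integral_congr_ae (Filter.Eventually.of_forall fun x => ?_)
  simp [mul_comm]

/-- Here `A` plays the role of `s ↦ Δ_s(w~)`. Only its value and derivative at `1` enter, so `w`
need not be a test function. The difference of the finite parts of `φ` and of `φ(0) w` is `P_w(φ)`.
-/
theorem IsTestSpace.G_eq_of_relation {φ w : K → ℂ} (hφ : φ ∈ T) (hw : w 0 = 1) {ε : ℝ}
    (hwa : Admissible μ w ε) {A : ℂ → ℂ} {g : ℂ} (hA : HasDerivAt A (-g) 1) (hA1 : A 1 = 1)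
    (h : ∀ᶠ s : ℂ in nhds 0, 0 < s.re →
      Delta μ (1 - s) (fourier lam μ φ) * Delta μ s w = A (1 - s) * Delta μ s φ) :
    G lam μ φ = ((1 / R : ℝ) : ℂ) * P μ w φ + g * φ 0 := by
  obtain ⟨ε', hφa⟩ := hT.admissible φ hφ
  have key := deriv_relation (hφa.hasLaurent H) (hwa.hasLaurent H)
    (hT.hasDerivAt_Delta_fourier H hφ) hA h
  rw [hT.Delta_fourier_one hφ, hA1, hw] at key
  rw [P_eq_sub hw hwa hφa]
  have hR : (R : ℂ) ≠ 0 := by exact_mod_cast H.pos.ne'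
  push_cast
  field_simp
  linear_combination key

theorem IsTestSpace.G_eq {φ w : K → ℂ} (hφ : φ ∈ T) (hwT : w ∈ T) (hw : w 0 = 1) :
    G lam μ φ = ((1 / R : ℝ) : ℂ) * P μ w φ + G lam μ w * φ 0 := by
  obtain ⟨ε, hwa⟩ := hT.admissible w hwT
  refine hT.G_eq_of_relation H hφ hw hwa (hT.hasDerivAt_Delta_fourier H hwT)
    (by rw [hT.Delta_fourier_one hwT, hw]) ?_
  have hn : ∀ᶠ s : ℂ in nhds 0, s.re < 1 :=
    (continuous_re.tendsto 0).eventually (gt_mem_nhds (by simp))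
  filter_upwards [hn] with s h1 h0
  have := functional_equation H.measurable H.null_zero hT.measurable_char hT.norm_char
    (hT.measurable φ hφ) (hT.measurable w hwT) (hT.integrable hφ) (hT.integrable hwT) (s := 1 - s)
    (hT.convergesOn _ (hT.fourier_mem φ hφ) 2 _ (by simpa) (by simp; linarith))
    (hT.convergesOn _ (hT.fourier_mem w hwT) 2 _ (by simpa) (by simp; linarith))
    (hT.convergesOn _ hφ 2 _ (by simpa) (by simp; linarith))
    (hT.convergesOn _ hwT 2 _ (by simpa) (by simp; linarith))
  simpa using this

/-- The functional equation is applied to `φ~` and `h`, not to `φ` and `w`. The double transform of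
`φ` is `φ(-x)`, and `Δ_s` does not see the sign. Thus no inversion formula for `h` is needed. -/
theorem IsTestSpace.G_eq_of_fourier {φ h w : K → ℂ} (hφ : φ ∈ T) (hh : Measurable h)
    (hhc : ConvergesOn μ h 0 2) (hhi : ∫ x, h x ∂μ = 1) (hw : fourier lam μ h = w)
    {ε : ℝ} (hwa : Admissible μ w ε) :
    G lam μ φ = ((1 / R : ℝ) : ℂ) * P μ w φ +
      (∫ y, ((-Real.log (localModule K y) : ℝ) : ℂ) * h y ∂μ) * φ 0 := by
  have hi : Integrable h μ := by simpa using hhc 1 (by simp) (by simp)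
  have hw0 : w 0 = 1 := by
    rw [← hw, fourier]
    simpa [hT.char_zero] using hhi
  refine hT.G_eq_of_relation H hφ hw0 hwa (A := fun s => Delta μ s h) ?_
    (by simpa [Delta] using hhi) ?_
  · refine (hhc.hasDerivAt H.measurable H.null_zero
      (s₀ := 1) (by simp) (by simp)).2.congr_deriv ?_
    rw [← integral_neg]
    refine integral_congr_ae (Filter.Eventually.of_forall fun x => ?_)
    simp [mul_comm]
  -- `Re s < ε` is needed for `Δ_s(w)`, and `Re s < 1` keeps `1 - s` in the strip where `Δ(h)` and
  -- `Δ(φ~)` converge.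
  · have hn : ∀ᶠ s : ℂ in nhds 0, s.re < min ε 1 :=
      (continuous_re.tendsto 0).eventually (gt_mem_nhds (by simpa using hwa.1))
    filter_upwards [hn] with s h1 h0
    have hs1 := h1.trans_le (min_le_right _ _)
    have hφ' := hT.fourier_mem φ hφ
    have e : fourier lam μ (fourier lam μ φ) = fun x => φ (-x) := funext (hT.self_dual φ hφ)
    have eD : Delta μ s (fun x => φ (-x)) = Delta μ s φ := by
      unfold Delta
      rw [← integral_neg_eq_self]
      simp
    have := functional_equation H.measurable H.null_zero hT.measurable_char hT.norm_char
      (hT.measurable _ hφ') hh (hT.integrable hφ') hi (s := s)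
      (hT.convergesOn _ (hT.fourier_mem _ hφ') 2 _ (by simpa) (by linarith))
      (by rw [hw]; exact hwa.integrable H s h0 (h1.trans_le (min_le_left _ _)))
      (hT.convergesOn _ hφ' 2 _ (by simpa) (by simp; linarith))
      (hhc _ (by simpa) (by simp; linarith))
    rw [e, eD, hw] at this
    rw [mul_comm, ← this, mul_comm]

/-- The transform of `φ_t` at `t y` is `|t|⁻¹ φ~(y)`. After the dilation `y ↦ t y` the logarithm
splits, and the extra term is `log |t|` times `∫ φ~ = φ(0)`. -/
theorem IsTestSpace.G_dilation {φ : K → ℂ} (hφ : φ ∈ T) {t : K} (ht : t ≠ 0) :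
    G lam μ (fun x => φ (t * x)) =
      G lam μ φ - (Real.log (localModule K t) : ℝ) * φ 0 := by
  have hp := localModule_pos ht
  have e : ∀ y, fourier lam μ (fun x => φ (t * x)) (t * y) =
      ((localModule K t)⁻¹ : ℝ) * fourier lam μ φ y := by
    intro y
    unfold fourier
    rw [← integral_comp_mul μ ht]
    refine integral_congr_ae (Filter.Eventually.of_forall fun x => ?_)
    dsimp only
    rw [show x * (t * y) = t * x * y by ring]
  have hint : ∫ y, fourier lam μ φ y ∂μ = φ 0 := by
    simpa [Delta] using hT.Delta_fourier_one hφ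
  have h1 : G lam μ (fun x => φ (t * x)) = localModule K t *
      ∫ y, ((-Real.log (localModule K (t * y)) : ℝ) : ℂ) *
        fourier lam μ (fun x => φ (t * x)) (t * y) ∂μ := by
    rw [integral_comp_mul μ ht (fun y => ((-Real.log (localModule K y) : ℝ) : ℂ) *
        fourier lam μ (fun x => φ (t * x)) y), ← mul_assoc, ← ofReal_mul,
      mul_inv_cancel₀ hp.ne', ofReal_one, one_mul]
    rfl
  rw [h1, ← integral_const_mul, ← hint, G, ← integral_const_mul, ← integral_sub
    (hT.integrable_G H hφ) ((hT.integrable (hT.fourier_mem φ hφ)).const_mul _)]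
  refine integral_congr_ae ?_
  filter_upwards [ae_ne_zero μ H.null_zero] with y hy
  rw [e, localModule_mul, Real.log_mul hp.ne' (localModule_pos hy).ne']
  have : (localModule K t : ℂ) ≠ 0 := by exact_mod_cast hp.ne'
  push_cast
  field_simp
  ring

/-- Only `τ` and the volume of the shells depend on the place. In `hG` the bracket is the finite
part of `Δ_s(φ)`, computed with the sharp cutoff, which need not be a test function. -/
theorem IsTestSpace.uniformFormula {τ : ℝ}
    (hG : ∀ φ ∈ T, G lam μ φ = ((1 / R : ℝ) : ℂ) * (P μ omegaInt φ + c₀ * φ 0) + τ * φ 0)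
    (hvol : ∀ X : K, 1 ≤ localModule K X →
      mulHaar μ (1 / R) {x | 1 ≤ localModule K x ∧ localModule K x < localModule K X} =
        ENNReal.ofReal (Real.log (localModule K X))) :
    UniformFormula lam μ T R τ where
  delta_integrable φ hφ s hs := hT.convergesOn φ hφ (s.re + 1) s hs (by linarith)
  residue φ hφ := by
    obtain ⟨ε, h⟩ := hT.admissible φ hφ
    exact ⟨_, h.hasLaurent H⟩
  P_integrable w hw hw1 φ hφ := by
    obtain ⟨ε, h⟩ := hT.admissible φ hφ
    obtain ⟨ε', h'⟩ := hT.admissible w hw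
    exact integrable_PIntegrand hw1 h' h
  finite_part w hw hw1 c hc φ hφ := by
    obtain ⟨ε, h⟩ := hT.admissible φ hφ
    obtain ⟨ε', h'⟩ := hT.admissible w hw
    have := h'.hasLaurent H
    rw [hw1, mul_one, mul_one] at this
    rw [hc.unique this, P_eq_sub hw1 h' h]
    convert h.hasLaurent H using 1
    ring
  G_integrable φ hφ := hT.integrable_G H hφ
  formula w hw hw1 φ hφ := hT.G_eq H hφ hw hw1
  formula_finite_part φ hφ c' hc' := by
    obtain ⟨ε, h⟩ := hT.admissible φ hφ
    rw [hc'.unique (h.hasLaurent H), hG φ hφ]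
  deriv_delta φ hφ := hT.hasDerivAt_Delta_fourier H hφ
  dilation φ hφ t ht := hT.G_dilation H hφ ht
  shell_volume := hvol

end Uniform

/-! ### Non-archimedean fields: the module against the norm. -/

section Ultra

variable {L : Type*} [NormedField L] [ProperSpace L] [IsUltrametricDist L]

/-- Multiplication by `x` maps the closed unit ball into itself and multiplies its volume by the
module of `x`. -/
theorem localModule_le_one_of_norm {x : L} (hx : ‖x‖ ≤ 1) : localModule L x ≤ 1 := by
  borelize L
  by_cases h0 : x = 0
  · simp [h0]
  have hV : Measure.addHaar (Metric.closedBall (0 : L) 1) ≠ ⊤ :=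
    (isCompact_closedBall 0 1).measure_lt_top.ne
  have hV0 : Measure.addHaar (Metric.closedBall (0 : L) 1) ≠ 0 :=
    (Measure.measure_pos_of_mem_nhds _ (Metric.closedBall_mem_nhds 0 one_pos)).ne'
  have h := congrArg (fun m => m (Metric.closedBall (0 : L) 1))
    (map_mul_left (Measure.addHaar : Measure L) (inv_ne_zero h0))
  simp only [localModule_inv, inv_inv] at h
  rw [Measure.map_apply (measurable_const_mul _) measurableSet_closedBall, Measure.smul_apply,
    smul_eq_mul] at h
  have hsub : (fun y : L => x⁻¹ * y) ⁻¹' Metric.closedBall 0 1 ⊆ Metric.closedBall 0 1 := by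
    intro y hy
    simp only [Set.mem_preimage, mem_closedBall_zero_iff] at hy ⊢
    have : y = x * (x⁻¹ * y) := by field_simp
    rw [this, norm_mul]
    exact mul_le_one₀ hx (norm_nonneg _) hy
  have h2 := measure_mono (μ := (Measure.addHaar : Measure L)) hsub
  rw [h] at h2
  have h3 : ENNReal.ofReal (localModule L x) ≤ 1 := by
    by_contra hc
    push Not at hc
    have := ENNReal.mul_lt_mul_left hV0 hV hc
    rw [one_mul] at this
    exact absurd h2 (not_le.2 this)
  simpa using h3

/-- The image of the closed unit ball under `x` misses the open unit ball around `1`, which has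
positive volume and also lies in the closed unit ball. So the image has strictly smaller volume. -/
theorem localModule_lt_one_of_norm {x : L} (hx : ‖x‖ < 1) : localModule L x < 1 := by
  borelize L
  by_cases h0 : x = 0
  · simp [h0]
  set μ : Measure L := Measure.addHaar
  have hV : μ (Metric.closedBall (0 : L) 1) ≠ ⊤ :=
    (isCompact_closedBall 0 1).measure_lt_top.ne
  have h := congrArg (fun m => m (Metric.closedBall (0 : L) 1))
    (map_mul_left μ (inv_ne_zero h0))
  simp only [localModule_inv, inv_inv] at h
  rw [Measure.map_apply (measurable_const_mul _) measurableSet_closedBall, Measure.smul_apply,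
    smul_eq_mul] at h
  have hn : ∀ y : L, x⁻¹ * y ∈ Metric.closedBall (0 : L) 1 → ‖y‖ < 1 := by
    intro y hy
    rw [mem_closedBall_zero_iff] at hy
    have : y = x * (x⁻¹ * y) := by field_simp
    rw [this, norm_mul]
    exact mul_lt_one_of_nonneg_of_lt_one_left (norm_nonneg _) hx hy
  have hsub : (fun y : L => x⁻¹ * y) ⁻¹' Metric.closedBall 0 1 ∪ Metric.ball 1 1 ⊆
      Metric.closedBall 0 1 := by
    rintro y (hy | hy)
    · exact mem_closedBall_zero_iff.2 (hn y hy).le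
    · rw [mem_ball_iff_norm] at hy
      rw [mem_closedBall_zero_iff]
      have : y = (y - 1) + 1 := by ring
      rw [this]
      exact (IsUltrametricDist.norm_add_le_max _ _).trans (max_le hy.le norm_one.le)
  have hdis : Disjoint ((fun y : L => x⁻¹ * y) ⁻¹' Metric.closedBall 0 1) (Metric.ball 1 1) := by
    rw [Set.disjoint_left]
    intro y hy hy2
    rw [mem_ball_iff_norm'] at hy2
    have h1 : (1 : L) = (1 - y) + y := by ring
    have := IsUltrametricDist.norm_add_le_max (1 - y) y
    rw [← h1, norm_one] at this
    exact absurd this (not_le.2 (max_lt hy2 (hn y hy)))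
  have h2 := measure_mono (μ := μ) hsub
  rw [measure_union hdis Metric.isOpen_ball.measurableSet, h] at h2
  have hb : 0 < μ (Metric.ball (1 : L) 1) := Metric.measure_ball_pos _ _ one_pos
  by_contra hc
  push Not at hc
  have h3 : μ (Metric.closedBall (0 : L) 1) ≤
      ENNReal.ofReal (localModule L x) * μ (Metric.closedBall (0 : L) 1) :=
    le_mul_of_one_le_left (zero_le) (by simpa using ENNReal.ofReal_le_ofReal hc)
  have h4 := (add_le_add_left h3 _).trans h2
  exact absurd h4 (not_le.2 (ENNReal.lt_add_right hV hb.ne'))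

theorem localModule_le_one_iff {x : L} : localModule L x ≤ 1 ↔ ‖x‖ ≤ 1 := by
  refine ⟨fun h => ?_, localModule_le_one_of_norm⟩
  by_contra hc
  push Not at hc
  have hx : x ≠ 0 := by rintro rfl; simp at hc; linarith
  have h1 : ‖x⁻¹‖ < 1 := by rw [norm_inv]; exact inv_lt_one_of_one_lt₀ hc
  have h2 := localModule_lt_one_of_norm h1
  rw [localModule_inv] at h2
  have := (inv_lt_one₀ (localModule_pos hx)).1 h2
  linarith

theorem localModule_le_iff {x y : L} : localModule L x ≤ localModule L y ↔ ‖x‖ ≤ ‖y‖ := by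
  by_cases hy : y = 0
  · subst hy
    rw [localModule_zero, norm_zero, norm_le_zero_iff]
    exact ⟨fun h => localModule_eq_zero.1 (le_antisymm h (localModule_nonneg x)),
      fun h => by simp [h]⟩
  · have h := localModule_le_one_iff (x := x * y⁻¹)
    rw [localModule_mul, localModule_inv, norm_mul, norm_inv, ← div_eq_mul_inv,
      ← div_eq_mul_inv, div_le_one (localModule_pos hy), div_le_one (norm_pos_iff.2 hy)] at h
    exact h

theorem localModule_lt_iff {x y : L} : localModule L x < localModule L y ↔ ‖x‖ < ‖y‖ := by
  rw [← not_le, ← not_le, localModule_le_iff]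

theorem localModule_add_le (x y : L) :
    localModule L (x + y) ≤ max (localModule L x) (localModule L y) := by
  rcases le_total ‖x‖ ‖y‖ with h | h
  · refine le_max_of_le_right (localModule_le_iff.2 ?_)
    exact (IsUltrametricDist.norm_add_le_max x y).trans (max_le h le_rfl)
  · refine le_max_of_le_left (localModule_le_iff.2 ?_)
    exact (IsUltrametricDist.norm_add_le_max x y).trans (max_le le_rfl h)

theorem localModule_sub_le (x y : L) :
    localModule L (x - y) ≤ max (localModule L x) (localModule L y) := by
  rw [sub_eq_add_neg, ← localModule_neg y]
  exact localModule_add_le x (-y)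

theorem localModule_eq_of_sub_lt {x y : L} (h : localModule L (y - x) < localModule L x) :
    localModule L y = localModule L x := by
  refine le_antisymm ?_ ?_
  · have := localModule_add_le (y - x) x
    rw [sub_add_cancel, max_eq_right h.le] at this
    exact this
  · have := localModule_sub_le y (y - x)
    rw [sub_sub_cancel] at this
    rcases le_max_iff.1 this with h1 | h1
    · exact h1
    · linarith

theorem isOpen_localModule_sub_lt (x : L) {t : L} :
    IsOpen {y : L | localModule L (y - x) < localModule L t} := by
  have : {y : L | localModule L (y - x) < localModule L t} = Metric.ball x ‖t‖ := by
    ext y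
    rw [Set.mem_ofPred_eq, localModule_lt_iff, mem_ball_iff_norm]
  rw [this]
  exact Metric.isOpen_ball

theorem isOpen_localModule_sub_le (x : L) {t : L} (ht : t ≠ 0) :
    IsOpen {y : L | localModule L (y - x) ≤ localModule L t} := by
  have : {y : L | localModule L (y - x) ≤ localModule L t} = Metric.closedBall x ‖t‖ := by
    ext y
    rw [Set.mem_ofPred_eq, localModule_le_iff, mem_closedBall_iff_norm]
  rw [this]
  exact IsUltrametricDist.isOpen_closedBall x (norm_ne_zero_iff.2 ht)

theorem isCompact_localModule_sub_le (x t : L) :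
    IsCompact {y : L | localModule L (y - x) ≤ localModule L t} := by
  have : {y : L | localModule L (y - x) ≤ localModule L t} = Metric.closedBall x ‖t‖ := by
    ext y
    rw [Set.mem_ofPred_eq, localModule_le_iff, mem_closedBall_iff_norm]
  rw [this]
  exact isCompact_closedBall x ‖t‖

/-- By the isosceles triangle principle the module is locally constant off `0`. -/
theorem continuousAt_localModule {x : L} (hx : x ≠ 0) : ContinuousAt (localModule L) x := by
  refine Filter.Tendsto.congr' (f₁ := fun _ => localModule L x) ?_ tendsto_const_nhds
  have h := (isOpen_localModule_sub_lt x (t := x)).mem_nhds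
    (by simpa using localModule_pos hx : x ∈ {y : L | localModule L (y - x) < localModule L x})
  filter_upwards [h] with y hy using (localModule_eq_of_sub_lt hy).symm

theorem measurable_localModule_ultra [MeasurableSpace L] [BorelSpace L] :
    Measurable (localModule L) :=
  measurable_of_continuousOn_compl_singleton 0 fun _ hx =>
    (continuousAt_localModule hx).continuousWithinAt

end Ultra

/-! ### Powers of a uniformizer and volumes of balls. -/

section Uniformizer

variable {L : Type*} [NormedField L] [ProperSpace L] [IsUltrametricDist L] {ϖ : L}

/-- Some power of `ϖ` scales `x` to a module in `(|ϖ|, 1]`. Since `|ϖ|` is the largest module below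
`1`, that module is `1`. -/
theorem IsUniformizer.exists_zpow (h : IsUniformizer ϖ) (h0 : ϖ ≠ 0) {x : L} (hx : x ≠ 0) :
    ∃ n : ℤ, localModule L x = localModule L ϖ ^ n := by
  have hp := localModule_pos h0
  obtain ⟨n, h1, h2⟩ := exists_mem_Ioc_zpow (localModule_pos hx) ((one_lt_inv₀ hp).2 h.1)
  have hz : ∀ m : ℤ, localModule L (x * ϖ ^ m) = localModule L x * localModule L ϖ ^ m := by
    intro m
    rw [localModule_mul, localModule_zpow]
  have hpn : 0 < localModule L ϖ ^ (n + 1) := zpow_pos hp _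
  rw [inv_zpow'] at h1 h2
  have e1 : localModule L ϖ ^ (-(n + 1)) * localModule L ϖ ^ (n + 1) = 1 := by
    rw [← zpow_add₀ hp.ne']; simp
  have e2 : localModule L ϖ ^ (-n) * localModule L ϖ ^ (n + 1) = localModule L ϖ := by
    rw [← zpow_add₀ hp.ne']; simp
  have k1 : localModule L (x * ϖ ^ (n + 1)) ≤ 1 := by
    rw [hz, ← e1]; gcongr
  have k2 : localModule L ϖ < localModule L (x * ϖ ^ (n + 1)) := by
    rw [hz]
    calc localModule L ϖ = _ := e2.symm
      _ < _ := by gcongr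
  have k3 : localModule L (x * ϖ ^ (n + 1)) = 1 := by
    refine le_antisymm k1 ?_
    by_contra hc
    push Not at hc
    exact absurd (h.2 _ hc) (not_le.2 k2)
  refine ⟨-(n + 1), ?_⟩
  rw [hz] at k3
  have := eq_div_of_mul_eq hpn.ne' k3
  rw [this, zpow_neg, one_div]

theorem IsUniformizer.lt_iff_le (h : IsUniformizer ϖ) {x t : L} (ht : t ≠ 0) :
    localModule L x < localModule L t ↔ localModule L x ≤ localModule L (t * ϖ) := by
  have hp := localModule_pos ht
  rw [localModule_mul, ← div_lt_one hp, ← div_le_iff₀' hp]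
  have e : localModule L x / localModule L t = localModule L (x * t⁻¹) := by
    rw [localModule_mul, localModule_inv, div_eq_mul_inv]
  rw [e]
  exact ⟨h.2 _, fun h' => h'.trans_lt h.1⟩

variable [MeasurableSpace L] [BorelSpace L] (μ : Measure L) [μ.IsAddHaarMeasure]

theorem measure_localModule_lt_top (t : L) :
    μ {x | localModule L x ≤ localModule L t} < ⊤ := by
  simpa using (isCompact_localModule_sub_le 0 t).measure_lt_top (μ := μ)

theorem measure_localModule_le {t : L} (ht : t ≠ 0) :
    μ {x | localModule L x ≤ localModule L t} =
      ENNReal.ofReal (localModule L t) * μ {x | localModule L x ≤ 1} := by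
  have h := congrArg (fun m => m {x : L | localModule L x ≤ 1})
    (map_mul_left μ (inv_ne_zero ht))
  have hS : MeasurableSet {x : L | localModule L x ≤ 1} :=
    measurableSet_le measurable_localModule_ultra measurable_const
  simp only [localModule_inv, inv_inv] at h
  rw [Measure.map_apply (measurable_const_mul _) hS, Measure.smul_apply, smul_eq_mul] at h
  rw [← h]
  congr 1
  ext x
  simp only [Set.mem_ofPred_eq, Set.mem_preimage]
  rw [localModule_mul, localModule_inv, inv_mul_le_one₀ (localModule_pos ht)]

/-- The origin lies in every `ϖ^n 𝒪`, whose volume is `|ϖ|^n` times that of `𝒪`. -/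
theorem null_zero_of_uniformizer (h : IsUniformizer ϖ) (h0 : ϖ ≠ 0) : μ {0} = 0 := by
  have hfin := measure_localModule_lt_top μ (1 : L)
  rw [localModule_one] at hfin
  have ht : Filter.Tendsto (fun n : ℕ => ENNReal.ofReal (localModule L ϖ ^ n) *
      μ {x : L | localModule L x ≤ 1}) Filter.atTop (nhds 0) := by
    have h1 : Filter.Tendsto (fun n : ℕ => localModule L ϖ ^ n) Filter.atTop (nhds 0) :=
      tendsto_pow_atTop_nhds_zero_of_lt_one (localModule_nonneg _) h.1
    have h2 := ENNReal.tendsto_ofReal h1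
    rw [ENNReal.ofReal_zero] at h2
    simpa using ENNReal.Tendsto.mul_const h2 (Or.inr hfin.ne)
  refine le_antisymm (ge_of_tendsto' ht fun n => ?_) (zero_le)
  rw [← localModule_pow, ← measure_localModule_le μ (pow_ne_zero n h0)]
  exact measure_mono (by simp [localModule_nonneg])

theorem measure_units (h : IsUniformizer ϖ) (h0 : ϖ ≠ 0) :
    μ {x : L | localModule L x = 1} =
      ENNReal.ofReal (1 - localModule L ϖ) * μ {x : L | localModule L x ≤ 1} := by
  have hm : Measurable (localModule L) := measurable_localModule_ultra
  have e : {x : L | localModule L x = 1} =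
      {x : L | localModule L x ≤ 1} \ {x : L | localModule L x ≤ localModule L ϖ} := by
    ext x
    have := h.lt_iff_le (x := x) one_ne_zero
    rw [localModule_one, one_mul] at this
    simp only [Set.mem_ofPred_eq, Set.mem_sdiff, ← this, not_lt]
    exact ⟨fun h => ⟨h.le, h.ge⟩, fun h => le_antisymm h.1 h.2⟩
  rw [e, measure_sdiff _ (measurableSet_le hm measurable_const).nullMeasurableSet
    (measure_localModule_lt_top μ ϖ).ne, measure_localModule_le μ h0,
    ENNReal.ofReal_sub _ (localModule_nonneg _), ENNReal.ofReal_one,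
    ENNReal.sub_mul, one_mul]
  · intro _ _
    have hfin := measure_localModule_lt_top μ (1 : L)
    rw [localModule_one] at hfin
    exact hfin.ne
  · intro x hx
    exact le_trans (by simpa using hx) h.1.le

theorem measure_localModule_le_one_pos : 0 < μ {x : L | localModule L x ≤ 1} := by
  refine Measure.measure_pos_of_mem_nhds μ ((?_ : IsOpen _).mem_nhds (?_ : (0 : L) ∈ _))
  · simpa using isOpen_localModule_sub_le (0 : L) one_ne_zero
  · simp

end Uniformizer

/-- The Laurent expansion `1 / (1 - e^(-ℓ s)) = 1 / (ℓ s) + 1 / 2 + O(s)`. -/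
theorem exists_laurent_one_sub_exp {ℓ : ℝ} (hℓ : 0 < ℓ) :
    ∃ E : ℂ → ℂ, AnalyticAt ℂ E 0 ∧ E 0 = 1 / 2 ∧
      ∀ s : ℂ, s ≠ 0 → 1 / (1 - exp (-(ℓ * s))) = 1 / (ℓ * s) + E s := by
  have hℓ' : (ℓ : ℂ) ≠ 0 := by exact_mod_cast hℓ.ne'
  let f : ℂ → ℂ := fun s => 1 - exp (-(ℓ * s))
  have hf : AnalyticAt ℂ f 0 := by
    have : Differentiable ℂ f := by fun_prop
    exact this.analyticAt 0
  have hf0 : f 0 = 0 := by simp [f]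
  have hf' : HasDerivAt f ℓ 0 := by
    have h1 : HasDerivAt (fun s : ℂ => -((ℓ : ℂ) * s)) (-(ℓ * 1)) 0 :=
      ((hasDerivAt_id (0 : ℂ)).const_mul (ℓ : ℂ)).neg
    have := (h1.cexp).const_sub 1
    simpa using this
  -- `k` is `f` with its simple zero divided out, so `1 / f = 1 / (s k)`, and `E` is the difference
  -- quotient of `1 / k` at `0`.
  let k : ℂ → ℂ := dslope f 0
  have hk : AnalyticAt ℂ k 0 := by
    obtain ⟨p, hp⟩ := hf
    exact ⟨_, hp.has_fpower_series_dslope_fslope⟩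
  have hk0 : k 0 = ℓ := by simp only [k, dslope_same, hf'.deriv]
  have hks : ∀ s, s ≠ 0 → k s = f s / s := by
    intro s hs
    simp only [k, dslope_of_ne _ hs, slope_def_field, hf0, sub_zero]
  have hki : AnalyticAt ℂ (fun s => (k s)⁻¹) 0 := hk.inv (by rw [hk0]; exact hℓ')
  let E : ℂ → ℂ := dslope (fun s => (k s)⁻¹) 0
  have hE : AnalyticAt ℂ E 0 := by
    obtain ⟨p, hp⟩ := hki
    exact ⟨_, hp.has_fpower_series_dslope_fslope⟩
  have hEs : ∀ s : ℂ, s ≠ 0 → 1 / f s = 1 / (ℓ * s) + E s := by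
    intro s hs
    simp only [E, dslope_of_ne _ hs, slope_def_field, hk0, sub_zero, hks s hs]
    field_simp
    ring
  refine ⟨E, hE, ?_, hEs⟩
  -- The value `1/2` comes from the symmetry `1/(1 - e^(-z)) + 1/(1 - e^z) = 1`. The polar parts at
  -- `t` and `-t` cancel, so `E(t) + E(-t) = 1`, and no second derivative is needed.
  have ht : Filter.Tendsto (fun t : ℝ => E t + E (-t)) (nhdsWithin 0 (Set.Ioi 0))
      (nhds (E 0 + E (-0))) := by
    have h1 := tendsto_ofReal_nhdsGT_zero
    refine (hE.continuousAt.tendsto.comp h1).add ?_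
    have h2 : Filter.Tendsto (fun t : ℝ => -(t : ℂ)) (nhdsWithin 0 (Set.Ioi 0)) (nhds (-0)) :=
      h1.neg
    rw [neg_zero] at h2 ⊢
    exact hE.continuousAt.tendsto.comp h2
  have h1 : Filter.Tendsto (fun t : ℝ => E t + E (-t)) (nhdsWithin 0 (Set.Ioi 0)) (nhds 1) := by
    refine tendsto_const_nhds.congr' ?_
    filter_upwards [self_mem_nhdsWithin] with t ht
    have ht0 : (0 : ℝ) < t := ht
    have ht' : (t : ℂ) ≠ 0 := by exact_mod_cast ht0.ne'
    have e1 := hEs t ht'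
    have e2 := hEs (-t) (neg_ne_zero.2 ht')
    have hne : f t ≠ 0 := by
      simp only [f]
      rw [sub_ne_zero, ← ofReal_mul, ← ofReal_neg, ← ofReal_exp]
      have : Real.exp (-(ℓ * t)) < 1 := by
        rw [Real.exp_lt_one_iff]
        have := mul_pos hℓ ht0
        linarith
      exact_mod_cast this.ne'
    have e3 : f (-t) = -exp (ℓ * t) * f t := by
      simp only [f, mul_neg, neg_neg]
      have : exp ((ℓ : ℂ) * t) * exp (-((ℓ : ℂ) * t)) = 1 := by
        rw [← exp_add, add_neg_cancel, exp_zero]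
      linear_combination -this
    have e4 : 1 / f t + 1 / f (-t) = 1 := by
      rw [e3]
      have hexp := exp_ne_zero ((ℓ : ℂ) * t)
      have : exp ((ℓ : ℂ) * t) * exp (-((ℓ : ℂ) * t)) = 1 := by
        rw [← exp_add, add_neg_cancel, exp_zero]
      have h5 : exp ((ℓ : ℂ) * t) * f t = exp ((ℓ : ℂ) * t) - 1 := by
        simp only [f]
        linear_combination -this
      field_simp
      linear_combination -h5
    rw [e1, e2] at e4
    have e5 : 1 / ((ℓ : ℂ) * t) + 1 / (ℓ * -t) = 0 := by
      field_simp
      ring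
    linear_combination e5 - e4
  have := tendsto_nhds_unique ht h1
  rw [neg_zero] at this
  linear_combination this / 2

/-! ### The pole of `Δ_s` at the characteristic function of the integers. -/

section Uniformizer

variable {L : Type*} [NormedField L] [ProperSpace L] [IsUltrametricDist L] {ϖ : L}
  [MeasurableSpace L] [BorelSpace L] (μ : Measure L) [μ.IsAddHaarMeasure]

/-- Up to the null point `0` the integers are the union of the spheres `|x| = |ϖ|^n`. Bounding the
volume of each by that of the ball containing it leaves a geometric series of ratio `|ϖ|^(Re s)`. -/
theorem integrable_omegaInt_cpow (h : IsUniformizer ϖ) (h0 : ϖ ≠ 0) {s : ℂ} (hs : 0 < s.re) :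
    Integrable (fun x : L => omegaInt x * (localModule L x : ℂ) ^ (s - 1)) μ := by
  have hm : Measurable (localModule L) := measurable_localModule_ultra
  have hρ := localModule_pos h0
  have hfin := measure_localModule_lt_top μ (1 : L)
  rw [localModule_one] at hfin
  refine ⟨((measurable_omegaInt hm).mul
    (measurable_localModule_cpow hm _)).aestronglyMeasurable, ?_⟩
  let S : ℕ → Set L := fun n => {x | localModule L x = localModule L ϖ ^ n}
  have hSm : ∀ n, MeasurableSet (S n) := fun n => measurableSet_eq_fun hm measurable_const
  have hle : ∫⁻ x, ‖omegaInt x * (localModule L x : ℂ) ^ (s - 1)‖ₑ ∂μ ≤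
      ∫⁻ x in ⋃ n, S n, ‖omegaInt x * (localModule L x : ℂ) ^ (s - 1)‖ₑ ∂μ := by
    rw [← lintegral_indicator (MeasurableSet.iUnion hSm)]
    refine lintegral_mono_ae ?_
    filter_upwards [ae_ne_zero μ (null_zero_of_uniformizer μ h h0)] with x hx
    by_cases h1 : localModule L x ≤ 1
    · obtain ⟨n, hn⟩ := h.exists_zpow h0 hx
      have hn0 : 0 ≤ n := by
        by_contra hc
        push Not at hc
        rw [hn] at h1
        exact absurd h1 (not_le.2 (one_lt_zpow_of_neg₀ hρ h.1 hc))
      lift n to ℕ using hn0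
      rw [Set.indicator_of_mem]
      exact Set.mem_iUnion.2 ⟨n, by simpa [S] using hn⟩
    · rw [omegaInt_of_lt (not_le.1 h1)]
      simp
  refine (hle.trans ((lintegral_iUnion_le _ _))).trans_lt ?_
  have hn : ∀ n, ∫⁻ x in S n, ‖omegaInt x * (localModule L x : ℂ) ^ (s - 1)‖ₑ ∂μ ≤
      ENNReal.ofReal ((localModule L ϖ ^ s.re) ^ n) * μ {x : L | localModule L x ≤ 1} := by
    intro n
    have hpn : 0 < localModule L ϖ ^ n := pow_pos hρ n
    calc ∫⁻ x in S n, ‖omegaInt x * (localModule L x : ℂ) ^ (s - 1)‖ₑ ∂μ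
        ≤ ∫⁻ x in S n, ENNReal.ofReal ((localModule L ϖ ^ n) ^ (s.re - 1)) ∂μ := by
          refine setLIntegral_mono measurable_const fun x hx => ?_
          have hx' : localModule L x = localModule L ϖ ^ n := hx
          have hx0 : x ≠ 0 := fun hc => by rw [hc, localModule_zero] at hx'; exact hpn.ne hx'
          have hx1 : localModule L x ≤ 1 := by
            rw [hx']; exact pow_le_one₀ hρ.le h.1.le
          rw [omegaInt_of_le hx1, one_mul, ← ofReal_norm, norm_localModule_cpow hx0, hx']
          simp
      _ = ENNReal.ofReal ((localModule L ϖ ^ n) ^ (s.re - 1)) * μ (S n) := by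
          rw [setLIntegral_const]
      _ ≤ ENNReal.ofReal ((localModule L ϖ ^ n) ^ (s.re - 1)) *
          (ENNReal.ofReal (localModule L ϖ ^ n) * μ {x : L | localModule L x ≤ 1}) := by
          gcongr
          rw [← localModule_pow, ← measure_localModule_le μ (pow_ne_zero n h0)]
          refine measure_mono fun x hx => ?_
          have hx' : localModule L x = localModule L ϖ ^ n := hx
          simp [hx', localModule_pow]
      _ = _ := by
          rw [← mul_assoc, ← ENNReal.ofReal_mul (by positivity)]
          congr 2
          rw [← Real.rpow_add_one hpn.ne', sub_add_cancel, ← Real.rpow_natCast,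
            ← Real.rpow_natCast, ← Real.rpow_mul hρ.le, ← Real.rpow_mul hρ.le, mul_comm]
  refine (ENNReal.tsum_le_tsum hn).trans_lt ?_
  rw [ENNReal.tsum_mul_right]
  refine ENNReal.mul_lt_top ?_ hfin
  have hsum : Summable fun n : ℕ => (localModule L ϖ ^ s.re) ^ n :=
    summable_geometric_of_lt_one (by positivity) (Real.rpow_lt_one hρ.le h.1 hs)
  rw [← ENNReal.ofReal_tsum_of_nonneg (fun n => by positivity) hsum]
  exact ENNReal.ofReal_lt_top

theorem Delta_omegaInt_comp_mul {t : L} (ht : t ≠ 0) (s : ℂ) :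
    Delta μ s (fun x => omegaInt (t⁻¹ * x)) =
      (localModule L t : ℂ) ^ s * Delta μ s (omegaInt : L → ℂ) := by
  have hp : (localModule L t : ℂ) ≠ 0 := by exact_mod_cast (localModule_pos ht).ne'
  have h := integral_comp_mul μ (inv_ne_zero ht)
    (fun x => omegaInt x * (localModule L x : ℂ) ^ (s - 1))
  have e : ∀ x, omegaInt (t⁻¹ * x) * (localModule L x : ℂ) ^ (s - 1) =
      (localModule L t : ℂ) ^ (s - 1) *
        (omegaInt (t⁻¹ * x) * (localModule L (t⁻¹ * x) : ℂ) ^ (s - 1)) := by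
    intro x
    conv_lhs => rw [← mul_inv_cancel_left₀ ht x]
    rw [localModule_mul, ofReal_mul, mul_cpow_ofReal_nonneg (localModule_nonneg _)
      (localModule_nonneg _), inv_mul_cancel_left₀ ht]
    ring
  unfold Delta
  simp_rw [e]
  rw [integral_const_mul, h, localModule_inv, inv_inv, cpow_sub _ _ hp, cpow_one]
  field_simp

/-- `ω(x) - ω(ϖ⁻¹ x)` is the characteristic function of the units, where the weight is `1`, and the
dilation multiplies `Δ_s(ω)` by `|ϖ|^s`. -/
theorem Delta_omegaInt (h : IsUniformizer ϖ) (h0 : ϖ ≠ 0) {s : ℂ} (hs : 0 < s.re) :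
    Delta μ s (omegaInt : L → ℂ) * (1 - (localModule L ϖ : ℂ) ^ s) =
      (((1 - localModule L ϖ) * μ.real {x : L | localModule L x ≤ 1} : ℝ) : ℂ) := by
  have hm : Measurable (localModule L) := measurable_localModule_ultra
  have hU : MeasurableSet {x : L | localModule L x = 1} := measurableSet_eq_fun hm measurable_const
  have e : ∀ x : L, omegaInt x * (localModule L x : ℂ) ^ (s - 1) -
      omegaInt (ϖ⁻¹ * x) * (localModule L x : ℂ) ^ (s - 1) =
      {x : L | localModule L x = 1}.indicator (fun _ => (1 : ℂ)) x := by
    intro x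
    have h1 := h.lt_iff_le (x := x) one_ne_zero
    rw [localModule_one, one_mul] at h1
    have h2 : localModule L (ϖ⁻¹ * x) ≤ 1 ↔ localModule L x ≤ localModule L ϖ := by
      rw [localModule_mul, localModule_inv, inv_mul_le_one₀ (localModule_pos h0)]
    rcases lt_trichotomy (localModule L x) 1 with h3 | h3 | h3
    · rw [omegaInt_of_le h3.le, omegaInt_of_le (h2.2 (h1.1 h3)), Set.indicator_of_notMem, sub_self]
      exact h3.ne
    · rw [omegaInt_of_le h3.le, omegaInt_of_lt, Set.indicator_of_mem, h3]
      · simp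
      · exact h3
      · rw [← not_le, h2, ← h1, not_lt, h3]
    · rw [omegaInt_of_lt h3, omegaInt_of_lt, Set.indicator_of_notMem, zero_mul, sub_self]
      · exact h3.ne'
      · rw [← not_le, h2, ← h1, not_lt]; exact h3.le
  have i1 := integrable_omegaInt_cpow μ h h0 hs
  have i2 : Integrable (fun x => omegaInt (ϖ⁻¹ * x) * (localModule L x : ℂ) ^ (s - 1)) μ := by
    have := ((integrable_comp_mul μ (inv_ne_zero h0)
      (f := fun x => omegaInt x * (localModule L x : ℂ) ^ (s - 1))).2 i1).const_mul
      ((localModule L ϖ : ℂ) ^ (s - 1))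
    refine this.congr (Filter.Eventually.of_forall fun x => ?_)
    dsimp only
    conv_rhs => rw [← mul_inv_cancel_left₀ h0 x]
    rw [localModule_mul (ϖ), ofReal_mul, mul_cpow_ofReal_nonneg (localModule_nonneg _)
      (localModule_nonneg _), inv_mul_cancel_left₀ h0]
    ring
  have h3 : Delta μ s (omegaInt : L → ℂ) - Delta μ s (fun x => omegaInt (ϖ⁻¹ * x)) =
      (μ.real {x : L | localModule L x = 1} : ℂ) := by
    unfold Delta
    rw [← integral_sub i1 i2]
    simp_rw [e]
    rw [integral_indicator_const _ hU]
    simp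
  rw [Delta_omegaInt_comp_mul μ h0] at h3
  have h4 : μ.real {x : L | localModule L x = 1} =
      (1 - localModule L ϖ) * μ.real {x : L | localModule L x ≤ 1} := by
    rw [Measure.real, measure_units μ h h0, ENNReal.toReal_mul,
      ENNReal.toReal_ofReal (by linarith [h.1])]
    rfl
  rw [h4] at h3
  linear_combination h3

theorem measureReal_integers_pos : 0 < μ.real {x : L | localModule L x ≤ 1} := by
  have hfin := measure_localModule_lt_top μ (1 : L)
  rw [localModule_one] at hfin
  exact ENNReal.toReal_pos (measure_localModule_le_one_pos μ).ne' hfin.ne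

theorem one_sub_cpow_ne_zero {ρ : ℝ} (h0 : 0 < ρ) (h1 : ρ < 1) {s : ℂ} (hs : 0 < s.re) :
    1 - (ρ : ℂ) ^ s ≠ 0 := by
  intro hc
  have : ‖(ρ : ℂ) ^ s‖ = 1 := by rw [← sub_eq_zero.1 hc, norm_one]
  rw [norm_cpow_eq_rpow_re_of_pos h0] at this
  exact (Real.rpow_lt_one h0.le h1 hs).ne this

/-- Expand `1 / (1 - e^(-ℓ s))` with `ℓ = -log |ϖ|`. Its constant term `1/2` is what later becomes
`-(log q) / 2` in `τ`. -/
theorem hasModuleResidue_ultra (h : IsUniformizer ϖ) (h0 : ϖ ≠ 0) :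
    HasModuleResidue μ
      ((1 - localModule L ϖ) * μ.real {x : L | localModule L x ≤ 1} / -Real.log (localModule L ϖ))
      (((1 - localModule L ϖ) * μ.real {x : L | localModule L x ≤ 1} : ℝ) / 2 : ℂ) := by
  have hρ := localModule_pos h0
  have hℓ : 0 < -Real.log (localModule L ϖ) := by linarith [Real.log_neg hρ h.1]
  have hA : 0 < (1 - localModule L ϖ) * μ.real {x : L | localModule L x ≤ 1} :=
    mul_pos (by linarith [h.1]) (measureReal_integers_pos μ)
  refine ⟨measurable_localModule_ultra, null_zero_of_uniformizer μ h h0, div_pos hA hℓ,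
    fun s hs => integrable_omegaInt_cpow μ h h0 hs, ?_⟩
  obtain ⟨E, hE, hE0, hEs⟩ := exists_laurent_one_sub_exp hℓ
  set A := (1 - localModule L ϖ) * μ.real {x : L | localModule L x ≤ 1} with hAdef
  refine ⟨fun s => (A : ℂ) * E s, analyticAt_const.mul hE, by simp only [hE0]; ring,
    Filter.Eventually.of_forall fun s hs => ?_⟩
  have hs0 : s ≠ 0 := by rintro rfl; simp at hs
  have h1 := Delta_omegaInt μ h h0 hs
  have h2 := one_sub_cpow_ne_zero hρ h.1 hs
  have h3 : (localModule L ϖ : ℂ) ^ s = exp (-(((-Real.log (localModule L ϖ) : ℝ) : ℂ) * s)) := by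
    rw [cpow_def_of_ne_zero (by exact_mod_cast hρ.ne'), ← ofReal_log hρ.le]
    push_cast
    ring_nf
  have h4 := hEs s hs0
  rw [← h3] at h4
  rw [eq_div_of_mul_eq h2 h1]
  calc (A : ℂ) / (1 - (localModule L ϖ : ℂ) ^ s)
      = A * (1 / (1 - (localModule L ϖ : ℂ) ^ s)) := by ring
    _ = _ := by
        rw [h4]
        push_cast
        ring

end Uniformizer

/-! ### Locally constant functions with compact support. -/

section TestFunctions

variable {L : Type*} [NormedField L] [ProperSpace L] [IsUltrametricDist L]

theorem isLocallyConstant_of_translation {X : Type*} {φ : L → X} {t : L} (ht : t ≠ 0)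
    (h : ∀ x b, localModule L b ≤ localModule L t → φ (x + b) = φ x) : IsLocallyConstant φ := by
  rw [IsLocallyConstant.iff_eventually_eq]
  intro x
  filter_upwards [(isOpen_localModule_sub_le x ht).mem_nhds
    (by simpa using localModule_nonneg t)] with y hy
  rw [← h x (y - x) hy, add_sub_cancel]

theorem hasCompactSupport_of_localModule {φ : L → ℂ} {u : L}
    (h : ∀ x, φ x ≠ 0 → localModule L x ≤ localModule L u) : HasCompactSupport φ := by
  refine HasCompactSupport.intro (isCompact_localModule_sub_le 0 u) fun x hx => ?_
  by_contra hc
  exact hx (by simpa using h x hc)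

/-- The Lebesgue number lemma for the cover of the support by level sets makes `φ` constant on balls
of one radius centred in the support. If only `x + b` lies in the support, the ball is taken around
that point. -/
theorem exists_translation_of_bruhatTest [(nhdsWithin (0 : L) {0}ᶜ).NeBot] {φ : L → ℂ}
    (hφ : φ ∈ bruhatTest L) :
    ∃ t : L, t ≠ 0 ∧ ∀ x b, localModule L b ≤ localModule L t → φ (x + b) = φ x := by
  obtain ⟨δ, hδ, hb⟩ := lebesgue_number_lemma_of_metric (s := tsupport φ)
    (c := fun z : ℂ => φ ⁻¹' {z}) hφ.2 (fun z => hφ.1 _)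
    (fun x _ => Set.mem_iUnion.2 ⟨φ x, rfl⟩)
  have hball : ∀ x ∈ tsupport φ, ∀ y, dist y x < δ → φ y = φ x := by
    intro x hx y hy
    obtain ⟨z, hz⟩ := hb x hx
    have h1 : φ y = z := hz hy
    have h2 : φ x = z := hz (Metric.mem_ball_self hδ)
    rw [h1, h2]
  obtain ⟨t, htδ, ht⟩ : ∃ t : L, ‖t‖ < δ ∧ t ≠ 0 := by
    have h1 : Metric.ball (0 : L) δ ∩ {0}ᶜ ∈ nhdsWithin (0 : L) {0}ᶜ :=
      Filter.inter_mem (mem_nhdsWithin_of_mem_nhds (Metric.ball_mem_nhds 0 hδ))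
        self_mem_nhdsWithin
    obtain ⟨t, ht1, ht2⟩ := Filter.nonempty_of_mem h1
    exact ⟨t, by simpa using ht1, ht2⟩
  refine ⟨t, ht, fun x b hbt => ?_⟩
  have hd : dist (x + b) x < δ := by
    rw [dist_eq_norm, add_sub_cancel_left]
    exact (localModule_le_iff.1 hbt).trans_lt htδ
  by_cases hx : x ∈ tsupport φ
  · exact hball x hx _ hd
  · by_cases hy : x + b ∈ tsupport φ
    · exact (hball _ hy x (by rwa [dist_comm])).symm
    · rw [image_eq_zero_of_notMem_tsupport hx, image_eq_zero_of_notMem_tsupport hy]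

theorem exists_support_of_bruhatTest {φ : L → ℂ} [(nhdsWithin (0 : L) {0}ᶜ).NeBot]
    (hφ : φ ∈ bruhatTest L) :
    ∃ u : L, u ≠ 0 ∧ ∀ x, φ x ≠ 0 → localModule L x ≤ localModule L u := by
  obtain ⟨r, hr⟩ := hφ.2.isBounded.exists_norm_le
  obtain ⟨t, ht1, ht⟩ : ∃ t : L, ‖t‖ < 1 ∧ t ≠ 0 := by
    have h1 : Metric.ball (0 : L) 1 ∩ {0}ᶜ ∈ nhdsWithin (0 : L) {0}ᶜ :=
      Filter.inter_mem (mem_nhdsWithin_of_mem_nhds (Metric.ball_mem_nhds 0 one_pos))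
        self_mem_nhdsWithin
    obtain ⟨t, ht1, ht2⟩ := Filter.nonempty_of_mem h1
    exact ⟨t, by simpa using ht1, ht2⟩
  obtain ⟨n, hn⟩ := pow_unbounded_of_one_lt r ((one_lt_inv₀ (norm_pos_iff.2 ht)).2 ht1)
  refine ⟨t⁻¹ ^ n, pow_ne_zero _ (inv_ne_zero ht), fun x hx => localModule_le_iff.2 ?_⟩
  rw [norm_pow, norm_inv]
  exact (hr x (subset_tsupport _ hx)).trans hn.le

theorem exists_bound_of_bruhatTest {φ : L → ℂ} (hφ : φ ∈ bruhatTest L) :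
    ∃ M, 0 ≤ M ∧ ∀ x, ‖φ x‖ ≤ M := by
  obtain ⟨M, hM⟩ := hφ.2.exists_bound_of_continuous hφ.1.continuous
  exact ⟨M, (norm_nonneg _).trans (hM 0), hM⟩

variable [MeasurableSpace L] [BorelSpace L] {μ : Measure L} [μ.IsAddHaarMeasure]
  [(nhdsWithin (0 : L) {0}ᶜ).NeBot] {R : ℝ} {c₀ : ℂ}

theorem convergesOn_of_bruhatTest (H : HasModuleResidue μ R c₀) {φ : L → ℂ}
    (hφ : φ ∈ bruhatTest L) (b : ℝ) : ConvergesOn μ φ 0 b := by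
  obtain ⟨u, hu, hsupp⟩ := exists_support_of_bruhatTest hφ
  obtain ⟨M, hM0, hM⟩ := exists_bound_of_bruhatTest hφ
  have hup := localModule_pos hu
  -- A nonnegative exponent makes `|x|^β` monotone in `|x|`.
  set β := max b 0
  have := H.convergesOn_of_bounds (ψ := φ) (α := 0) (β := β)
    (C := M * max 1 (localModule L u ^ β))
    (hφ.1.continuous.measurable.aestronglyMeasurable) (fun x _ _ => ?_) (fun x hx => ?_)
  · rw [neg_zero] at this
    exact ConvergesOn.mono μ this le_rfl (le_max_left _ _)
  · rw [Real.rpow_zero, mul_one]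
    exact (hM x).trans (le_mul_of_one_le_right hM0 (le_max_left _ _))
  · by_cases h0 : φ x = 0
    · rw [h0, norm_zero]
      have := localModule_nonneg x
      positivity
    · have hxp : 0 < localModule L x := by linarith
      rw [Real.rpow_neg hxp.le, ← div_eq_mul_inv, le_div_iff₀ (by positivity)]
      calc ‖φ x‖ * localModule L x ^ β ≤ M * localModule L u ^ β := by
            gcongr
            · exact hM x
            · exact hsupp x h0
        _ ≤ _ := by gcongr; exact le_max_right _ _

/-- `φ - φ(0) ω` vanishes near `0` and far out, so the bounds with exponent `1` hold once the
constant is large. -/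
theorem admissible_of_bruhatTest (H : HasModuleResidue μ R c₀) {φ : L → ℂ}
    (hφ : φ ∈ bruhatTest L) : Admissible μ φ 1 := by
  obtain ⟨t, ht, htr⟩ := exists_translation_of_bruhatTest hφ
  obtain ⟨u, hu, hsupp⟩ := exists_support_of_bruhatTest hφ
  obtain ⟨M, hM0, hM⟩ := exists_bound_of_bruhatTest hφ
  have hup := localModule_pos hu
  have htp := localModule_pos ht
  refine ⟨one_pos, H.convergesOn_of_bounds (C := max (2 * M / localModule L t)
    (M * localModule L u)) ?_ (fun x hx hx1 => ?_) (fun x hx => ?_)⟩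
  · exact (hφ.1.continuous.measurable.sub
      (measurable_const.mul (measurable_omegaInt H.measurable))).aestronglyMeasurable
  · have hxp := localModule_pos hx
    rw [omegaInt_of_le hx1, mul_one, Real.rpow_one]
    rcases le_or_gt (localModule L x) (localModule L t) with h | h
    · have := htr 0 x h
      rw [zero_add] at this
      rw [this, sub_self, norm_zero]
      positivity
    · calc ‖φ x - φ 0‖ ≤ M + M := (norm_sub_le _ _).trans (add_le_add (hM x) (hM 0))
        _ = 2 * M / localModule L t * localModule L t := by field_simp; ring
        _ ≤ _ := by gcongr; exact le_max_left _ _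
  · have hxp : 0 < localModule L x := by linarith
    rw [omegaInt_of_lt hx, mul_zero, sub_zero, Real.rpow_neg_one, ← div_eq_mul_inv,
      le_div_iff₀ hxp]
    by_cases h0 : φ x = 0
    · rw [h0, norm_zero, zero_mul]
      positivity
    · calc ‖φ x‖ * localModule L x ≤ M * localModule L u := by
            gcongr
            · exact hM x
            · exact hsupp x h0
        _ ≤ _ := le_max_right _ _

theorem omegaInt_add {x b : L} (hb : localModule L b ≤ 1) :
    (omegaInt (x + b) : ℂ) = omegaInt x := by
  have : localModule L (x + b) ≤ 1 ↔ localModule L x ≤ 1 := by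
    constructor
    · intro h
      have := localModule_sub_le (x + b) b
      rw [add_sub_cancel_right] at this
      exact this.trans (max_le h hb)
    · exact fun h => (localModule_add_le x b).trans (max_le h hb)
  by_cases h : localModule L x ≤ 1
  · rw [omegaInt_of_le h, omegaInt_of_le (this.2 h)]
  · rw [omegaInt_of_lt (not_le.1 h), omegaInt_of_lt (not_le.1 (this.not.2 h))]

theorem omegaInt_mem_bruhatTest : (omegaInt : L → ℂ) ∈ bruhatTest L := by
  refine ⟨isLocallyConstant_of_translation (t := 1) one_ne_zero fun x b hb =>
    omegaInt_add (by simpa using hb), hasCompactSupport_of_localModule (u := 1) fun x hx => ?_⟩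
  by_contra hc
  rw [localModule_one] at hc
  exact hx (omegaInt_of_lt (not_le.1 hc))

end TestFunctions

/-! ### Fourier transform for a character of given conductor. -/

section Character

variable {L : Type*} [NormedField L] [ProperSpace L] [IsUltrametricDist L]

/-- `lam` is a unitary character of the additive group of `L`, trivial on `c 𝒪` and not on
`ϖ⁻¹ c 𝒪`. -/
structure HasConductor (lam : L → ℂ) (ϖ c : L) : Prop where
  ne_zero : c ≠ 0
  map_add : ∀ x y, lam (x + y) = lam x * lam y
  norm_eq : ∀ x, ‖lam x‖ = 1
  trivial : ∀ x, localModule L x ≤ localModule L c → lam x = 1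
  nontrivial : ∃ x, localModule L (x * ϖ) ≤ localModule L c ∧ lam x ≠ 1

variable {lam : L → ℂ} {ϖ c : L} (hl : HasConductor lam ϖ c)

include hl

theorem HasConductor.map_zero : lam 0 = 1 :=
  hl.trivial 0 (by simpa using localModule_nonneg c)

theorem HasConductor.isLocallyConstant : IsLocallyConstant lam :=
  isLocallyConstant_of_translation hl.ne_zero fun x b hb => by
    rw [hl.map_add, hl.trivial b hb, mul_one]

variable [MeasurableSpace L] [BorelSpace L] {μ : Measure L} [μ.IsAddHaarMeasure]

/-- On the support of `φ` the product `x b` lies in `c 𝒪`, where the character is trivial. -/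
theorem HasConductor.fourier_add {φ : L → ℂ} {u : L} (hu : u ≠ 0)
    (h : ∀ x, φ x ≠ 0 → localModule L x ≤ localModule L u) (y b : L)
    (hb : localModule L b ≤ localModule L (c * u⁻¹)) :
    fourier lam μ φ (y + b) = fourier lam μ φ y := by
  refine integral_congr_ae (Filter.Eventually.of_forall fun x => ?_)
  dsimp only
  by_cases hx : φ x = 0
  · simp [hx]
  · rw [mul_add, hl.map_add, hl.trivial (x * b), mul_one]
    have e : localModule L c = localModule L u * localModule L (c * u⁻¹) := by
      rw [← localModule_mul]; congr 1; field_simp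
    rw [localModule_mul, e]
    exact mul_le_mul (h x hx) hb (localModule_nonneg _) (localModule_nonneg _)

/-- For larger `y`, translation by `x₀ / y` stays within the period of `φ` but multiplies `φ~(y)` by
`λ(x₀) ≠ 1`, so `φ~(y) = 0`. -/
theorem HasConductor.le_of_fourier_ne_zero (hϖ : IsUniformizer ϖ) (hϖ0 : ϖ ≠ 0) {φ : L → ℂ}
    {t : L} (ht : t ≠ 0)
    (h : ∀ x b, localModule L b ≤ localModule L t → φ (x + b) = φ x) {y : L}
    (hy : fourier lam μ φ y ≠ 0) : localModule L y ≤ localModule L (c * t⁻¹) := by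
  by_contra hc
  push Not at hc
  obtain ⟨x₀, hx₀, hne⟩ := hl.nontrivial
  have hct : c * t⁻¹ ≠ 0 := mul_ne_zero hl.ne_zero (inv_ne_zero ht)
  have hy0 : y ≠ 0 := fun h0 => by
    rw [h0, localModule_zero] at hc
    exact absurd hc (not_lt.2 (localModule_nonneg _))
  have hc2 := (hϖ.lt_iff_le hy0).1 hc
  have hb : localModule L (x₀ * y⁻¹) ≤ localModule L t := by
    have p1 := localModule_pos hϖ0
    have p2 := localModule_pos hy0
    have p3 := localModule_pos ht
    simp only [localModule_mul, localModule_inv] at hc2 hx₀ ⊢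
    rw [← div_eq_mul_inv, div_le_iff₀ p2, ← mul_le_mul_iff_left₀ p1]
    calc _ ≤ localModule L c := hx₀
      _ = localModule L c * (localModule L t)⁻¹ * localModule L t := by field_simp
      _ ≤ localModule L y * localModule L ϖ * localModule L t := by gcongr
      _ = _ := by ring
  have key : fourier lam μ φ y = fourier lam μ φ y * lam x₀ := by
    unfold fourier
    rw [← integral_mul_const]
    conv_lhs => rw [← integral_add_right_eq_self _ (x₀ * y⁻¹)]
    refine integral_congr_ae (Filter.Eventually.of_forall fun x => ?_)
    dsimp only
    rw [h x _ hb, add_mul, inv_mul_cancel_right₀ hy0, hl.map_add, mul_assoc]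
  exact hne (mul_left_cancel₀ hy (by rw [← key, mul_one]))

variable [(nhdsWithin (0 : L) {0}ᶜ).NeBot]

theorem HasConductor.fourier_mem (hϖ : IsUniformizer ϖ) (hϖ0 : ϖ ≠ 0) {φ : L → ℂ}
    (hφ : φ ∈ bruhatTest L) : fourier lam μ φ ∈ bruhatTest L := by
  obtain ⟨t, ht, htr⟩ := exists_translation_of_bruhatTest hφ
  obtain ⟨u, hu, hsupp⟩ := exists_support_of_bruhatTest hφ
  exact ⟨isLocallyConstant_of_translation (mul_ne_zero hl.ne_zero (inv_ne_zero hu))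
    (hl.fourier_add hu hsupp), hasCompactSupport_of_localModule fun y hy =>
      hl.le_of_fourier_ne_zero hϖ hϖ0 ht htr hy⟩

theorem HasConductor.isTestSpace {R : ℝ} {c₀ : ℂ} (H : HasModuleResidue μ R c₀)
    (hϖ : IsUniformizer ϖ) (hϖ0 : ϖ ≠ 0) (hs : IsSelfDual lam μ (bruhatTest L)) :
    IsTestSpace lam μ (bruhatTest L) where
  measurable_char := hl.isLocallyConstant.continuous.measurable
  norm_char x := (hl.norm_eq x).le
  char_zero := hl.map_zero
  measurable _ hφ := hφ.1.continuous.measurable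
  fourier_mem _ hφ := hl.fourier_mem hϖ hϖ0 hφ
  convergesOn _ hφ b := convergesOn_of_bruhatTest H hφ b
  admissible _ hφ := ⟨1, admissible_of_bruhatTest H hφ⟩
  self_dual := hs

theorem HasConductor.fourier_omegaInt (hϖ : IsUniformizer ϖ) (hϖ0 : ϖ ≠ 0) (y : L) :
    fourier lam μ omegaInt y =
      (μ.real {x : L | localModule L x ≤ 1} : ℂ) * omegaInt (c⁻¹ * y) := by
  have hc := localModule_pos hl.ne_zero
  have e : localModule L (c⁻¹ * y) ≤ 1 ↔ localModule L y ≤ localModule L c := by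
    rw [localModule_mul, localModule_inv, inv_mul_le_one₀ hc]
  by_cases hy : localModule L y ≤ localModule L c
  · rw [omegaInt_of_le (e.2 hy), mul_one, fourier]
    have : ∀ x : L, omegaInt x * lam (x * y) =
        {x : L | localModule L x ≤ 1}.indicator (fun _ => (1 : ℂ)) x := by
      intro x
      by_cases hx : localModule L x ≤ 1
      · rw [omegaInt_of_le hx, hl.trivial, Set.indicator_of_mem, one_mul]
        · exact hx
        · rw [localModule_mul]
          exact (mul_le_of_le_one_left (localModule_nonneg y) hx).trans hy
      · rw [omegaInt_of_lt (not_le.1 hx), Set.indicator_of_notMem, zero_mul]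
        exact hx
    simp_rw [this]
    rw [integral_indicator_const _ (measurableSet_le measurable_localModule_ultra
      measurable_const)]
    simp
  · rw [omegaInt_of_lt (not_le.1 (e.not.2 hy)), mul_zero]
    by_contra hne
    refine hy ?_
    have := hl.le_of_fourier_ne_zero hϖ hϖ0 (t := 1) one_ne_zero
      (fun x b hb => omegaInt_add (by simpa using hb)) hne
    simpa using this

/-- Fourier inversion for `ω` at the origin: `ω~` is `V` times the characteristic function of `c 𝒪`,
whose integral is `|c| V`. -/
theorem HasConductor.volume_sq (hϖ : IsUniformizer ϖ) (hϖ0 : ϖ ≠ 0)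
    (hs : IsSelfDual lam μ (bruhatTest L)) :
    μ.real {x : L | localModule L x ≤ 1} ^ 2 * localModule L c = 1 := by
  have h := hs omegaInt omegaInt_mem_bruhatTest 0
  have hS : MeasurableSet {x : L | localModule L x ≤ 1} :=
    measurableSet_le measurable_localModule_ultra measurable_const
  have hi : ∫ x, (omegaInt x : ℂ) ∂μ = (μ.real {x : L | localModule L x ≤ 1} : ℂ) := by
    change ∫ x, {x : L | localModule L x ≤ 1}.indicator (fun _ => (1 : ℂ)) x ∂μ = _
    rw [integral_indicator_const _ hS]
    simp
  rw [fourier] at h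
  simp only [mul_zero, hl.map_zero, mul_one, neg_zero, omegaInt_zero,
    hl.fourier_omegaInt hϖ hϖ0] at h
  rw [integral_const_mul, integral_comp_mul μ (inv_ne_zero hl.ne_zero), hi, localModule_inv,
    inv_inv] at h
  have h' : ((μ.real {x : L | localModule L x ≤ 1} ^ 2 * localModule L c : ℝ) : ℂ) = 1 := by
    push_cast
    linear_combination h
  exact_mod_cast h'

/-- Near `s = 1`, `Δ_s(ω~) = V² |c|^s (1 - ρ) / (1 - ρ^s)` with `ρ = |ϖ|`. Its value at `1` is `1`
because `V² |c| = 1`, so `-G(ω)` is the logarithmic derivative there. -/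
theorem HasConductor.G_omegaInt {R : ℝ} {c₀ : ℂ} (H : HasModuleResidue μ R c₀)
    (hϖ : IsUniformizer ϖ) (hϖ0 : ϖ ≠ 0) (hs : IsSelfDual lam μ (bruhatTest L)) :
    G lam μ omegaInt = ((-Real.log (localModule L c) -
      localModule L ϖ * Real.log (localModule L ϖ) / (1 - localModule L ϖ) : ℝ) : ℂ) := by
  have hT := hl.isTestSpace H hϖ hϖ0 hs
  have hd := hT.hasDerivAt_Delta_fourier H omegaInt_mem_bruhatTest
  set ρ := localModule L ϖ with hρdef
  set V := μ.real {x : L | localModule L x ≤ 1} with hV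
  have hρ : 0 < ρ := localModule_pos hϖ0
  have hc := localModule_pos hl.ne_zero
  have hρ1 : ρ < 1 := hϖ.1
  have hVc : (V : ℂ) ^ 2 * (localModule L c : ℂ) = 1 := by
    exact_mod_cast hl.volume_sq (μ := μ) hϖ hϖ0 hs
  have hρ' : (ρ : ℂ) ≠ 0 := by exact_mod_cast hρ.ne'
  have hc' : (localModule L c : ℂ) ≠ 0 := by exact_mod_cast hc.ne'
  have h1ρ : (1 : ℂ) - ρ ≠ 0 := by
    have : (1 : ℝ) - ρ ≠ 0 := by linarith
    exact_mod_cast this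
  have heq : (fun s => Delta μ s (fourier lam μ omegaInt)) =ᶠ[nhds 1]
      fun s => V * ((localModule L c : ℂ) ^ s * (((1 - ρ) * V : ℝ) / (1 - (ρ : ℂ) ^ s))) := by
    have hn : ∀ᶠ s : ℂ in nhds 1, 0 < s.re :=
      (continuous_re.tendsto 1).eventually (lt_mem_nhds (by simp))
    filter_upwards [hn] with s hs
    have h1 := Delta_omegaInt μ hϖ hϖ0 hs
    rw [← eq_div_of_mul_eq (one_sub_cpow_ne_zero hρ hρ1 hs) h1,
      ← Delta_omegaInt_comp_mul μ hl.ne_zero]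
    unfold Delta
    rw [← integral_const_mul]
    refine integral_congr_ae (Filter.Eventually.of_forall fun x => ?_)
    dsimp only
    rw [hl.fourier_omegaInt hϖ hϖ0, mul_assoc]
  have d1 : HasDerivAt (fun s : ℂ => (localModule L c : ℂ) ^ s)
      ((localModule L c : ℂ) ^ (1 : ℂ) * log (localModule L c) * 1) 1 :=
    (hasDerivAt_id (1 : ℂ)).const_cpow (Or.inl hc')
  have d2 : HasDerivAt (fun s : ℂ => (ρ : ℂ) ^ s) ((ρ : ℂ) ^ (1 : ℂ) * log ρ * 1) 1 :=
    (hasDerivAt_id (1 : ℂ)).const_cpow (Or.inl hρ')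
  have d3 := ((hasDerivAt_const (1 : ℂ) (((1 - ρ) * V : ℝ) : ℂ)).div (d2.const_sub 1)
    (by rw [cpow_one]; exact h1ρ))
  have d4 := ((d1.mul d3).const_mul (V : ℂ)).congr_of_eventuallyEq heq
  have := hd.unique d4
  rw [← ofReal_log hc.le, ← ofReal_log hρ.le] at this
  simp only [cpow_one, Pi.div_apply] at this
  rw [eq_comm, neg_eq_iff_eq_neg.symm, eq_comm] at this
  rw [← neg_neg (G lam μ omegaInt), this]
  push_cast
  field_simp
  linear_combination (-(Real.log (localModule L c) : ℂ) * (1 - ρ) -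
    ρ * (Real.log ρ : ℂ)) * hVc

end Character

/-! ### Changing the integrand and the domain of convergent integrals. -/

section HasIntegralOn

variable {X : Type*} [MeasurableSpace X] {μ : Measure X} {S : Set X} {f g : X → ℂ} {c : ℂ}

theorem HasIntegralOn.congr_ae (h : HasIntegralOn μ S f c) (hS : MeasurableSet S)
    (hfg : ∀ᵐ x ∂μ, x ∈ S → g x = f x) : HasIntegralOn μ S g c := by
  have : g =ᵐ[μ.restrict S] f := (ae_restrict_iff' hS).2 hfg
  exact ⟨h.1.congr_fun_ae this.symm, (integral_congr_ae this).trans h.2⟩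

theorem HasIntegralOn.congr_set (h : HasIntegralOn μ S f c) {S' : Set X} (hS : S =ᵐ[μ] S') :
    HasIntegralOn μ S' f c :=
  ⟨h.1.congr_set_ae hS.symm, by rw [← setIntegral_congr_set hS, h.2]⟩

theorem HasIntegralOn.split (h : HasIntegralOn μ Set.univ f c) (hS : MeasurableSet S) :
    ∃ a b, HasIntegralOn μ S f a ∧ HasIntegralOn μ Sᶜ f b ∧ a + b = c := by
  have hi : Integrable f μ := integrableOn_univ.1 h.1
  refine ⟨_, _, ⟨hi.integrableOn, rfl⟩, ⟨hi.integrableOn, rfl⟩, ?_⟩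
  rw [integral_add_compl hS hi, ← h.2, Measure.restrict_univ]

end HasIntegralOn

/-! ### Volumes for `d×u` at a finite place. -/

section Volume

variable {L : Type*} [NormedField L] [ProperSpace L] [IsUltrametricDist L] {ϖ : L}
  [MeasurableSpace L] [BorelSpace L] (μ : Measure L) [μ.IsAddHaarMeasure]

theorem measurableSet_localModule_eq (r : ℝ) : MeasurableSet {x : L | localModule L x = r} :=
  measurableSet_eq_fun measurable_localModule_ultra measurable_const

theorem mulHaar_units (γ : ℝ) :
    mulHaar μ γ {x : L | localModule L x = 1} =
      ENNReal.ofReal γ * μ {x : L | localModule L x = 1} := by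
  rw [mulHaar, withDensity_apply _ (measurableSet_localModule_eq 1), ← setLIntegral_const]
  refine setLIntegral_congr_fun (measurableSet_localModule_eq 1) fun x hx => ?_
  have hx' : localModule L x = 1 := hx
  simp only [hx', div_one]

theorem mulHaar_sphere (γ : ℝ) {t : L} (ht : t ≠ 0) :
    mulHaar μ γ {x : L | localModule L x = localModule L t} =
      mulHaar μ γ {x : L | localModule L x = 1} := by
  rw [← mulHaar_preimage_mul μ measurable_localModule_ultra γ (inv_ne_zero ht)
    (measurableSet_localModule_eq 1)]
  congr 1
  ext x
  have := localModule_pos ht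
  simp only [Set.mem_ofPred_eq, Set.mem_preimage, localModule_mul, localModule_inv]
  rw [inv_mul_eq_one₀ this.ne', eq_comm]

/-- The shell is a disjoint union of spheres `|x| = |ϖ|^(-j)`, all of the same volume by dilation
invariance. -/
theorem mulHaar_shell (h : IsUniformizer ϖ) (h0 : ϖ ≠ 0) {γ : ℝ}
    (hu : mulHaar μ γ {x : L | localModule L x = 1} =
      ENNReal.ofReal (-Real.log (localModule L ϖ))) (X : L) (hX : 1 ≤ localModule L X) :
    mulHaar μ γ {x | 1 ≤ localModule L x ∧ localModule L x < localModule L X} =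
      ENNReal.ofReal (Real.log (localModule L X)) := by
  have hρ := localModule_pos h0
  have hℓ : 0 < -Real.log (localModule L ϖ) := by linarith [Real.log_neg hρ h.1]
  have key : ∀ n : ℕ, mulHaar μ γ {x | 1 ≤ localModule L x ∧
      localModule L x < localModule L (ϖ⁻¹ ^ n)} =
      ENNReal.ofReal (n * -Real.log (localModule L ϖ)) := by
    intro n
    induction n with
    | zero =>
      have : {x : L | 1 ≤ localModule L x ∧ localModule L x < localModule L (ϖ⁻¹ ^ 0)} = ∅ := by
        ext x
        simp
      rw [this]
      simp
    | succ n ih =>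
      have hn : ϖ⁻¹ ^ n ≠ 0 := pow_ne_zero _ (inv_ne_zero h0)
      have hn1 : 1 ≤ localModule L (ϖ⁻¹ ^ n) := by
        rw [localModule_pow, localModule_inv]
        exact one_le_pow₀ ((one_le_inv₀ hρ).2 h.1.le)
      have e : {x : L | 1 ≤ localModule L x ∧ localModule L x < localModule L (ϖ⁻¹ ^ (n + 1))} =
          {x : L | 1 ≤ localModule L x ∧ localModule L x < localModule L (ϖ⁻¹ ^ n)} ∪
            {x : L | localModule L x = localModule L (ϖ⁻¹ ^ n)} := by
        ext x
        have h1 := h.lt_iff_le (x := x) (t := ϖ⁻¹ ^ (n + 1)) (pow_ne_zero _ (inv_ne_zero h0))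
        rw [pow_succ, inv_mul_cancel_right₀ h0] at h1
        rw [pow_succ]
        simp only [Set.mem_ofPred_eq, Set.mem_union, h1, le_iff_lt_or_eq (b := localModule L (ϖ⁻¹ ^ n))]
        constructor
        · rintro ⟨h2, h3 | h3⟩
          · exact Or.inl ⟨h2, h3⟩
          · exact Or.inr h3
        · rintro (⟨h2, h3⟩ | h3)
          · exact ⟨h2, Or.inl h3⟩
          · exact ⟨h3 ▸ hn1, Or.inr h3⟩
      rw [e, measure_union _ (measurableSet_localModule_eq _), ih, mulHaar_sphere μ γ hn, hu,
        ← ENNReal.ofReal_add (by positivity) hℓ.le]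
      · congr 1
        push_cast
        ring
      · rw [Set.disjoint_left]
        rintro x ⟨_, h2⟩ h3
        exact h2.ne h3
  have hX0 : X ≠ 0 := by
    rintro rfl
    rw [localModule_zero] at hX
    linarith
  obtain ⟨n, hn⟩ := h.exists_zpow h0 hX0
  have hn0 : n ≤ 0 := by
    by_contra hc
    push Not at hc
    rw [hn] at hX
    exact absurd hX (not_le.2 (zpow_lt_one₀ hρ h.1 hc))
  obtain ⟨m, rfl⟩ := Int.exists_eq_neg_ofNat hn0
  have e : localModule L X = localModule L (ϖ⁻¹ ^ m) := by
    rw [hn, localModule_pow, localModule_inv, zpow_neg, zpow_natCast, inv_pow]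
  rw [e, key m, localModule_pow, localModule_inv, Real.log_pow, Real.log_inv]

end Volume

/-! ### The function `ω₁` and Weil's local term at a finite place. -/

section Formula

variable {L : Type*} [NormedField L] [ProperSpace L] [IsUltrametricDist L]
  [(nhdsWithin (0 : L) {0}ᶜ).NeBot] {lam : L → ℂ} {ϖ c : L}
  [MeasurableSpace L] [BorelSpace L] {μ : Measure L} [μ.IsAddHaarMeasure]

theorem omegaOne_mem_bruhatTest (hϖ0 : ϖ ≠ 0) :
    (omegaOne (localModule L ϖ) : L → ℂ) ∈ bruhatTest L := by
  have h1 : IsLocallyConstant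
      (Set.indicator {x : L | localModule L (x - 1) ≤ localModule L ϖ} (1 : L → ℂ)) := by
    refine isLocallyConstant_of_translation hϖ0 fun x b hb => ?_
    have : localModule L (x + b - 1) ≤ localModule L ϖ ↔
        localModule L (x - 1) ≤ localModule L ϖ := by
      constructor
      · intro h
        have := localModule_sub_le (x + b - 1) b
        rw [show x + b - 1 - b = x - 1 by ring] at this
        exact this.trans (max_le h hb)
      · intro h
        have := localModule_add_le (x - 1) b
        rw [show x - 1 + b = x + b - 1 by ring] at this
        exact this.trans (max_le h hb)
    by_cases h : localModule L (x - 1) ≤ localModule L ϖ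
    · rw [Set.indicator_of_mem (by exact this.2 h), Set.indicator_of_mem (by exact h)]
      rfl
    · rw [Set.indicator_of_notMem (by exact this.not.2 h), Set.indicator_of_notMem (by exact h)]
  refine ⟨omegaInt_mem_bruhatTest.1.sub h1, omegaInt_mem_bruhatTest.2.sub ?_⟩
  exact HasCompactSupport.intro (isCompact_localModule_sub_le 1 ϖ) fun x hx =>
    Set.indicator_of_notMem hx _

theorem omegaOne_zero (hϖ : IsUniformizer ϖ) : omegaOne (localModule L ϖ) (0 : L) = 1 := by
  have : (0 : L) ∉ {x : L | localModule L (x - 1) ≤ localModule L ϖ} := by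
    simpa using hϖ.1
  rw [omegaOne, Set.indicator_of_notMem this, omegaInt_zero, sub_zero]

/-- `ω₁ - ω` is minus the characteristic function of `1 + ϖ 𝒪`, on which `|x| = 1`, so the integral
is minus the volume of that ball. -/
theorem P_omegaInt_omegaOne (hϖ : IsUniformizer ϖ) (hϖ0 : ϖ ≠ 0) :
    P μ omegaInt (omegaOne (localModule L ϖ)) =
      -((localModule L ϖ * μ.real {x : L | localModule L x ≤ 1} : ℝ) : ℂ) := by
  have hS : MeasurableSet {x : L | localModule L (x - 1) ≤ localModule L ϖ} :=
    (isOpen_localModule_sub_le 1 hϖ0).measurableSet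
  have e : ∀ x : L, PIntegrand omegaInt (omegaOne (localModule L ϖ)) x =
      {x : L | localModule L (x - 1) ≤ localModule L ϖ}.indicator (fun _ => (-1 : ℂ)) x := by
    intro x
    rw [PIntegrand, omegaOne_zero hϖ, one_mul, omegaOne, sub_sub_cancel_left]
    by_cases hx : localModule L (x - 1) ≤ localModule L ϖ
    · have h1 : localModule L x = 1 := by
        rw [← localModule_one (K := L)]
        refine localModule_eq_of_sub_lt ?_
        rw [localModule_one]
        exact hx.trans_lt hϖ.1
      rw [Set.indicator_of_mem (by exact hx), Set.indicator_of_mem (by exact hx), h1]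
      simp
    · rw [Set.indicator_of_notMem (by exact hx), Set.indicator_of_notMem (by exact hx)]
      simp
  unfold P
  simp_rw [e]
  rw [integral_indicator_const _ hS]
  have h2 : μ {x : L | localModule L (x - 1) ≤ localModule L ϖ} =
      ENNReal.ofReal (localModule L ϖ) * μ {x | localModule L x ≤ 1} := by
    rw [← measure_localModule_le μ hϖ0,
      ← measure_preimage_add_right μ (-1) {x : L | localModule L x ≤ localModule L ϖ}]
    simp only [sub_eq_add_neg]
    rfl
  rw [Measure.real, h2, ENNReal.toReal_mul, ENNReal.toReal_ofReal (localModule_nonneg ϖ)]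
  simp [Measure.real]

/-- At `x = 1 - 1/u` the first term of `ω₁` selects `|u| ≥ 1`, and the ball removed around `1` is
`|u| > 1`. This is why `ω₁` is the cutoff adapted to Weil's term. -/
theorem omegaOne_one_sub_inv (hϖ : IsUniformizer ϖ) {u : L} (hu : u ≠ 0) :
    omegaOne (localModule L ϖ) (1 - u⁻¹) =
      {u : L | localModule L u = 1}.indicator (fun _ => (1 : ℂ)) u := by
  have hp := localModule_pos hu
  have h1 : (omegaInt (1 - u⁻¹) : ℂ) = omegaInt (-u⁻¹) := by
    rw [show 1 - u⁻¹ = -u⁻¹ + 1 by ring]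
    exact omegaInt_add (by simp)
  have h2 : localModule L (1 - u⁻¹ - 1) = (localModule L u)⁻¹ := by
    rw [show 1 - u⁻¹ - 1 = -u⁻¹ by ring, localModule_neg, localModule_inv]
  have h3 : (localModule L u)⁻¹ ≤ localModule L ϖ ↔ (localModule L u)⁻¹ < 1 := by
    have := hϖ.lt_iff_le (x := u⁻¹) one_ne_zero
    rw [localModule_one, one_mul, localModule_inv] at this
    exact this.symm
  have h4 : localModule L (-u⁻¹) = (localModule L u)⁻¹ := by
    rw [localModule_neg, localModule_inv]
  rw [omegaOne, h1]
  rcases lt_trichotomy ((localModule L u)⁻¹) 1 with h | h | h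
  · rw [omegaInt_of_le (h4.trans_le h.le), Set.indicator_of_mem, Set.indicator_of_notMem]
    · simp
    · intro hc
      rw [show localModule L u = 1 from hc, inv_one] at h
      exact lt_irrefl _ h
    · exact h2.trans_le (h3.2 h)
  · rw [omegaInt_of_le (h4.trans_le h.le), Set.indicator_of_notMem, Set.indicator_of_mem, sub_zero]
    · exact inv_eq_one.1 h
    · intro hc
      have hc' : localModule L (1 - u⁻¹ - 1) ≤ localModule L ϖ := hc
      rw [h2, h3, h] at hc'
      exact lt_irrefl _ hc'
  · rw [omegaInt_of_lt (h4 ▸ h), Set.indicator_of_notMem, Set.indicator_of_notMem, sub_zero]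
    · intro hc
      rw [show localModule L u = 1 from hc, inv_one] at h
      exact lt_irrefl _ h
    · intro hc
      have hc' : localModule L (1 - u⁻¹ - 1) ≤ localModule L ϖ := hc
      rw [h2, h3] at hc'
      exact lt_asymm hc' h

theorem localModule_one_sub_inv {K : Type*} [NormedField K] [LocallyCompactSpace K] {u : K}
    (hu : u ≠ 0) : localModule K (1 - u⁻¹) = localModule K (1 - u) / localModule K u := by
  rw [div_eq_mul_inv, ← localModule_inv, ← localModule_mul, ← localModule_neg]
  congr 1
  field_simp
  ring

theorem comp_one_sub_mem_bruhatTest {F : L → ℂ} (hF : F ∈ bruhatMulTest L) :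
    (fun x => F (1 - x)) ∈ bruhatTest L :=
  ⟨hF.1.comp_continuous (continuous_const.sub continuous_id),
    hF.2.1.comp_homeomorph (Homeomorph.subLeft 1)⟩

theorem hasIntegralOn_weil_ultra {γ : ℝ} (hγ : 0 ≤ γ) (h0 : μ {0} = 0) (hϖ : IsUniformizer ϖ)
    {F : L → ℂ} {a : ℂ}
    (h : HasIntegralOn μ Set.univ (fun x => (F (1 - x) - F 1 * omegaOne (localModule L ϖ) x) *
      ((γ / localModule L x : ℝ) : ℂ)) a) :
    HasIntegralOn (mulHaar μ γ) Set.univ (fun u => (F u⁻¹ -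
      {u : L | localModule L u = 1}.indicator (fun _ => F 1) u) /
        (localModule L (1 - u) : ℂ)) a := by
  have hm : Measurable (localModule L) := measurable_localModule_ultra
  rw [hasIntegralOn_mulHaar_iff μ hm hγ MeasurableSet.univ]
  have h2 := hasIntegralOn_comp_one_sub_inv μ hm h0 MeasurableSet.univ h
  simp only [Set.mem_univ, Set.ofPred_true] at h2
  refine h2.congr_ae MeasurableSet.univ ?_
  filter_upwards [ae_ne_zero μ h0] with u hu _
  have hp : (localModule L u : ℂ) ≠ 0 := by exact_mod_cast (localModule_pos hu).ne'
  rw [omegaOne_one_sub_inv hϖ hu, localModule_one_sub_inv hu, sub_sub_cancel]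
  have e : {u : L | localModule L u = 1}.indicator (fun _ => F 1) u =
      F 1 * {u : L | localModule L u = 1}.indicator (fun _ => (1 : ℂ)) u := by
    by_cases h : localModule L u = 1
    · rw [Set.indicator_of_mem (by exact h), Set.indicator_of_mem (by exact h), mul_one]
    · rw [Set.indicator_of_notMem (by exact h), Set.indicator_of_notMem (by exact h), mul_zero]
  rw [e]
  push_cast
  -- At `u = 1` both sides are `0` by the convention for division.
  by_cases h1 : (localModule L (1 - u) : ℂ) = 0
  · simp [h1]
  · field_simp

end Formula

/-! ### Test functions `f(|u|) χ(u)⁻¹`. -/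

section Hecke

variable {L : Type*} [NormedField L] [ProperSpace L] [IsUltrametricDist L]
  [MeasurableSpace L] [BorelSpace L] {μ : Measure L} [μ.IsAddHaarMeasure]

theorem heckeTest_coe (f : ℝ → ℂ) (χ : Lˣ →* Circle) (u : Lˣ) :
    heckeTest f χ u = f (localModule L u) * ((χ u)⁻¹ : Circle) := by
  rw [heckeTest, dif_neg u.ne_zero, Units.mk0_val]

@[simp] theorem heckeTest_zero (f : ℝ → ℂ) (χ : Lˣ →* Circle) : heckeTest f χ 0 = 0 := by
  rw [heckeTest, dif_pos rfl]

theorem norm_heckeTest_le (f : ℝ → ℂ) (χ : Lˣ →* Circle) (u : L) :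
    ‖heckeTest f χ u‖ ≤ ‖f (localModule L u)‖ := by
  by_cases hu : u = 0
  · simp [hu]
  · lift u to Lˣ using isUnit_iff_ne_zero.2 hu
    rw [heckeTest_coe, norm_mul, Circle.norm_coe, mul_one]

theorem measurable_heckeTest {f : ℝ → ℂ} {χ : Lˣ →* Circle} (hf : Continuous f)
    (hχ : Continuous χ) : Measurable (heckeTest f χ) := by
  refine measurable_of_continuousOn_compl_singleton 0 fun x hx => ContinuousAt.continuousWithinAt ?_
  lift x to Lˣ using isUnit_iff_ne_zero.2 hx
  rw [← (Units.isOpenEmbedding_val (R := L)).continuousAt_iff]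
  have e : heckeTest f χ ∘ Units.val = fun u : Lˣ =>
      f (localModule L u) * ((χ u)⁻¹ : Circle) := funext fun u => heckeTest_coe f χ u
  rw [e]
  have h1 : ContinuousAt (fun u : Lˣ => localModule L u) x :=
    (continuousAt_localModule x.ne_zero).comp Units.continuous_val.continuousAt
  exact (hf.continuousAt.comp h1).mul
    (continuous_subtype_val.comp hχ.inv).continuousAt

theorem localModule_one_sub_of_ne {u : L} (hu : localModule L u ≠ 1) :
    localModule L (1 - u) = max 1 (localModule L u) := by
  rcases lt_or_gt_of_ne hu with h | h
  · rw [max_eq_left h.le, ← localModule_one (K := L)]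
    refine localModule_eq_of_sub_lt ?_
    rwa [sub_sub_cancel_left, localModule_neg, localModule_one]
  · rw [max_eq_right h.le, ← localModule_neg u]
    refine localModule_eq_of_sub_lt ?_
    rwa [sub_neg_eq_add, sub_add_cancel, localModule_neg, localModule_one]

theorem hasIntegralOn_heckeTest_units (γ : ℝ) (f : ℝ → ℂ) (χ : Lˣ →* Circle)
    (hχ : ∀ u : Lˣ, localModule L (u : L) = 1 → χ u = 1) :
    HasIntegralOn (mulHaar μ γ) {u : L | localModule L u = 1}
      (fun u => (heckeTest f χ u⁻¹ - heckeTest f χ 1) / (localModule L (1 - u) : ℂ)) 0 := by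
  have h0 : HasIntegralOn (mulHaar μ γ) {u : L | localModule L u = 1} (fun _ => 0) 0 :=
    ⟨integrableOn_zero, by simp⟩
  refine h0.congr_ae (measurableSet_localModule_eq 1) (Filter.Eventually.of_forall fun u hu => ?_)
  have hu' : localModule L u = 1 := hu
  have hu0 : u ≠ 0 := fun h => by simp [h] at hu'
  lift u to Lˣ using isUnit_iff_ne_zero.2 hu0
  have h1 := heckeTest_coe f χ (1 : Lˣ)
  rw [Units.val_one] at h1
  rw [← Units.val_inv_eq_inv_val, heckeTest_coe, h1, hχ _ (by
    rw [Units.val_inv_eq_inv_val, localModule_inv, hu', inv_one]), map_one,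
    Units.val_inv_eq_inv_val, localModule_inv, hu', localModule_one]
  simp

/-- If `f` lives on `[a, b]`, the integrand vanishes unless `a ≤ |u|⁻¹ ≤ b`. There the density `γ /
|u|` is at most `γ b`, and `|1 - u| ≥ 1` off the unit sphere. A power of `t₀` provides a ball of
finite volume containing this region. -/
theorem integrable_heckeTest {γ : ℝ} (hγ : 0 ≤ γ) {f : ℝ → ℂ} {χ : Lˣ →* Circle}
    (hf : Continuous f) (hfc : HasCompactSupport f) (hf0 : tsupport f ⊆ Set.Ioi 0)
    (hχ : Continuous χ) {t₀ : L} (ht₀ : 1 < ‖t₀‖) :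
    IntegrableOn (fun u => heckeTest f χ u⁻¹ / (localModule L (1 - u) : ℂ))
      {u : L | localModule L u ≠ 1} (mulHaar μ γ) := by
  have hm : Measurable (localModule L) := measurable_localModule_ultra
  have hS : MeasurableSet {u : L | localModule L u ≠ 1} := (measurableSet_localModule_eq 1).compl
  obtain ⟨M, hM⟩ := hfc.exists_bound_of_continuous hf
  have hM0 : 0 ≤ M := (norm_nonneg _).trans (hM 0)
  obtain ⟨a, ha, haf⟩ : ∃ a > 0, ∀ r, f r ≠ 0 → a ≤ r := by
    rcases (tsupport f).eq_empty_or_nonempty with h | h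
    · refine ⟨1, one_pos, fun r hr => ?_⟩
      have := subset_tsupport f hr
      rw [h] at this
      exact this.elim
    · obtain ⟨a, ha, hmin⟩ := hfc.isCompact.exists_isLeast h
      exact ⟨a, hf0 ha, fun r hr => hmin (subset_tsupport f hr)⟩
  obtain ⟨b, hb, hbf⟩ : ∃ b > 0, ∀ r, f r ≠ 0 → r ≤ b := by
    obtain ⟨b, hb⟩ := hfc.isCompact.isBounded.exists_norm_le
    exact ⟨max b 1, by positivity, fun r hr =>
      (le_abs_self r).trans ((hb r (subset_tsupport f hr)).trans (le_max_left _ _))⟩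
  have ht1 : 1 < localModule L t₀ := by
    rw [← localModule_one (K := L), localModule_lt_iff, norm_one]
    exact ht₀
  obtain ⟨n, hn⟩ := pow_unbounded_of_one_lt a⁻¹ ht1
  rw [← localModule_pow] at hn
  rw [← integrable_indicator_iff hS, integrable_mulHaar_iff μ hm hγ]
  have hfin := measure_localModule_lt_top μ (t₀ ^ n)
  have hB : MeasurableSet {u : L | localModule L u ≤ localModule L (t₀ ^ n)} :=
    measurableSet_le hm measurable_const
  refine Integrable.mono' (g := {u : L | localModule L u ≤ localModule L (t₀ ^ n)}.indicator
    fun _ => γ * b * M) ((integrable_indicator_iff hB).2 (integrableOn_const hfin.ne)) ?_ ?_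
  · refine (Measurable.mul (measurable_ofReal.comp (measurable_const.div hm)) ?_).aestronglyMeasurable
    refine Measurable.indicator ?_ hS
    exact ((measurable_heckeTest hf hχ).comp measurable_inv).div
      (measurable_ofReal.comp (hm.comp (measurable_const.sub measurable_id)))
  · refine Filter.Eventually.of_forall fun u => ?_
    have hnn : 0 ≤ {u : L | localModule L u ≤ localModule L (t₀ ^ n)}.indicator
        (fun _ => γ * b * M) u := Set.indicator_nonneg (fun _ _ => by positivity) _
    by_cases hu : localModule L u = 1
    · rw [Set.indicator_of_notMem (by simpa using hu), mul_zero, norm_zero]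
      exact hnn
    by_cases hu0 : u = 0
    · subst hu0
      rw [localModule_zero, div_zero, ofReal_zero, zero_mul, norm_zero]
      exact hnn
    by_cases hfu : f (localModule L u⁻¹) = 0
    · have : heckeTest f χ u⁻¹ = 0 := by
        rw [← norm_le_zero_iff]
        exact (norm_heckeTest_le f χ u⁻¹).trans (by rw [hfu, norm_zero])
      rw [Set.indicator_of_mem (by exact hu), this, zero_div, mul_zero, norm_zero]
      exact hnn
    have hp := localModule_pos hu0
    have k1 := haf _ hfu
    have k2 := hbf _ hfu
    rw [localModule_inv] at k1 k2
    have k3 : localModule L u ≤ localModule L (t₀ ^ n) := by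
      refine le_trans ?_ hn.le
      rwa [le_inv_comm₀ hp ha]
    rw [Set.indicator_of_mem (by exact hu), Set.indicator_of_mem (by exact k3), norm_mul, norm_div,
      norm_real, norm_real, localModule_one_sub_of_ne hu, Real.norm_of_nonneg (by positivity),
      Real.norm_of_nonneg (by positivity), div_eq_mul_inv]
    have k4 : ‖heckeTest f χ u⁻¹‖ / max 1 (localModule L u) ≤ M :=
      (div_le_self (norm_nonneg _) (le_max_left _ _)).trans
        ((norm_heckeTest_le f χ u⁻¹).trans (hM _))
    gcongr

/-- Multiplication by a unit `v` with `χ(v) ≠ 1` preserves `d×u`. It also preserves `|1 - u| =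
max(1, |u|)` off the unit sphere, and it multiplies the integrand by `χ(v)`. Hence the integral
equals `χ(v)` times itself. -/
theorem hasIntegralOn_heckeTest_ne_one {γ : ℝ} (hγ : 0 ≤ γ) {f : ℝ → ℂ} {χ : Lˣ →* Circle}
    (hf : Continuous f) (hfc : HasCompactSupport f) (hf0 : tsupport f ⊆ Set.Ioi 0)
    (hχ : Continuous χ) {t₀ : L} (ht₀ : 1 < ‖t₀‖)
    (hne : ∃ u : Lˣ, localModule L (u : L) = 1 ∧ χ u ≠ 1) :
    HasIntegralOn (mulHaar μ γ) {u : L | localModule L u ≠ 1}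
      (fun u => heckeTest f χ u⁻¹ / (localModule L (1 - u) : ℂ)) 0 := by
  refine ⟨integrable_heckeTest hγ hf hfc hf0 hχ ht₀, ?_⟩
  obtain ⟨v, hv1, hv2⟩ := hne
  have hm : Measurable (localModule L) := measurable_localModule_ultra
  have hS : MeasurableSet {u : L | localModule L u ≠ 1} := (measurableSet_localModule_eq 1).compl
  rw [← integral_indicator hS]
  set g := {u : L | localModule L u ≠ 1}.indicator
    (fun u => heckeTest f χ u⁻¹ / (localModule L (1 - u) : ℂ)) with hg
  have hinv : ∀ u, g (v * u) = (χ v : ℂ) * g u := by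
    intro u
    have e : localModule L ((v : L) * u) = localModule L u := by rw [localModule_mul, hv1, one_mul]
    by_cases hu : localModule L u = 1
    · rw [hg, Set.indicator_of_notMem (by simpa [e] using hu),
        Set.indicator_of_notMem (by simpa using hu), mul_zero]
    · rw [hg, Set.indicator_of_mem (by simpa [e] using hu),
        Set.indicator_of_mem (by simpa using hu), localModule_one_sub_of_ne (by rwa [e]),
        localModule_one_sub_of_ne hu, e]
      by_cases hu0 : u = 0
      · simp [hu0]
      · lift u to Lˣ using isUnit_iff_ne_zero.2 hu0
        rw [← Units.val_mul, ← Units.val_inv_eq_inv_val, ← Units.val_inv_eq_inv_val,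
          heckeTest_coe, heckeTest_coe, Units.val_inv_eq_inv_val, Units.val_inv_eq_inv_val,
          localModule_inv, localModule_inv, Units.val_mul, e, map_inv, map_inv, inv_inv, inv_inv,
          map_mul, Circle.coe_mul]
        ring
  have h1 := (measurePreserving_mul_mulHaar μ hm γ v.ne_zero).integral_comp
    (measurableEmbedding_mul_left v.ne_zero) g
  simp_rw [hinv] at h1
  rw [integral_const_mul] at h1
  have h2 : (χ v : ℂ) - 1 ≠ 0 := by
    rw [sub_ne_zero]
    exact fun hc => hv2 (by ext; simpa using hc)
  refine (mul_eq_zero.1 (?_ : ((χ v : ℂ) - 1) * _ = 0)).resolve_left h2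
  linear_combination h1

end Hecke

/-! ### The fractional part and the additive character. -/

section PadicFract

variable (p : ℕ) [Fact p.Prime]

theorem padicFract_spec (x : ℚ_[p]) :
    0 ≤ padicFract p x ∧ padicFract p x < 1 ∧
      (∃ m k : ℕ, padicFract p x = m / (p : ℚ) ^ k) ∧ ‖x - (padicFract p x : ℚ_[p])‖ ≤ 1 :=
  (exists_padicFract p x).choose_spec

/-- This is `ℤ[1/p] ∩ ℤ_p = ℤ`: `p`-integrality of `n / p^k` forces `p^k` to divide `n`. -/
theorem exists_int_eq_of_norm_le_one {r : ℚ} (hr : ∃ (n : ℤ) (k : ℕ), r * (p : ℚ) ^ k = n)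
    (h : ‖(r : ℚ_[p])‖ ≤ 1) : ∃ n : ℤ, r = n := by
  obtain ⟨n, k, hn⟩ := hr
  have hp : (p : ℚ) ≠ 0 := by exact_mod_cast (Fact.out : p.Prime).ne_zero
  have h1 : ‖(n : ℚ_[p])‖ ≤ (p : ℝ) ^ (-(k : ℤ)) := by
    have : (n : ℚ_[p]) = (r : ℚ_[p]) * (p : ℚ_[p]) ^ k := by
      have := congrArg (fun q : ℚ => (q : ℚ_[p])) hn
      push_cast at this
      exact this.symm
    rw [this, norm_mul, norm_pow, Padic.norm_p, inv_pow, zpow_neg, zpow_natCast]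
    exact mul_le_of_le_one_left (by positivity) h
  obtain ⟨m, hm⟩ := (Padic.norm_int_le_pow_iff_dvd n k).1 h1
  refine ⟨m, ?_⟩
  rw [hm] at hn
  push_cast at hn
  have hpk : (p : ℚ) ^ k ≠ 0 := pow_ne_zero _ hp
  exact mul_right_cancel₀ hpk (by rw [hn, mul_comm])

theorem padicFract_mul_pow (x : ℚ_[p]) :
    ∃ (n : ℤ) (k : ℕ), padicFract p x * (p : ℚ) ^ k = n := by
  obtain ⟨m, k, h⟩ := (padicFract_spec p x).2.2.1
  have hp : (p : ℚ) ≠ 0 := by exact_mod_cast (Fact.out : p.Prime).ne_zero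
  exact ⟨m, k, by rw [h]; push_cast; field_simp⟩

theorem padicFract_add (x y : ℚ_[p]) :
    ∃ n : ℤ, padicFract p (x + y) = padicFract p x + padicFract p y + n := by
  have key : ∃ n : ℤ, padicFract p (x + y) - padicFract p x - padicFract p y = n := by
    refine exists_int_eq_of_norm_le_one p ?_ ?_
    · obtain ⟨n₁, k₁, h₁⟩ := padicFract_mul_pow p x
      obtain ⟨n₂, k₂, h₂⟩ := padicFract_mul_pow p y
      obtain ⟨n₃, k₃, h₃⟩ := padicFract_mul_pow p (x + y)
      refine ⟨n₃ * p ^ (k₁ + k₂) - n₁ * p ^ (k₂ + k₃) - n₂ * p ^ (k₁ + k₃), k₁ + k₂ + k₃, ?_⟩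
      push_cast
      rw [← h₁, ← h₂, ← h₃]
      ring
    · have h₁ := (padicFract_spec p x).2.2.2
      have h₂ := (padicFract_spec p y).2.2.2
      have h₃ := (padicFract_spec p (x + y)).2.2.2
      have e : ((padicFract p (x + y) - padicFract p x - padicFract p y : ℚ) : ℚ_[p]) =
          (x - padicFract p x) + ((y - padicFract p y) - ((x + y) - padicFract p (x + y))) := by
        push_cast
        ring
      rw [e]
      refine (Padic.nonarchimedean _ _).trans (max_le h₁ ?_)
      rw [sub_eq_add_neg]
      refine (Padic.nonarchimedean _ _).trans (max_le h₂ ?_)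
      rwa [norm_neg]
  obtain ⟨n, hn⟩ := key
  exact ⟨n, by rw [← hn]; ring⟩

theorem padicFract_eq_zero_iff (x : ℚ_[p]) : padicFract p x = 0 ↔ ‖x‖ ≤ 1 := by
  obtain ⟨h0, h1, _, h3⟩ := padicFract_spec p x
  constructor
  · intro h
    simpa [h] using h3
  · intro h
    have hn : ‖(padicFract p x : ℚ_[p])‖ ≤ 1 := by
      have e : (padicFract p x : ℚ_[p]) = x + -(x - padicFract p x) := by ring
      rw [e]
      exact (Padic.nonarchimedean _ _).trans (max_le h (by rwa [norm_neg]))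
    obtain ⟨n, hn⟩ := exists_int_eq_of_norm_le_one p (padicFract_mul_pow p x) hn
    rw [hn] at h0 h1 ⊢
    have h0' : 0 ≤ n := by exact_mod_cast h0
    have h1' : n < 1 := by exact_mod_cast h1
    have : n = 0 := by omega
    simp [this]

variable (L : Type*) [Field L] [Algebra ℚ_[p] L]

theorem padicChar_add (x y : L) :
    padicChar p L (x + y) = padicChar p L x * padicChar p L y := by
  obtain ⟨n, hn⟩ := padicFract_add p (Algebra.trace ℚ_[p] L x) (Algebra.trace ℚ_[p] L y)
  rw [padicChar, map_add, hn, padicChar, padicChar, ← exp_add]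
  have e : (2 * Real.pi * I * ((padicFract p (Algebra.trace ℚ_[p] L x) +
      padicFract p (Algebra.trace ℚ_[p] L y) + n : ℚ) : ℂ) : ℂ) =
      (2 * Real.pi * I * (padicFract p (Algebra.trace ℚ_[p] L x) : ℚ) +
        2 * Real.pi * I * (padicFract p (Algebra.trace ℚ_[p] L y) : ℚ)) +
        n * (2 * Real.pi * I) := by
    push_cast
    ring
  rw [e, exp_add _ ((n : ℂ) * _), exp_int_mul_two_pi_mul_I, mul_one]

/-- The exponential is `1` only when the fractional part is an integer, and the only integer in `[0,
1)` is `0`. -/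
theorem padicChar_eq_one_iff (x : L) :
    padicChar p L x = 1 ↔ ‖Algebra.trace ℚ_[p] L x‖ ≤ 1 := by
  rw [← padicFract_eq_zero_iff, padicChar, exp_eq_one_iff]
  obtain ⟨h0, h1, _, _⟩ := padicFract_spec p (Algebra.trace ℚ_[p] L x)
  constructor
  · rintro ⟨n, hn⟩
    have h2 : ((padicFract p (Algebra.trace ℚ_[p] L x) : ℚ) : ℂ) = n := by
      have := Complex.two_pi_I_ne_zero
      refine mul_left_cancel₀ this ?_
      rw [hn]
      ring
    have h3 : padicFract p (Algebra.trace ℚ_[p] L x) = n := by exact_mod_cast h2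
    rw [h3] at h0 h1 ⊢
    have h0' : 0 ≤ n := by exact_mod_cast h0
    have h1' : n < 1 := by exact_mod_cast h1
    have : n = 0 := by omega
    simp [this]
  · intro h
    exact ⟨0, by simp [h]⟩

theorem norm_padicChar (x : L) : ‖padicChar p L x‖ = 1 := by
  rw [padicChar, norm_exp]
  simp

end PadicFract

/-! ### Assembly at a finite place. -/

section FinitePlace

variable (p : ℕ) [Fact p.Prime] (L : Type*) [NormedField L] [NormedAlgebra ℚ_[p] L]

include p

theorem isUltrametricDist_of_padic : IsUltrametricDist L := by
  refine IsUltrametricDist.isUltrametricDist_of_forall_norm_natCast_le_one fun n => ?_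
  rw [← map_natCast (algebraMap ℚ_[p] L) n, norm_algebraMap']
  exact_mod_cast Padic.norm_int_le_one (p := p) n

theorem norm_natCast_prime : ‖(p : L)‖ = (p : ℝ)⁻¹ := by
  rw [← map_natCast (algebraMap ℚ_[p] L) p, norm_algebraMap', Padic.norm_p]

theorem norm_natCast_prime_lt_one : ‖(p : L)‖ < 1 := by
  rw [norm_natCast_prime]
  exact inv_lt_one_of_one_lt₀ (by exact_mod_cast (Fact.out : p.Prime).one_lt)

theorem norm_natCast_prime_pos : 0 < ‖(p : L)‖ := by
  rw [norm_natCast_prime]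
  exact inv_pos.2 (by exact_mod_cast (Fact.out : p.Prime).pos)

theorem neBot_of_padic : (nhdsWithin (0 : L) {0}ᶜ).NeBot := by
  let nf : NontriviallyNormedField L :=
    { (inferInstance : NormedField L) with
      non_trivial := ⟨(p : L)⁻¹, by
        rw [norm_inv]
        exact (one_lt_inv₀ (norm_natCast_prime_pos p L)).2 (norm_natCast_prime_lt_one p L)⟩ }
  exact @NormedField.nhdsNE_neBot L nf 0

variable {L}

/-- The element `p` has module strictly between `0` and `1`, so the maximal module below `1` is not
`0`. -/
theorem IsUniformizer.ne_zero_of_padic [ProperSpace L] {ϖ : L} (h : IsUniformizer ϖ) : ϖ ≠ 0 := by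
  have := isUltrametricDist_of_padic p L
  rintro rfl
  have h1 := h.2 (p : L) (localModule_lt_one_of_norm (norm_natCast_prime_lt_one p L))
  rw [localModule_zero] at h1
  have h2 : (p : L) ≠ 0 := norm_pos_iff.1 (norm_natCast_prime_pos p L)
  exact absurd h1 (not_le.2 (localModule_pos h2))

/-- Triviality on `ϖ^(-δ) 𝒪` is the defining property of `δ`. Its maximality makes `δ + 1` fail, and
the element that witnesses this is one on which the character is not `1`. -/
theorem hasConductor_padicChar [ProperSpace L] {ϖ : L} {δ : ℤ} (hϖ : IsUniformizer ϖ)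
    (hδ : IsDifferentExponent p ϖ δ) : HasConductor (padicChar p L) ϖ (ϖ ^ (-δ)) := by
  have h0 := hϖ.ne_zero_of_padic p
  have hc : ϖ ^ (-δ) ≠ 0 := zpow_ne_zero _ h0
  refine ⟨hc, padicChar_add p L, norm_padicChar p L, fun x hx => ?_, ?_⟩
  · rw [padicChar_eq_one_iff]
    have := hδ.1 ((ϖ ^ (-δ))⁻¹ * x) (by
      rw [localModule_mul, localModule_inv, inv_mul_le_one₀ (localModule_pos hc)]
      exact hx)
    rwa [mul_inv_cancel_left₀ hc] at this
  · have h1 : δ + 1 ∉ {d : ℤ | ∀ a : L, localModule L a ≤ 1 →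
        ‖Algebra.trace ℚ_[p] L (ϖ ^ (-d) * a)‖ ≤ 1} := fun hm => by
      have := hδ.2 hm
      omega
    simp only [Set.mem_ofPred_eq, not_forall] at h1
    obtain ⟨a, ha, hn⟩ := h1
    refine ⟨ϖ ^ (-(δ + 1)) * a, ?_, fun hc => hn ((padicChar_eq_one_iff p L _).1 hc)⟩
    have e : ϖ ^ (-(δ + 1)) * a * ϖ = ϖ ^ (-δ) * a := by
      rw [neg_add, zpow_add₀ h0, zpow_neg_one]
      field_simp
    rw [e, localModule_mul]
    exact mul_le_of_le_one_right (localModule_nonneg _) ha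

end FinitePlace

theorem finitePlace (p : ℕ) [Fact p.Prime] (L : Type*) [NormedField L] [NormedAlgebra ℚ_[p] L]
      [FiniteDimensional ℚ_[p] L] [LocallyCompactSpace L] [MeasurableSpace L] [BorelSpace L]
      (μ : Measure L) [μ.IsAddHaarMeasure] (ϖ : L) (q R : ℝ) (δ : ℤ)
      (hs : LocalLog.IsSelfDual (LocalLog.padicChar p L) μ (LocalLog.bruhatTest L))
      (hϖ : LocalLog.IsUniformizer ϖ)
      (hq : q = (LocalLog.localModule L ϖ)⁻¹)
      (hδ : LocalLog.IsDifferentExponent p ϖ δ)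
      (hR : R = q ^ (-(δ : ℝ) / 2) * (1 - 1 / q) / Real.log q) :
      μ {x | LocalLog.localModule L x ≤ 1} = ENNReal.ofReal (q ^ (-(δ : ℝ) / 2)) ∧
      LocalLog.UniformFormula (LocalLog.padicChar p L) μ (LocalLog.bruhatTest L) R
        (Real.log q / (q - 1) - δ * Real.log q - Real.log q / 2) ∧
      LocalLog.mulHaar μ (1 / R) {x | LocalLog.localModule L x = 1} =
        ENNReal.ofReal (Real.log q) ∧
      LocalLog.G (LocalLog.padicChar p L) μ LocalLog.omegaInt =
        ((Real.log q / (q - 1) - δ * Real.log q : ℝ) : ℂ) ∧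
      (∀ φ ∈ LocalLog.bruhatTest L,
        LocalLog.G (LocalLog.padicChar p L) μ φ =
          ((1 / R : ℝ) : ℂ) * (LocalLog.P μ LocalLog.omegaInt φ +
            ((q ^ (-(δ : ℝ) / 2 - 1) : ℝ) : ℂ) * φ 0) - ((δ * Real.log q : ℝ) : ℂ) * φ 0) ∧
      (∀ φ ∈ LocalLog.bruhatTest L,
        Integrable (LocalLog.PIntegrand (LocalLog.omegaOne (1 / q)) φ) μ ∧
        LocalLog.G (LocalLog.padicChar p L) μ φ =
          ((1 / R : ℝ) : ℂ) * LocalLog.P μ (LocalLog.omegaOne (1 / q)) φ -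
            ((δ * Real.log q : ℝ) : ℂ) * φ 0) ∧
      (∀ F ∈ LocalLog.bruhatMulTest L,
        (∃ a, LocalLog.HasIntegralOn μ Set.univ
            (fun x => (F (1 - x) - F 1 * LocalLog.omegaOne (1 / q) x) *
              ((1 / R / LocalLog.localModule L x : ℝ) : ℂ)) a ∧
          LocalLog.weilTerm (LocalLog.padicChar p L) μ F =
            a - ((δ * Real.log q : ℝ) : ℂ) * F 1) ∧
        (∃ a b,
          LocalLog.HasIntegralOn (LocalLog.mulHaar μ (1 / R))
            {u | LocalLog.localModule L u = 1}
            (fun u => (F u⁻¹ - F 1) / (LocalLog.localModule L (1 - u) : ℂ)) a ∧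
          LocalLog.HasIntegralOn (LocalLog.mulHaar μ (1 / R))
            {u | LocalLog.localModule L u ≠ 1}
            (fun u => F u⁻¹ / (LocalLog.localModule L (1 - u) : ℂ)) b ∧
          LocalLog.weilTerm (LocalLog.padicChar p L) μ F =
            a + b - ((δ * Real.log q : ℝ) : ℂ) * F 1)) ∧
      (∀ (f : ℝ → ℂ) (χ : Lˣ →* Circle), ContDiff ℝ ∞ f → HasCompactSupport f →
        tsupport f ⊆ Set.Ioi 0 → Continuous χ →
        ((∀ u : Lˣ, LocalLog.localModule L (u : L) = 1 → χ u = 1) →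
          LocalLog.HasIntegralOn (LocalLog.mulHaar μ (1 / R))
            {u | LocalLog.localModule L u = 1}
            (fun u => (LocalLog.heckeTest f χ u⁻¹ - LocalLog.heckeTest f χ 1) /
              (LocalLog.localModule L (1 - u) : ℂ)) 0) ∧
        ((∃ u : Lˣ, LocalLog.localModule L (u : L) = 1 ∧ χ u ≠ 1) →
          LocalLog.HasIntegralOn (LocalLog.mulHaar μ (1 / R))
            {u | LocalLog.localModule L u ≠ 1}
            (fun u => LocalLog.heckeTest f χ u⁻¹ / (LocalLog.localModule L (1 - u) : ℂ)) 0)) := by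
  have : ProperSpace L := FiniteDimensional.proper ℚ_[p] L
  have := isUltrametricDist_of_padic p L
  have := neBot_of_padic p L
  have h0 : ϖ ≠ 0 := hϖ.ne_zero_of_padic p
  have hl := hasConductor_padicChar p hϖ hδ
  set ρ := localModule L ϖ with hρdef
  have hρ : 0 < ρ := localModule_pos h0
  have hρ1 : ρ < 1 := hϖ.1
  have hq0 : 0 < q := by rw [hq]; positivity
  have hq1 : 1 < q := by rw [hq]; exact (one_lt_inv₀ hρ).2 hρ1
  have hρq : 1 / q = ρ := by rw [hq, one_div, inv_inv]
  have hℓ : -Real.log ρ = Real.log q := by rw [hq, Real.log_inv]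
  have hℓ0 : 0 < Real.log q := Real.log_pos hq1
  have hnull := null_zero_of_uniformizer μ hϖ h0
  have hc : localModule L (ϖ ^ (-δ)) = q ^ (δ : ℝ) := by
    rw [localModule_zpow, ← hρdef, Real.rpow_intCast, hq, inv_zpow']
  set V := μ.real {x : L | localModule L x ≤ 1} with hVdef
  have hV : V = q ^ (-(δ : ℝ) / 2) := by
    -- Here `|c| = q^δ`, so self-duality reads `V² q^δ = 1`.
    have h1 := hl.volume_sq (μ := μ) hϖ h0 hs
    rw [hc] at h1
    have h2 : (q ^ (-(δ : ℝ) / 2)) ^ 2 * q ^ (δ : ℝ) = 1 := by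
      rw [← Real.rpow_natCast, ← Real.rpow_mul hq0.le, ← Real.rpow_add hq0]
      norm_num
    have h3 : V ^ 2 = (q ^ (-(δ : ℝ) / 2)) ^ 2 :=
      mul_right_cancel₀ (Real.rpow_pos_of_pos hq0 (δ : ℝ)).ne' (h1.trans h2.symm)
    exact (pow_left_inj₀ (measureReal_integers_pos μ).le (by positivity) two_ne_zero).1 h3
  have hVpos : 0 < V := measureReal_integers_pos μ
  have hR' : R = (1 - ρ) * V / -Real.log ρ := by
    rw [hR, hρq, hℓ, ← hV]
    ring
  have H : HasModuleResidue μ R (((1 - ρ) * V : ℝ) / 2 : ℂ) := by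
    rw [hR']
    exact hasModuleResidue_ultra μ hϖ h0
  have hRpos := H.pos
  have hT := hl.isTestSpace H hϖ h0 hs
  have hVol : μ {x : L | localModule L x ≤ 1} = ENNReal.ofReal V := by
    have := measure_localModule_lt_top μ (1 : L)
    rw [localModule_one] at this
    rw [hVdef, ofReal_measureReal this.ne]
  have hunits : mulHaar μ (1 / R) {x : L | localModule L x = 1} =
      ENNReal.ofReal (Real.log q) := by
    rw [mulHaar_units, measure_units μ hϖ h0, ← hρdef, hVol, ← ENNReal.ofReal_mul (by linarith),
      ← ENNReal.ofReal_mul (by positivity), hR', ← hℓ]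
    congr 1
    have : 1 - ρ ≠ 0 := by linarith
    have : Real.log ρ ≠ 0 := by linarith
    field_simp
  have hρℓ : ρ / (1 - ρ) = 1 / (q - 1) := by
    rw [← hρq]
    have : q - 1 ≠ 0 := by linarith
    field_simp
  have hGω : G (padicChar p L) μ omegaInt =
      ((Real.log q / (q - 1) - δ * Real.log q : ℝ) : ℂ) := by
    rw [hl.G_omegaInt H hϖ h0 hs, hc, Real.log_rpow hq0, ← hρdef]
    congr 1
    have : ρ * Real.log ρ / (1 - ρ) = -(Real.log q) * (ρ / (1 - ρ)) := by
      rw [← hℓ]; ring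
    rw [this, hρℓ]
    ring
  -- The term `(log q) / (q - 1)` of `G(ω)` is `γ ρ V`. It can be written as `γ q^(-δ/2 - 1)`, or
  -- absorbed by replacing `ω` with `ω₁`, since `P_ω(ω₁) = -ρ V`.
  have hγρ : 1 / R * (ρ * V) = Real.log q / (q - 1) := by
    have h1 : 1 / R * (ρ * V) = Real.log q * (ρ / (1 - ρ)) := by
      rw [hR', ← hℓ]
      have : 1 - ρ ≠ 0 := by linarith
      have : Real.log ρ ≠ 0 := by linarith
      field_simp
    rw [h1, hρℓ, mul_one_div]
  have hpow : q ^ (-(δ : ℝ) / 2 - 1) = ρ * V := by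
    rw [Real.rpow_sub hq0, Real.rpow_one, ← hV, ← hρq]
    ring
  have hform : ∀ φ ∈ bruhatTest L, G (padicChar p L) μ φ =
      ((1 / R : ℝ) : ℂ) * (P μ omegaInt φ +
        ((q ^ (-(δ : ℝ) / 2 - 1) : ℝ) : ℂ) * φ 0) - ((δ * Real.log q : ℝ) : ℂ) * φ 0 := by
    intro φ hφ
    rw [hT.G_eq H hφ omegaInt_mem_bruhatTest omegaInt_zero, hGω, hpow, ← hγρ]
    push_cast
    ring
  have hform1 : ∀ φ ∈ bruhatTest L, Integrable (PIntegrand (omegaOne (1 / q)) φ) μ ∧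
      G (padicChar p L) μ φ = ((1 / R : ℝ) : ℂ) * P μ (omegaOne (1 / q)) φ -
        ((δ * Real.log q : ℝ) : ℂ) * φ 0 := by
    intro φ hφ
    have a1 := admissible_of_bruhatTest H hφ
    have a2 := admissible_of_bruhatTest H (omegaOne_mem_bruhatTest h0)
    rw [hρq]
    refine ⟨integrable_PIntegrand (omegaOne_zero hϖ) a2 a1, ?_⟩
    rw [P_eq_sub (omegaOne_zero hϖ) a2 a1, hform φ hφ, P_omegaInt_omegaOne hϖ h0, hpow]
    ring
  have hW : ∀ F ∈ bruhatMulTest L, ∃ a, HasIntegralOn μ Set.univ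
      (fun x => (F (1 - x) - F 1 * omegaOne (1 / q) x) *
        ((1 / R / localModule L x : ℝ) : ℂ)) a ∧
      weilTerm (padicChar p L) μ F = a - ((δ * Real.log q : ℝ) : ℂ) * F 1 := by
    intro F hF
    obtain ⟨h1, h2⟩ := hform1 _ (comp_one_sub_mem_bruhatTest hF)
    have e : (fun x => (F (1 - x) - F 1 * omegaOne (1 / q) x) *
        ((1 / R / localModule L x : ℝ) : ℂ)) =
        fun x => ((1 / R : ℝ) : ℂ) * PIntegrand (omegaOne (1 / q)) (fun x => F (1 - x)) x := by
      ext x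
      simp only [PIntegrand, sub_zero]
      push_cast
      ring
    refine ⟨_, ⟨?_, rfl⟩, ?_⟩
    · rw [e, integrableOn_univ]
      exact h1.const_mul _
    · rw [weilTerm, h2, e, Measure.restrict_univ, integral_const_mul, sub_zero]
      rfl
  refine ⟨by rw [hVol, hV], ?_, hunits, hGω, hform, hform1, fun F hF => ⟨hW F hF, ?_⟩, ?_⟩
  · refine hT.uniformFormula H (fun φ hφ => ?_) ?_
    -- The finite part of `Δ_s(ω)` times `γ` is `(log q) / 2`. Passing from `P_ω` to `P` subtracts
    -- it from the constant.
    · have h2 : 1 / R * ((1 - ρ) * V / 2) = Real.log q / 2 := by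
        rw [hR', ← hℓ]
        have : 1 - ρ ≠ 0 := by linarith
        have : Real.log ρ ≠ 0 := by linarith
        field_simp
      have h3 : ((1 / R : ℝ) : ℂ) * (((1 - ρ) * V : ℝ) / 2 : ℂ) =
          ((Real.log q / 2 : ℝ) : ℂ) := by
        rw [← h2]
        push_cast
        ring
      rw [hT.G_eq H hφ omegaInt_mem_bruhatTest omegaInt_zero, hGω, mul_add, ← mul_assoc, h3]
      push_cast
      ring
    · exact mulHaar_shell μ hϖ h0 (by rw [hunits, hℓ])
  · obtain ⟨a, ha, haW⟩ := hW F hF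
    rw [hρq] at ha
    have h1 := hasIntegralOn_weil_ultra (γ := 1 / R) (by positivity) hnull hϖ ha
    have hS : MeasurableSet {u : L | localModule L u = 1} := measurableSet_localModule_eq 1
    obtain ⟨b, b', hb, hb', hbb⟩ := h1.split hS
    refine ⟨b, b', hb.congr_ae hS (Filter.Eventually.of_forall fun u hu => ?_),
      hb'.congr_ae hS.compl (Filter.Eventually.of_forall fun u hu => ?_), ?_⟩
    · rw [Set.indicator_of_mem hu]
    · rw [Set.indicator_of_notMem hu, sub_zero]
    · rw [hbb, haW]
  · intro f χ hf hfc hf0 hχ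
    refine ⟨hasIntegralOn_heckeTest_units (1 / R) f χ,
      hasIntegralOn_heckeTest_ne_one (by positivity) hf.continuous hfc hf0 hχ
        (t₀ := (p : L)⁻¹) ?_⟩
    rw [norm_inv]
    exact (one_lt_inv₀ (norm_natCast_prime_pos p L)).2 (norm_natCast_prime_lt_one p L)

/-! ### Polar coordinates at the archimedean places. -/

section Radial

variable {K : Type*} [NormedField K] [NormedAlgebra ℝ K] [FiniteDimensional ℝ K]
  [LocallyCompactSpace K] [MeasurableSpace K] [BorelSpace K] [SecondCountableTopology K]
  {μ : Measure K} [μ.IsAddHaarMeasure]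

variable (hd : ∀ x : K, localModule K x = ‖x‖ ^ Module.finrank ℝ K)

include hd

theorem measurable_localModule_of_norm : Measurable (localModule K) := by
  have : localModule K = fun x => ‖x‖ ^ Module.finrank ℝ K := funext hd
  rw [this]
  fun_prop

omit hd in
theorem radial_weight {r : ℝ} (hr : 0 < r) (s z : ℂ) :
    r ^ (Module.finrank ℝ K - 1) • (z * ((r ^ Module.finrank ℝ K : ℝ) : ℂ) ^ (s - 1)) = (r : ℂ) ^ (Module.finrank ℝ K * s - 1) • z := by
  have hd1 : 1 ≤ Module.finrank ℝ K := Module.finrank_pos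
  have hr' : (r : ℂ) ≠ 0 := by exact_mod_cast hr.ne'
  have e : (((r ^ (Module.finrank ℝ K - 1) : ℝ)) : ℂ) * ((r ^ Module.finrank ℝ K : ℝ) : ℂ) ^ (s - 1) =
      (r : ℂ) ^ (Module.finrank ℝ K * s - 1) := by
    rw [← Real.rpow_natCast, ← Real.rpow_natCast, ← cpow_mul_ofReal_nonneg hr.le,
      ofReal_cpow hr.le, ← cpow_add _ _ hr', Nat.cast_sub hd1]
    congr 1
    push_cast
    ring
  rw [real_smul, smul_eq_mul, ← e]
  ring

theorem integrable_radial (g : ℝ → ℂ) (s : ℂ) :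
    Integrable (fun x : K => g ‖x‖ * (localModule K x : ℂ) ^ (s - 1)) μ ↔
      MellinConvergent g (Module.finrank ℝ K * s) := by
  simp only [hd]
  rw [integrable_fun_norm_addHaar μ (f := fun r => g r * ((r ^ Module.finrank ℝ K : ℝ) : ℂ) ^ (s - 1)),
    MellinConvergent]
  exact integrableOn_congr_fun (fun r hr => radial_weight hr s (g r)) measurableSet_Ioi

/-- With `d` the real dimension, the weight `r^(d-1) (r^d)^(s-1)` is `r^(d s - 1)`, so the radial
integral is a Mellin transform at `d s`. -/
theorem Delta_radial (g : ℝ → ℂ) (s : ℂ) :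
    Delta μ s (fun x : K => g ‖x‖) =
      Module.finrank ℝ K * (μ.real (Metric.ball 0 1) : ℂ) * mellin g (Module.finrank ℝ K * s) := by
  unfold Delta
  simp only [hd]
  rw [integral_fun_norm_addHaar μ (fun r => g r * ((r ^ Module.finrank ℝ K : ℝ) : ℂ) ^ (s - 1)), mellin,
    nsmul_eq_mul, real_smul, mul_assoc]
  congr 2
  exact setIntegral_congr_fun measurableSet_Ioi fun r hr => radial_weight hr s (g r)

theorem localModule_le_one_iff_norm (x : K) : localModule K x ≤ 1 ↔ ‖x‖ ≤ 1 := by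
  rw [hd]
  exact pow_le_one_iff_of_nonneg (norm_nonneg x) Module.finrank_pos.ne'

/-- The radial integral gives `Δ_s(ω) = d V / (d s) = V / s` exactly, hence the constant term `0`.
-/
theorem hasModuleResidue_of_norm :
    HasModuleResidue μ (μ.real (Metric.ball (0 : K) 1)) 0 := by
  have hd0 : (Module.finrank ℝ K : ℂ) ≠ 0 := by exact_mod_cast Module.finrank_pos.ne'
  have e : (omegaInt : K → ℂ) = fun x => Set.indicator (Set.Iic 1) (fun _ => 1 : ℝ → ℂ) ‖x‖ := by
    funext x
    by_cases h : ‖x‖ ≤ 1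
    · rw [omegaInt_of_le ((localModule_le_one_iff_norm hd x).2 h), Set.indicator_of_mem (by exact h)]
    · rw [omegaInt_of_lt (not_le.1 (mt (localModule_le_one_iff_norm hd x).1 h)),
        Set.indicator_of_notMem (by exact h)]
  have hM : ∀ s : ℂ, 0 < s.re →
      HasMellin (Set.indicator (Set.Iic 1) (fun _ => 1 : ℝ → ℂ)) s (1 / s) := by
    intro s hs
    have h := hasMellin_one_Ioc hs
    have hc : Set.EqOn (fun t : ℝ => (t : ℂ) ^ (s - 1) •
        Set.indicator (Set.Ioc 0 1) (fun _ => 1 : ℝ → ℂ) t) (fun t : ℝ => (t : ℂ) ^ (s - 1) •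
        Set.indicator (Set.Iic 1) (fun _ => 1 : ℝ → ℂ) t) (Set.Ioi 0) := by
      intro t ht
      simp only [Set.indicator, Set.mem_Ioc, Set.mem_Iic, show 0 < t from ht, true_and]
    exact ⟨(integrableOn_congr_fun hc measurableSet_Ioi).1 h.1,
      (setIntegral_congr_fun measurableSet_Ioi hc).symm.trans h.2⟩
  have hre : ∀ s : ℂ, 0 < s.re → 0 < (Module.finrank ℝ K * s : ℂ).re := by
    intro s hs
    have : (0 : ℝ) < Module.finrank ℝ K := by exact_mod_cast Module.finrank_pos
    simpa using mul_pos this hs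
  refine ⟨measurable_localModule_of_norm hd, measure_singleton 0, ?_, ?_, ?_⟩
  · exact ENNReal.toReal_pos (Metric.measure_ball_pos _ _ one_pos).ne' measure_ball_lt_top.ne
  · intro s hs
    rw [e]
    exact (integrable_radial hd _ s).2 (hM _ (hre s hs)).1
  · refine ⟨fun _ => 0, analyticAt_const, rfl, Filter.Eventually.of_forall fun s hs => ?_⟩
    have hs0 : s ≠ 0 := by rintro rfl; simp at hs
    rw [e, Delta_radial hd, (hM _ (hre s hs)).2]
    field_simp
    simp

/-- In polar coordinates the volume is `d` times the integral of `1/r` from `1` to `‖X‖`, and `d log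
‖X‖ = log |X|`. -/
theorem mulHaar_shell_of_norm (X : K) (hX : 1 ≤ localModule K X) :
    mulHaar μ (1 / μ.real (Metric.ball (0 : K) 1))
      {x | 1 ≤ localModule K x ∧ localModule K x < localModule K X} =
      ENNReal.ofReal (Real.log (localModule K X)) := by
  have hm := measurable_localModule_of_norm hd
  have hd1 : 1 ≤ Module.finrank ℝ K := Module.finrank_pos
  have hdp : (0 : ℝ) < Module.finrank ℝ K := by exact_mod_cast hd1
  set V := μ.real (Metric.ball (0 : K) 1) with hV
  have hVp : 0 < V :=
    ENNReal.toReal_pos (Metric.measure_ball_pos _ _ one_pos).ne' measure_ball_lt_top.ne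
  have hX1 : 1 ≤ ‖X‖ := by
    rw [hd] at hX
    exact (one_le_pow_iff_of_nonneg (norm_nonneg X) (by omega)).1 hX
  let g : ℝ → ℝ := Set.indicator (Set.Ico 1 ‖X‖) fun r => 1 / V / r ^ Module.finrank ℝ K
  have hset : {x : K | 1 ≤ localModule K x ∧ localModule K x < localModule K X} =
      {x | ‖x‖ ∈ Set.Ico 1 ‖X‖} := by
    ext x
    simp only [Set.mem_ofPred_eq, hd, Set.mem_Ico]
    rw [one_le_pow_iff_of_nonneg (norm_nonneg x) (by omega),
      pow_lt_pow_iff_left₀ (norm_nonneg x) (norm_nonneg X) (by omega)]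
  have hms : MeasurableSet {x : K | ‖x‖ ∈ Set.Ico 1 ‖X‖} := measurable_norm measurableSet_Ico
  have hg : ∀ r, 0 < r → r ^ (Module.finrank ℝ K - 1) • g r =
      Set.indicator (Set.Ico 1 ‖X‖) (fun r => V⁻¹ * r⁻¹) r := by
    intro r hr
    by_cases h : r ∈ Set.Ico 1 ‖X‖
    · have e : r ^ Module.finrank ℝ K = r ^ (Module.finrank ℝ K - 1) * r := by rw [← pow_succ, Nat.sub_add_cancel hd1]
      simp only [g, Set.indicator_of_mem h, smul_eq_mul, e]
      field_simp
    · simp only [g, Set.indicator_of_notMem h, smul_zero]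
  have hio : IntegrableOn (fun r : ℝ => V⁻¹ * r⁻¹) (Set.Ico 1 ‖X‖) := by
    refine (ContinuousOn.integrableOn_Icc ?_).mono_set Set.Ico_subset_Icc_self
    exact continuousOn_const.mul (continuousOn_inv₀.mono fun r hr => by
      have := hr.1; simp only [Set.mem_compl_iff, Set.mem_singleton_iff]; linarith)
  have hint : Integrable (fun x : K => g ‖x‖) μ := by
    rw [integrable_fun_norm_addHaar μ]
    refine (integrableOn_congr_fun (fun r hr => hg r hr) measurableSet_Ioi).2 ?_
    exact ((integrable_indicator_iff measurableSet_Ico).2 hio).integrableOn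
  have hgn : ∀ r, 0 ≤ g r := fun r => Set.indicator_nonneg (fun r hr => by
    have : 0 ≤ r := zero_le_one.trans hr.1
    positivity) r
  have hI : ∫ x : K, g ‖x‖ ∂μ = Real.log (localModule K X) := by
    rw [integral_fun_norm_addHaar μ,
      setIntegral_congr_fun measurableSet_Ioi (fun r hr => hg r hr),
      setIntegral_indicator measurableSet_Ico, show Set.Ioi (0 : ℝ) ∩ Set.Ico 1 ‖X‖ =
        Set.Ico 1 ‖X‖ from Set.inter_eq_right.2 fun r hr => zero_lt_one.trans_le hr.1,
      integral_Ico_eq_integral_Ioc, ← intervalIntegral.integral_of_le hX1,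
      intervalIntegral.integral_const_mul, integral_inv_of_pos one_pos (by linarith), hd,
      Real.log_pow, nsmul_eq_mul, smul_eq_mul, div_one, ← hV]
    field_simp
  rw [hset, mulHaar, withDensity_apply _ hms, ← hI,
    ofReal_integral_eq_lintegral_ofReal hint (Filter.Eventually.of_forall fun x => hgn _),
    ← lintegral_indicator hms]
  refine lintegral_congr fun x => ?_
  by_cases h : ‖x‖ ∈ Set.Ico 1 ‖X‖
  · simp only [g, Set.indicator_of_mem h, hd]
    rw [Set.indicator_of_mem (by exact h)]
  · simp only [g, Set.indicator_of_notMem h, ENNReal.ofReal_zero]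
    rw [Set.indicator_of_notMem (by exact h)]

end Radial

/-! ### Convergence from growth bounds. -/

section Bounds

variable {K : Type*} [NormedField K] [LocallyCompactSpace K]
  [MeasurableSpace K] [BorelSpace K] [SecondCountableTopology K]
  {μ : Measure K} [μ.IsAddHaarMeasure] {R : ℝ} {c₀ : ℂ} (H : HasModuleResidue μ R c₀)

include H

theorem HasModuleResidue.convergesOn_zero {ψ : K → ℂ} (hψ : AEStronglyMeasurable ψ μ)
    {C C' β : ℝ} (hb : ∀ x, ‖ψ x‖ ≤ C)
    (hdec : ∀ x, 1 < localModule K x → ‖ψ x‖ ≤ C' * localModule K x ^ (-β)) :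
    ConvergesOn μ ψ 0 β := by
  have h := H.convergesOn_of_bounds hψ (C := max C C') (α := 0) (β := β)
    (fun x _ _ => by
      rw [Real.rpow_zero, mul_one]
      exact (hb x).trans (le_max_left _ _))
    (fun x hx => (hdec x hx).trans (mul_le_mul_of_nonneg_right (le_max_right _ _)
      (Real.rpow_nonneg (localModule_nonneg x) _)))
  rwa [neg_zero] at h

theorem HasModuleResidue.admissible {ψ : K → ℂ} (hψ : Measurable ψ) {C C' α : ℝ} (hα : 0 < α)
    (hlip : ∀ x, localModule K x ≤ 1 → ‖ψ x - ψ 0‖ ≤ C * localModule K x ^ α)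
    (hdec : ∀ x, 1 < localModule K x → ‖ψ x‖ ≤ C' * localModule K x ^ (-α)) :
    Admissible μ ψ α := by
  refine ⟨hα, H.convergesOn_of_bounds (C := max C C') ?_ (fun x _ hx => ?_) (fun x hx => ?_)⟩
  · exact (hψ.sub ((measurable_omegaInt H.measurable).const_mul _)).aestronglyMeasurable
  · rw [omegaInt_of_le hx, mul_one]
    exact (hlip x hx).trans (mul_le_mul_of_nonneg_right (le_max_left _ _)
      (Real.rpow_nonneg (localModule_nonneg x) _))
  · rw [omegaInt_of_lt hx, mul_zero, sub_zero]
    exact (hdec x hx).trans (mul_le_mul_of_nonneg_right (le_max_right _ _)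
      (Real.rpow_nonneg (localModule_nonneg x) _))

end Bounds

/-! ### Schwartz functions and Gaussians. -/

section Archimedean

variable {K : Type*} [NormedField K] [NormedAlgebra ℝ K] [FiniteDimensional ℝ K]
  [LocallyCompactSpace K] [MeasurableSpace K] [BorelSpace K] [SecondCountableTopology K]
  {μ : Measure K} [μ.IsAddHaarMeasure] {R : ℝ}

variable (hd : ∀ x : K, localModule K x = ‖x‖ ^ Module.finrank ℝ K)

include hd

theorem rpow_localModule_of_norm (x : K) (n : ℕ) :
    localModule K x ^ (-(n : ℝ)) = (‖x‖ ^ (Module.finrank ℝ K * n))⁻¹ := by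
  rw [hd, Real.rpow_neg (by positivity), Real.rpow_natCast, pow_mul]

theorem rpow_inv_finrank_localModule (x : K) :
    localModule K x ^ ((Module.finrank ℝ K : ℝ)⁻¹) = ‖x‖ := by
  rw [hd, Real.pow_rpow_inv_natCast (norm_nonneg x) Module.finrank_pos.ne']

theorem norm_gt_one_of_localModule {x : K} (hx : 1 < localModule K x) : 1 < ‖x‖ := by
  rw [← not_le, ← localModule_le_one_iff_norm hd x, not_le]
  exact hx

theorem schwartz_decay (f : 𝓢(K, ℂ)) (b : ℝ) :
    ∃ C, ∀ x, 1 < localModule K x → ‖f x‖ ≤ C * localModule K x ^ (-b) := by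
  obtain ⟨n, hn⟩ := exists_nat_ge b
  obtain ⟨C, hC, h⟩ := f.decay (Module.finrank ℝ K * n) 0
  refine ⟨C, fun x hx => ?_⟩
  have hx1 := norm_gt_one_of_localModule hd hx
  have h1 : ‖f x‖ ≤ C * localModule K x ^ (-(n : ℝ)) := by
    rw [rpow_localModule_of_norm hd, ← div_eq_mul_inv, le_div_iff₀ (by positivity), mul_comm]
    simpa using h x
  exact h1.trans (mul_le_mul_of_nonneg_left
    (Real.rpow_le_rpow_of_exponent_le hx.le (by linarith)) hC.le)

theorem schwartz_convergesOn (f : 𝓢(K, ℂ)) (b : ℝ) : ConvergesOn μ f 0 b := by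
  obtain ⟨C, h⟩ := schwartz_decay hd f b
  obtain ⟨C', -, h'⟩ := f.decay 0 0
  exact (hasModuleResidue_of_norm hd).convergesOn_zero f.continuous.aestronglyMeasurable
    (C := C') (fun x => by simpa using h' x) h

/-- A Schwartz function is Lipschitz for the norm, so Hölder of exponent `1/d` for the module. This
determines the width of the strip. -/
theorem schwartz_admissible (f : 𝓢(K, ℂ)) :
    Admissible μ f ((Module.finrank ℝ K : ℝ)⁻¹) := by
  have hdp : (0 : ℝ) < Module.finrank ℝ K := by exact_mod_cast Module.finrank_pos
  obtain ⟨C, h⟩ := schwartz_decay hd f ((Module.finrank ℝ K : ℝ)⁻¹)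
  obtain ⟨C', -, h'⟩ := f.decay 0 1
  refine (hasModuleResidue_of_norm hd).admissible f.continuous.measurable (C := C')
    (inv_pos.2 hdp) (fun x _ => ?_) h
  rw [rpow_inv_finrank_localModule hd]
  have := (convex_univ (𝕜 := ℝ) (E := K)).norm_image_sub_le_of_norm_fderiv_le (f := f) (C := C')
    (fun x _ => f.differentiable x) (fun x _ => by
      have := h' x
      rwa [pow_zero, one_mul, norm_iteratedFDeriv_one] at this) (Set.mem_univ 0) (Set.mem_univ x)
  simpa using this

/-- The Gaussian `exp (-a |x|²)`. -/
def gaussian (K : Type*) [Norm K] (a : ℝ) (x : K) : ℂ :=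
  (Real.exp (-(a * ‖x‖ ^ 2)) : ℝ)

omit hd in
theorem measurable_gaussian (a : ℝ) : Measurable (gaussian K a) := by
  unfold gaussian
  fun_prop

omit hd [NormedAlgebra ℝ K] [FiniteDimensional ℝ K] [LocallyCompactSpace K] [MeasurableSpace K]
  [BorelSpace K] [SecondCountableTopology K] in
theorem norm_gaussian (a : ℝ) (x : K) : ‖gaussian K a x‖ = Real.exp (-(a * ‖x‖ ^ 2)) := by
  rw [gaussian, norm_real, Real.norm_of_nonneg (Real.exp_pos _).le]

/-- From `e^t ≥ t^d / d!` at `t = a ‖x‖²`. The decay `‖x‖^(-2d) = |x|^(-2)` gives convergence on `0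
< Re s < 2`, around the point `s = 1`. -/
theorem gaussian_decay {a : ℝ} (ha : 0 < a) (x : K) (hx : 1 < localModule K x) :
    ‖gaussian K a x‖ ≤ (Module.finrank ℝ K).factorial / a ^ Module.finrank ℝ K *
      localModule K x ^ (-(2 : ℝ)) := by
  have hx1 := norm_gt_one_of_localModule hd hx
  have h := Real.pow_div_factorial_le_exp (a * ‖x‖ ^ 2) (by positivity) (Module.finrank ℝ K)
  have e := rpow_localModule_of_norm hd x 2
  rw [Nat.cast_ofNat] at e
  rw [norm_gaussian, Real.exp_neg, e, inv_le_comm₀ (Real.exp_pos _) (by positivity)]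
  refine le_trans (le_of_eq ?_) h
  rw [mul_pow, ← pow_mul, mul_comm 2 (Module.finrank ℝ K)]
  field_simp

theorem gaussian_convergesOn {a : ℝ} (ha : 0 < a) : ConvergesOn μ (gaussian K a) 0 2 := by
  refine (hasModuleResidue_of_norm hd).convergesOn_zero
    (measurable_gaussian a).aestronglyMeasurable (C := 1) (fun x => ?_) (gaussian_decay hd ha)
  rw [norm_gaussian, Real.exp_le_one_iff]
  have : 0 ≤ a * ‖x‖ ^ 2 := by positivity
  linarith

theorem gaussian_admissible {a : ℝ} (ha : 0 < a) :
    Admissible μ (gaussian K a) ((Module.finrank ℝ K : ℝ)⁻¹) := by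
  have hd1 : (1 : ℝ) ≤ Module.finrank ℝ K := by exact_mod_cast Module.finrank_pos
  refine (hasModuleResidue_of_norm hd).admissible (measurable_gaussian a) (C := a)
    (C' := (Module.finrank ℝ K).factorial / a ^ Module.finrank ℝ K)
    (inv_pos.2 (by linarith)) (fun x hx => ?_) (fun x hx => (gaussian_decay hd ha x hx).trans ?_)
  · have hx1 := (localModule_le_one_iff_norm hd x).1 hx
    have h1 := Real.add_one_le_exp (-(a * ‖x‖ ^ 2))
    have h2 : Real.exp (-(a * ‖x‖ ^ 2)) ≤ 1 := by
      rw [Real.exp_le_one_iff]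
      have : 0 ≤ a * ‖x‖ ^ 2 := by positivity
      linarith
    have e0 : gaussian K a 0 = (1 : ℝ) := by simp [gaussian]
    rw [rpow_inv_finrank_localModule hd, e0, gaussian, ← ofReal_sub, norm_real, Real.norm_eq_abs,
      abs_sub_comm, abs_of_nonneg (by linarith)]
    have : a * ‖x‖ ^ 2 ≤ a * ‖x‖ := by
      gcongr
      exact pow_le_of_le_one (norm_nonneg x) hx1 two_ne_zero
    linarith
  · refine mul_le_mul_of_nonneg_left (Real.rpow_le_rpow_of_exponent_le hx.le ?_) (by positivity)
    have := inv_le_one_of_one_le₀ hd1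
    linarith

/-- The substitution `t = r²` turns the Mellin transform of `e^(-a r²)` into Euler's integral for
Gamma. -/
theorem Delta_gaussian {a : ℝ} (ha : 0 < a) {s : ℂ} (hs : 0 < s.re) :
    Delta μ s (gaussian K a) = (Module.finrank ℝ K / 2 : ℂ) *
      (μ.real (Metric.ball (0 : K) 1) : ℂ) * ((1 / (a : ℂ)) ^ ((Module.finrank ℝ K / 2 : ℂ) * s) *
        Gamma ((Module.finrank ℝ K / 2 : ℂ) * s)) := by
  have hdp : (0 : ℝ) < Module.finrank ℝ K := by exact_mod_cast Module.finrank_pos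
  have e : (gaussian K a) = fun x => (fun t : ℝ => (fun r : ℝ => exp (-(a * r : ℂ))) (t ^ (2 : ℝ)))
      ‖x‖ := by
    funext x
    simp [gaussian]
  have e2 : (Module.finrank ℝ K * s / (2 : ℝ) : ℂ) = (Module.finrank ℝ K / 2 : ℂ) * s := by
    push_cast; ring
  rw [e, Delta_radial hd (fun t : ℝ => (fun r : ℝ => exp (-(a * r : ℂ))) (t ^ (2 : ℝ))),
    mellin_comp_rpow (fun r : ℝ => exp (-(a * r : ℂ))), e2, mellin]
  simp only [smul_eq_mul]
  rw [integral_cpow_mul_exp_neg_mul_Ioi _ ha, real_smul]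
  · push_cast
    simp
    ring
  · have : 0 < (Module.finrank ℝ K : ℝ) / 2 * s.re := by positivity
    convert this using 1
    rw [show (Module.finrank ℝ K / 2 : ℂ) = ((Module.finrank ℝ K / 2 : ℝ) : ℂ) by push_cast; rfl,
      re_ofReal_mul]

theorem gaussian_hasLaurent {a : ℝ} (ha : 0 < a) :
    HasLaurent μ (gaussian K a) (μ.real (Metric.ball (0 : K) 1))
      (-((μ.real (Metric.ball (0 : K) 1) * (Module.finrank ℝ K / 2) *
        (Real.log a + Real.eulerMascheroniConstant) : ℝ) : ℂ)) := by
  set V := μ.real (Metric.ball (0 : K) 1) with hV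
  set n := Module.finrank ℝ K with hn
  have hnp : (n : ℂ) ≠ 0 := by exact_mod_cast Module.finrank_pos.ne'
  have haC : (1 / (a : ℂ)) ≠ 0 := one_div_ne_zero (by exact_mod_cast ha.ne')
  have hlog : log (1 / (a : ℂ)) = -Real.log a := by
    rw [← ofReal_one, ← ofReal_div, ← ofReal_log (by positivity), one_div, Real.log_inv, ofReal_neg]
  -- The recursion `Γ(z + 1) = z Γ(z)` rewrites `Δ_s` as `V k(s) / s` with `k(0) = 1`, so the
  -- constant term is `V k'(0)`. Euler's constant enters through `Γ'(1)`.
  let k : ℂ → ℂ := fun s => (1 / (a : ℂ)) ^ ((n / 2 : ℂ) * s) * Gamma ((n / 2 : ℂ) * s + 1)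
  have hlin : ∀ s : ℂ, HasDerivAt (fun s : ℂ => (n / 2 : ℂ) * s) (n / 2 : ℂ) s := fun s => by
    simpa using (hasDerivAt_id s).const_mul (n / 2 : ℂ)
  have hk : AnalyticAt ℂ k 0 := by
    have hG : AnalyticAt ℂ (fun s : ℂ => Gamma ((n / 2 : ℂ) * s + 1)) 0 := by
      have ho : IsOpen {s : ℂ | 0 < ((n / 2 : ℂ) * s + 1).re} :=
        isOpen_lt continuous_const (by fun_prop)
      refine DifferentiableOn.analyticAt (s := {s : ℂ | 0 < ((n / 2 : ℂ) * s + 1).re})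
        (fun s hs => ?_) (ho.mem_nhds (by simp))
      refine (DifferentiableAt.comp s (differentiableAt_Gamma _ fun m hm => ?_)
        (by fun_prop)).differentiableWithinAt
      rw [Set.mem_ofPred_eq, hm] at hs
      simp at hs
      have : (0 : ℝ) ≤ m := m.cast_nonneg
      linarith
    have hC : AnalyticAt ℂ (fun s : ℂ => (1 / (a : ℂ)) ^ ((n / 2 : ℂ) * s)) 0 :=
      Differentiable.analyticAt (fun s =>
        ((hlin s).const_cpow (Or.inl haC)).differentiableAt) 0
    exact hC.mul hG
  have hk0 : k 0 = 1 := by simp [k]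
  have hk' : HasDerivAt k (-((n / 2 : ℂ) * (Real.log a + Real.eulerMascheroniConstant))) 0 := by
    have h1 := (hlin 0).const_cpow (c := 1 / (a : ℂ)) (Or.inl haC)
    have h2 : HasDerivAt (fun s : ℂ => Gamma ((n / 2 : ℂ) * s + 1))
        (-Real.eulerMascheroniConstant * (n / 2 : ℂ)) 0 :=
      HasDerivAt.comp (0 : ℂ) (by simpa using hasDerivAt_Gamma_one) ((hlin 0).add_const 1)
    refine (h1.mul h2).congr_deriv ?_
    simp only [mul_zero, cpow_zero, zero_add, Gamma_one, hlog]
    ring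
  refine ⟨fun s => V * dslope k 0 s, ?_, ?_, Filter.Eventually.of_forall fun s hs => ?_⟩
  · obtain ⟨p, hp⟩ := hk
    exact analyticAt_const.mul ⟨_, hp.has_fpower_series_dslope_fslope⟩
  · simp only [dslope_same, hk'.deriv]
    push_cast
    ring
  · have hs0 : s ≠ 0 := by rintro rfl; simp at hs
    have hG := Gamma_add_one ((n / 2 : ℂ) * s) (by simp [hs0, hnp])
    dsimp only
    rw [Delta_gaussian hd ha hs, dslope_of_ne _ hs0, slope_def_field, hk0, sub_zero]
    simp only [k, hG, ← hV, ← hn]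
    field_simp
    ring

/-- The Gaussian serves as `h` and as `w`, and `ψ` is the digamma value at `d/2`. Two terms make up
`τ`: the logarithmic derivative of `Δ_s` at `s = 1` gives `(d/2)(log a - ψ)`, and replacing the
Gaussian by the sharp cutoff adds `(d/2)(log a + γ_e)`. -/
theorem IsTestSpace.G_eq_cutoff {lam : K → ℂ} {T : Set (K → ℂ)} (hT : IsTestSpace lam μ T)
    {a ψ τ : ℝ} (ha : 0 < a) (hw : fourier lam μ (gaussian K a) = gaussian K a)
    (hi : ∫ x, gaussian K a x ∂μ = 1)
    (hψ : HasDerivAt Gamma (Gamma (Module.finrank ℝ K / 2 : ℂ) * ψ) (Module.finrank ℝ K / 2 : ℂ))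
    (hτ : τ = (Module.finrank ℝ K / 2 : ℝ) *
      (2 * Real.log a + Real.eulerMascheroniConstant - ψ))
    {φ : K → ℂ} (hφ : φ ∈ T) :
    G lam μ φ = ((1 / μ.real (Metric.ball (0 : K) 1) : ℝ) : ℂ) * P μ omegaInt φ + τ * φ 0 := by
  have H := hasModuleResidue_of_norm (μ := μ) hd
  have hV : (μ.real (Metric.ball (0 : K) 1) : ℂ) ≠ 0 := by exact_mod_cast H.pos.ne'
  have haC : (1 / (a : ℂ)) ≠ 0 := one_div_ne_zero (by exact_mod_cast ha.ne')
  have hlog : log (1 / (a : ℂ)) = -Real.log a := by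
    rw [← ofReal_one, ← ofReal_div, ← ofReal_log (by positivity), one_div, Real.log_inv, ofReal_neg]
  have hconv := gaussian_convergesOn (μ := μ) hd ha
  have hadm := gaussian_admissible (μ := μ) hd ha
  obtain ⟨ε, hφa⟩ := hT.admissible φ hφ
  have hw0 : gaussian K a 0 = 1 := by simp [gaussian]
  have hc := (hadm.hasLaurent H).unique (by
    rw [hw0, mul_one]; exact gaussian_hasLaurent (μ := μ) hd ha)
  rw [hw0, zero_mul, add_zero] at hc
  have hD1 : Delta μ 1 (gaussian K a) = 1 := by simpa [Delta] using hi
  have hg : ∫ y, ((-Real.log (localModule K y) : ℝ) : ℂ) * gaussian K a y ∂μ =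
      (Module.finrank ℝ K / 2 : ℂ) * (Real.log a - ψ) := by
    have h1 := (hconv.hasDerivAt H.measurable H.null_zero (s₀ := 1) (by simp) (by simp)).2
    have hlin : HasDerivAt (fun s : ℂ => (Module.finrank ℝ K / 2 : ℂ) * s)
        (Module.finrank ℝ K / 2 : ℂ) 1 := by
      simpa using (hasDerivAt_id (1 : ℂ)).const_mul (Module.finrank ℝ K / 2 : ℂ)
    have h2 := hlin.const_cpow (c := 1 / (a : ℂ)) (Or.inl haC)
    have h3 : HasDerivAt (fun s : ℂ => Gamma ((Module.finrank ℝ K / 2 : ℂ) * s)) _ 1 :=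
      HasDerivAt.comp (1 : ℂ) (by simpa using hψ) hlin
    have h4 := ((h2.mul h3).const_mul ((Module.finrank ℝ K / 2 : ℂ) *
      (μ.real (Metric.ball (0 : K) 1) : ℂ))).congr_of_eventuallyEq
      (f₁ := fun s => Delta μ s (gaussian K a)) (by
        have : ∀ᶠ s : ℂ in nhds 1, 0 < s.re :=
          (continuous_re.tendsto 1).eventually (lt_mem_nhds (by simp))
        filter_upwards [this] with s hs using Delta_gaussian hd ha hs)
    have h5 := h1.unique h4
    have h6 := hD1
    rw [Delta_gaussian hd ha (by simp)] at h6
    rw [mul_one] at h5 h6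
    rw [hlog] at h5
    have h7 : ∫ y, ((-Real.log (localModule K y) : ℝ) : ℂ) * gaussian K a y ∂μ =
        -∫ y, gaussian K a y * (localModule K y : ℂ) ^ ((1 : ℂ) - 1) *
          (Real.log (localModule K y) : ℂ) ∂μ := by
      rw [← integral_neg]
      refine integral_congr_ae (Filter.Eventually.of_forall fun x => ?_)
      simp [mul_comm]
    rw [h7, h5]
    linear_combination ((Module.finrank ℝ K / 2 : ℂ) * (Real.log a - ψ)) * h6
  rw [hT.G_eq_of_fourier H hφ (measurable_gaussian a) hconv hi hw hadm,
    P_eq_sub hw0 hadm hφa, hc, hg, hτ]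
  push_cast
  field_simp
  ring

end Archimedean

/-! ### The Schwartz space as a space of test functions. -/

section SchwartzTest

variable {K : Type*} [NormedField K] [NormedAlgebra ℝ K] [FiniteDimensional ℝ K]
  [LocallyCompactSpace K] [MeasurableSpace K] [BorelSpace K] [SecondCountableTopology K]
  {μ : Measure K} [μ.IsAddHaarMeasure]

theorem norm_archChar (x : K) : ‖archChar K x‖ = 1 := by
  rw [archChar, show -(2 * Real.pi * I * (Algebra.trace ℝ K x : ℝ)) =
    ((-(2 * Real.pi * Algebra.trace ℝ K x) : ℝ) : ℂ) * I by push_cast; ring]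
  exact norm_exp_ofReal_mul_I _

theorem continuous_archChar : Continuous (archChar K) := by
  have := (Algebra.trace ℝ K).continuous_of_finiteDimensional
  unfold archChar
  fun_prop

theorem isTestSpace_schwartz (hd : ∀ x : K, localModule K x = ‖x‖ ^ Module.finrank ℝ K)
    (hF : ∀ f : 𝓢(K, ℂ), ∃ g : 𝓢(K, ℂ), fourier (archChar K) μ f = g)
    (hsd : IsSelfDual (archChar K) μ (schwartzTest K)) :
    IsTestSpace (archChar K) μ (schwartzTest K) where
  measurable_char := continuous_archChar.measurable
  norm_char x := (norm_archChar x).le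
  char_zero := by simp [archChar]
  measurable := by
    rintro _ ⟨f, rfl⟩
    exact f.continuous.measurable
  fourier_mem := by
    rintro _ ⟨f, rfl⟩
    exact hF f
  convergesOn := by
    rintro _ ⟨f, rfl⟩ b
    exact schwartz_convergesOn hd f b
  admissible := by
    rintro _ ⟨f, rfl⟩
    exact ⟨_, schwartz_admissible hd f⟩
  self_dual := hsd

theorem comp_one_sub_mem_schwartzTest {F : K → ℂ} (hF : F ∈ smoothMulTest K) :
    (fun x => F (1 - x)) ∈ schwartzTest K := by
  have h1 : ContDiff ℝ ∞ fun x => F (1 - x) := hF.1.comp (contDiff_const.sub contDiff_id)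
  have h2 : HasCompactSupport fun x => F (1 - x) :=
    hF.2.1.comp_homeomorph (Homeomorph.subLeft (1 : K))
  exact ⟨h2.toSchwartzMap h1, rfl⟩

end SchwartzTest

/-! ### The cutoff formula and Weil's substitution. -/

section Integrals

variable {K : Type*} [NormedField K] [LocallyCompactSpace K] [MeasurableSpace K] [BorelSpace K]
  [SecondCountableTopology K] {μ : Measure K} [μ.IsAddHaarMeasure] {R : ℝ} {c₀ : ℂ}

/-- The integral `P_w(φ) / R`, with the constant moved inside. -/
theorem hasIntegralOn_P {w φ : K → ℂ} (h : Integrable (PIntegrand w φ) μ) (R : ℝ) :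
    HasIntegralOn μ Set.univ
      (fun x => (φ x - φ 0 * w x) / ((R * localModule K x : ℝ) : ℂ))
      (((1 / R : ℝ) : ℂ) * P μ w φ) := by
  have e : (fun x => (φ x - φ 0 * w x) / ((R * localModule K x : ℝ) : ℂ)) =
      fun x => ((1 / R : ℝ) : ℂ) * PIntegrand w φ x := by
    funext x
    rw [PIntegrand]
    push_cast
    rw [div_mul_eq_div_div_swap]
    ring
  rw [e]
  exact ⟨integrableOn_univ.2 (h.const_mul _), by
    rw [Measure.restrict_univ, integral_const_mul, P]⟩

theorem exists_hasIntegralOn_cutoff (hm : Measurable (localModule K)) {φ : K → ℂ} {ε : ℝ}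
    (h : Admissible μ φ ε) (R : ℝ) :
    ∃ a b, HasIntegralOn μ {x | localModule K x ≤ 1}
        (fun x => (φ x - φ 0) / ((R * localModule K x : ℝ) : ℂ)) a ∧
      HasIntegralOn μ {x | 1 < localModule K x}
        (fun x => φ x / ((R * localModule K x : ℝ) : ℂ)) b ∧
      a + b = ((1 / R : ℝ) : ℂ) * P μ omegaInt φ := by
  have hS : MeasurableSet {x : K | localModule K x ≤ 1} := measurableSet_le hm measurable_const
  have hc : {x : K | localModule K x ≤ 1}ᶜ = {x | 1 < localModule K x} := by
    ext x
    simp only [Set.mem_compl_iff, Set.mem_ofPred_eq, not_le]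
  obtain ⟨a, b, ha, hb, hab⟩ := (hasIntegralOn_P h.integrable_PIntegrand R).split hS
  refine ⟨a, b, ha.congr_ae hS (Filter.Eventually.of_forall fun x hx => ?_), ?_, hab⟩
  · rw [omegaInt_of_le hx, mul_one]
  · rw [← hc]
    refine hb.congr_ae hS.compl (Filter.Eventually.of_forall fun x hx => ?_)
    rw [hc] at hx
    rw [omegaInt_of_lt hx, mul_zero, sub_zero]

/-- The substitution `x = 1 - 1 / u`, in the form that relates `G(x ↦ F(1 - x))` to Weil's
integrals. -/
theorem HasIntegralOn.weil_substitution (hm : Measurable (localModule K)) (h0 : μ {0} = 0)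
    {S : Set K} (hS : MeasurableSet S) {g : K → ℂ} {c : ℂ}
    (h : HasIntegralOn μ S (fun x => g x / ((R * localModule K x : ℝ) : ℂ)) c) :
    HasIntegralOn μ {u | 1 - u⁻¹ ∈ S}
      (fun u => g (1 - u⁻¹) / ((localModule K (1 - u) * (R * localModule K u) : ℝ) : ℂ)) c := by
  have hS' : MeasurableSet {u : K | 1 - u⁻¹ ∈ S} := (measurable_const.sub measurable_inv) hS
  refine (hasIntegralOn_comp_one_sub_inv μ hm h0 hS h).congr_ae hS' ?_
  filter_upwards [ae_ne_zero μ h0] with u hu _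
  have hp : (localModule K u : ℂ) ≠ 0 := by exact_mod_cast (localModule_pos hu).ne'
  -- At `x = 1 - 1/u` one has `|x| = |1 - u| / |u|`, so the Jacobian `|u|⁻²` divided by `|x|` is `1
  -- / (|u| |1 - u|)`.
  rw [localModule_one_sub_inv hu]
  push_cast
  by_cases h1 : (localModule K (1 - u) : ℂ) = 0
  · simp [h1]
  by_cases h2 : (R : ℂ) = 0
  · simp [h2]
  field_simp

end Integrals

/-! ### The real place: self-duality, the sharp cutoff, the box. -/

section Real

theorem localModule_real_eq_norm_pow (x : ℝ) :
    localModule ℝ x = ‖x‖ ^ Module.finrank ℝ ℝ := by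
  rw [localModule_real, Module.finrank_self, pow_one, Real.norm_eq_abs]

theorem volume_real_ball_real : (volume : Measure ℝ).real (Metric.ball 0 1) = 2 := by
  rw [Measure.real, Real.volume_ball, mul_one, ENNReal.toReal_ofReal zero_le_two]

theorem hasModuleResidue_real : HasModuleResidue (volume : Measure ℝ) 2 0 := by
  have := hasModuleResidue_of_norm (μ := (volume : Measure ℝ)) localModule_real_eq_norm_pow
  rwa [volume_real_ball_real] at this

theorem archChar_real (x : ℝ) : archChar ℝ x = exp (-(2 * Real.pi * I * x)) := by
  rw [archChar, Algebra.trace_self_apply]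

theorem fourier_real (φ : ℝ → ℂ) :
    fourier (archChar ℝ) volume φ = FourierTransform.fourier φ := by
  funext y
  rw [Real.fourier_real_eq_integral_exp_smul, fourier]
  refine integral_congr_ae (Filter.Eventually.of_forall fun x => ?_)
  dsimp only
  rw [archChar_real, smul_eq_mul, mul_comm]
  congr 2
  push_cast
  ring

theorem isSelfDual_real : IsSelfDual (archChar ℝ) volume (schwartzTest ℝ) := by
  rintro _ ⟨f, rfl⟩ x
  rw [fourier_real, fourier_real, ← neg_neg x, ← Real.fourierInv_eq_fourier_neg, neg_neg,
    ← SchwartzMap.fourier_coe, ← SchwartzMap.fourierInv_coe, FourierPair.fourierInv_fourier_eq]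

theorem isTestSpace_real : IsTestSpace (archChar ℝ) volume (schwartzTest ℝ) :=
  isTestSpace_schwartz localModule_real_eq_norm_pow
    (fun f => ⟨FourierTransform.fourier f, by rw [fourier_real, SchwartzMap.fourier_coe]⟩)
    isSelfDual_real

theorem fourier_gaussian_real :
    fourier (archChar ℝ) volume (gaussian ℝ Real.pi) = gaussian ℝ Real.pi := by
  have e : gaussian ℝ Real.pi = fun v : ℝ => exp (-(Real.pi : ℂ) * (‖v‖ : ℂ) ^ 2) := by
    funext v
    rw [gaussian, neg_mul]
    push_cast
    rfl
  have hpi : (Real.pi : ℂ) ≠ 0 := by exact_mod_cast Real.pi_ne_zero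
  funext y
  rw [fourier_real, e, fourier_gaussian_innerProductSpace (by simpa using Real.pi_pos),
    div_self hpi, one_cpow, one_mul]
  congr 1
  field_simp

theorem integral_eq_fourier_zero (φ : ℝ → ℂ) :
    ∫ x, φ x = fourier (archChar ℝ) volume φ 0 := by
  simp [fourier, archChar]

/-- The Gaussian with `a = π` is its own transform, and the digamma value at `1/2` is `-γ_e - 2 log
2`. -/
theorem G_real_cutoff {φ : ℝ → ℂ} (hφ : φ ∈ schwartzTest ℝ) :
    G (archChar ℝ) volume φ = ((1 / 2 : ℝ) : ℂ) * P volume omegaInt φ +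
      (Real.log (2 * Real.pi) + Real.eulerMascheroniConstant : ℝ) * φ 0 := by
  have h := isTestSpace_real.G_eq_cutoff localModule_real_eq_norm_pow
    (ψ := -(Real.eulerMascheroniConstant + 2 * Real.log 2))
    (τ := Real.log (2 * Real.pi) + Real.eulerMascheroniConstant) Real.pi_pos
    fourier_gaussian_real ?_ ?_ ?_ hφ
  · rwa [volume_real_ball_real] at h
  · rw [integral_eq_fourier_zero, fourier_gaussian_real]
    simp [gaussian]
  · rw [Module.finrank_self, Nat.cast_one, Gamma_one_half_eq]
    refine hasDerivAt_Gamma_one_half.congr_deriv ?_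
    rw [Real.sqrt_eq_rpow, ofReal_cpow Real.pi_pos.le, ofReal_neg, ofReal_add, ofReal_mul,
      ofReal_log zero_le_two]
    push_cast
    ring
  · rw [Module.finrank_self, Real.log_mul two_ne_zero Real.pi_ne_zero]
    push_cast
    ring

theorem uniformFormula_real : UniformFormula (archChar ℝ) volume (schwartzTest ℝ) 2
    (Real.log (2 * Real.pi) + Real.eulerMascheroniConstant) := by
  refine isTestSpace_real.uniformFormula hasModuleResidue_real (fun φ hφ => ?_) fun X hX => ?_
  · rw [G_real_cutoff hφ, zero_mul, add_zero]
  · have := mulHaar_shell_of_norm (μ := (volume : Measure ℝ)) localModule_real_eq_norm_pow X hX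
    rwa [volume_real_ball_real] at this

theorem integral_indicator_Ioc_mul {a : ℝ} (ha : 0 < a) (k g : ℝ → ℂ) :
    ∫ x, Set.indicator (Set.Ioc (-a) a) k x * g x = ∫ x in (-a)..a, k x * g x := by
  have e : (fun x => Set.indicator (Set.Ioc (-a) a) k x * g x) =
      Set.indicator (Set.Ioc (-a) a) fun x => k x * g x := by
    funext x
    rw [Set.indicator_mul_left]
  rw [e, integral_indicator measurableSet_Ioc, intervalIntegral.integral_of_le (by linarith)]

theorem convergesOn_indicator_Ioc {a : ℝ} (ha : 0 < a) {k : ℝ → ℂ} (hk : Continuous k) :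
    ConvergesOn volume (Set.indicator (Set.Ioc (-a) a) k) 0 2 := by
  obtain ⟨C, hC⟩ := isCompact_Icc.exists_bound_of_continuousOn
    (s := Set.Icc (-a) a) hk.continuousOn
  have hC0 : 0 ≤ C := (norm_nonneg _).trans (hC 0 ⟨by linarith, ha.le⟩)
  refine hasModuleResidue_real.convergesOn_zero
    (hk.measurable.indicator measurableSet_Ioc).aestronglyMeasurable (C := C) (C' := C * a ^ 2)
    (fun x => ?_) (fun x hx => ?_)
  · by_cases h : x ∈ Set.Ioc (-a) a
    · rw [Set.indicator_of_mem h]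
      exact hC x ⟨h.1.le, h.2⟩
    · rwa [Set.indicator_of_notMem h, norm_zero]
  · rw [localModule_real] at hx ⊢
    have e : |x| ^ (-(2 : ℝ)) = (|x| ^ 2)⁻¹ := by
      rw [Real.rpow_neg (abs_nonneg x), Real.rpow_two]
    rw [e]
    by_cases h : x ∈ Set.Ioc (-a) a
    · rw [Set.indicator_of_mem h]
      refine (hC x ⟨h.1.le, h.2⟩).trans ?_
      rw [← div_eq_mul_inv, le_div_iff₀ (by positivity)]
      gcongr
      exact abs_le.2 ⟨h.1.le, h.2⟩
    · rw [Set.indicator_of_notMem h, norm_zero]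
      positivity

/-- Here `h` is `k` cut off to `(-a, a]`, possibly discontinuous. Only its transform `w` has to be
admissible. -/
theorem G_real_of_window {a : ℝ} (ha : 0 < a) {k w : ℝ → ℂ} (hk : Continuous k)
    (hw : ∀ y : ℝ, ∫ x in (-a)..a, k x * exp (-(2 * Real.pi * I * (x * y : ℝ))) = w y)
    (hw0 : w 0 = 1) {ε : ℝ} (hwa : Admissible volume w ε) {v : ℂ}
    (hv : ∫ x in (-a)..a, k x * ((-Real.log x : ℝ) : ℂ) = v)
    {φ : ℝ → ℂ} (hφ : φ ∈ schwartzTest ℝ) :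
    G (archChar ℝ) volume φ = ((1 / 2 : ℝ) : ℂ) * P volume w φ + v * φ 0 := by
  have hf : fourier (archChar ℝ) volume (Set.indicator (Set.Ioc (-a) a) k) = w := by
    funext y
    rw [fourier, integral_indicator_Ioc_mul ha, ← hw]
    simp only [archChar_real]
  rw [isTestSpace_real.G_eq_of_fourier hasModuleResidue_real hφ
    (hk.measurable.indicator measurableSet_Ioc) (convergesOn_indicator_Ioc ha hk)
    (by rw [integral_eq_fourier_zero, hf, hw0]) hf hwa]
  congr 2
  rw [← hv, ← integral_indicator_Ioc_mul ha]
  refine integral_congr_ae (Filter.Eventually.of_forall fun x => ?_)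
  dsimp only
  rw [localModule_real, Real.log_abs, mul_comm]

/-- A crude Lipschitz bound at the origin: a cubic lower bound for `sin` up to `t = 1`, and `|sinc|
≤ 1` beyond. -/
theorem abs_sinc_sub_one_le (t : ℝ) : |Real.sinc t - 1| ≤ 2 * |t| := by
  have key : ∀ t : ℝ, 0 < t → |Real.sinc t - 1| ≤ 2 * |t| := by
    intro t ht
    have h1 := Real.sinc_le_one t
    have h2 := Real.neg_one_le_sinc t
    rw [abs_of_nonpos (by linarith), abs_of_pos ht]
    rcases le_or_gt t 1 with h | h
    · have h3 := Real.sin_gt_sub_cube ht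
      have h4 : 1 - t ≤ Real.sinc t := by
        rw [Real.sinc_of_ne_zero ht.ne', le_div_iff₀ ht]
        nlinarith [mul_pos ht ht]
      linarith
    · linarith
  rcases lt_trichotomy t 0 with h | h | h
  · have := key (-t) (by linarith)
    rwa [Real.sinc_neg, abs_neg] at this
  · simp [h]
  · exact key t h

theorem abs_sinc_le_inv_abs {t : ℝ} (ht : t ≠ 0) : |Real.sinc t| ≤ |t|⁻¹ := by
  rw [Real.sinc_of_ne_zero ht, abs_div, div_eq_mul_inv]
  exact mul_le_of_le_one_left (by positivity) (Real.abs_sin_le_one t)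

theorem admissible_real {w : ℝ → ℝ} (hw : Continuous w) (hw0 : w 0 = 1) {C C' : ℝ}
    (h1 : ∀ x, |w x - 1| ≤ C * |x|) (h2 : ∀ x, 1 < |x| → |w x| ≤ C' * |x|⁻¹) :
    Admissible volume (fun x => (w x : ℂ)) 1 := by
  refine hasModuleResidue_real.admissible (by fun_prop) (C := C) (C' := C') one_pos
    (fun x _ => ?_) (fun x hx => ?_)
  · rw [localModule_real, Real.rpow_one, hw0, ← ofReal_sub, norm_real, Real.norm_eq_abs]
    exact h1 x
  · rw [localModule_real] at hx ⊢
    rw [Real.rpow_neg_one, norm_real, Real.norm_eq_abs]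
    exact h2 x hx

theorem sinc_admissible {b : ℝ} (hb : 0 < b) :
    Admissible volume (fun x : ℝ => (Real.sinc (b * x) : ℂ)) 1 := by
  refine admissible_real (Real.continuous_sinc.comp (by fun_prop)) (by simp) (C := 2 * b)
    (C' := b⁻¹) (fun x => ?_) (fun x hx => ?_)
  · have := abs_sinc_sub_one_le (b * x)
    rwa [abs_mul, abs_of_pos hb, ← mul_assoc] at this
  · have hx0 : x ≠ 0 := by rintro rfl; norm_num at hx
    have := abs_sinc_le_inv_abs (mul_ne_zero hb.ne' hx0)
    rwa [abs_mul, abs_of_pos hb, mul_inv] at this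

theorem sinc_sq_admissible {b : ℝ} (hb : 0 < b) :
    Admissible volume (fun x : ℝ => ((Real.sinc (b * x) ^ 2 : ℝ) : ℂ)) 1 := by
  refine admissible_real ((Real.continuous_sinc.comp (by fun_prop)).pow 2) (by simp)
    (C := 4 * b) (C' := b⁻¹) (fun x => ?_) (fun x hx => ?_)
  · have h1 := abs_sinc_sub_one_le (b * x)
    rw [abs_mul b, abs_of_pos hb] at h1
    have h2 : |Real.sinc (b * x) + 1| ≤ 2 := by
      have := abs_add_le (Real.sinc (b * x)) 1
      have := Real.abs_sinc_le_one (b * x)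
      norm_num at *
      linarith
    rw [show Real.sinc (b * x) ^ 2 - 1 =
      (Real.sinc (b * x) - 1) * (Real.sinc (b * x) + 1) by ring, abs_mul]
    calc _ ≤ 2 * (b * |x|) * 2 := by gcongr
      _ = _ := by ring
  · have hx0 : x ≠ 0 := by rintro rfl; norm_num at hx
    have h1 := abs_sinc_le_inv_abs (mul_ne_zero hb.ne' hx0)
    have h2 := Real.abs_sinc_le_one (b * x)
    rw [abs_mul b, abs_of_pos hb, mul_inv] at h1
    rw [pow_two, abs_mul]
    exact (mul_le_of_le_one_left (abs_nonneg _) h2).trans h1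

theorem fourier_box {a : ℝ} (ha : 0 < a) (y : ℝ) :
    ∫ x in (-a)..a, ((1 / (2 * a) : ℝ) : ℂ) * exp (-(2 * Real.pi * I * (x * y : ℝ))) =
      (Real.sinc (2 * Real.pi * a * y) : ℂ) := by
  have haC : (a : ℂ) ≠ 0 := by exact_mod_cast ha.ne'
  have hpi : (Real.pi : ℂ) ≠ 0 := by exact_mod_cast Real.pi_ne_zero
  rcases eq_or_ne y 0 with rfl | hy
  · simp
    field_simp
    norm_num
  · have hyC : (y : ℂ) ≠ 0 := by exact_mod_cast hy
    have hc : -(2 * Real.pi * I * y) ≠ (0 : ℂ) := by simp [hpi, hyC]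
    have e : ∀ x : ℝ, exp (-(2 * Real.pi * I * (x * y : ℝ))) =
        exp (-(2 * Real.pi * I * y) * (x : ℂ)) := by
      intro x
      congr 1
      push_cast
      ring
    rw [intervalIntegral.integral_const_mul]
    simp only [e]
    have hθ : 2 * Real.pi * a * y ≠ 0 := by positivity
    have hs : ((Real.sin (2 * Real.pi * a * y) / (2 * Real.pi * a * y) : ℝ) : ℂ) =
        (exp (-((2 * Real.pi * a * y : ℝ) : ℂ) * I) - exp (((2 * Real.pi * a * y : ℝ) : ℂ) * I)) *
          I / 2 / ((2 * Real.pi * a * y : ℝ) : ℂ) := by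
      rw [ofReal_div, ofReal_sin, Complex.sin]
    rw [integral_exp_mul_complex hc, Real.sinc_of_ne_zero hθ, hs]
    have e1 : -(2 * Real.pi * I * y) * (a : ℂ) = -((2 * Real.pi * a * y : ℝ) : ℂ) * I := by
      push_cast; ring
    have e2 : -(2 * Real.pi * I * y) * ((-a : ℝ) : ℂ) = ((2 * Real.pi * a * y : ℝ) : ℂ) * I := by
      push_cast; ring
    rw [e1, e2]
    push_cast
    field_simp
    rw [I_sq]
    ring

theorem integral_log_box {a : ℝ} (ha : 0 < a) :
    ∫ x in (-a)..a, ((1 / (2 * a) : ℝ) : ℂ) * ((-Real.log x : ℝ) : ℂ) =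
      ((1 - Real.log a : ℝ) : ℂ) := by
  rw [intervalIntegral.integral_const_mul, intervalIntegral.integral_ofReal,
    intervalIntegral.integral_neg, integral_log, Real.log_neg_eq_log, ← ofReal_mul]
  congr 1
  field_simp
  ring

/-- The constant is the mean of `-log |x|` over `[-a, a]`. The choice `a = 1/2` gives `1 + log 2`,
and `a = e` makes the constant vanish. -/
theorem G_real_sinc {a : ℝ} (ha : 0 < a) {φ : ℝ → ℂ} (hφ : φ ∈ schwartzTest ℝ) :
    G (archChar ℝ) volume φ = ((1 / 2 : ℝ) : ℂ) *
      P volume (fun x : ℝ => (Real.sinc (2 * Real.pi * a * x) : ℂ)) φ +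
        ((1 - Real.log a : ℝ) : ℂ) * φ 0 :=
  G_real_of_window ha continuous_const (fourier_box ha) (by simp)
    (sinc_admissible (by positivity)) (integral_log_box ha) hφ

end Real

/-! ### The triangle function and the squared cardinal sine. -/

section Triangle

theorem integral_affine_mul_exp {c : ℂ} (hc : c ≠ 0) (α : ℂ) (a b : ℝ) :
    ∫ x in a..b, (1 + α * x) * exp (c * x) =
      exp (c * b) * ((1 + α * b) / c - α / c ^ 2) -
        exp (c * a) * ((1 + α * a) / c - α / c ^ 2) := by
  have hd : ∀ x : ℝ, HasDerivAt (fun x : ℝ => exp (c * x) * ((1 + α * x) / c - α / c ^ 2))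
      ((1 + α * x) * exp (c * x)) x := by
    intro x
    have hx : HasDerivAt (fun x : ℝ => (x : ℂ)) 1 x := HasDerivAt.ofReal_comp (hasDerivAt_id x)
    have h1 := (hx.const_mul c).cexp
    have h2 := (((hx.const_mul α).const_add 1).div_const c).sub_const (α / c ^ 2)
    refine (h1.mul h2).congr_deriv ?_
    field_simp
    ring
  exact intervalIntegral.integral_eq_sub_of_hasDerivAt (fun x _ => hd x)
    (Continuous.intervalIntegrable (by fun_prop) a b)

theorem fourier_triangle (y : ℝ) :
    ∫ x in (-1 : ℝ)..1, ((1 - |x| : ℝ) : ℂ) * exp (-(2 * Real.pi * I * (x * y : ℝ))) =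
      ((Real.sinc (Real.pi * y) ^ 2 : ℝ) : ℂ) := by
  have hi : ∀ a b : ℝ, IntervalIntegrable (fun x : ℝ => ((1 - |x| : ℝ) : ℂ) *
      exp (-(2 * Real.pi * I * (x * y : ℝ)))) volume a b := fun a b =>
    Continuous.intervalIntegrable (by fun_prop) a b
  rw [← intervalIntegral.integral_add_adjacent_intervals (hi (-1) 0) (hi 0 1)]
  have e1 : ∫ x in (-1 : ℝ)..0, ((1 - |x| : ℝ) : ℂ) * exp (-(2 * Real.pi * I * (x * y : ℝ))) =
      ∫ x in (-1 : ℝ)..0, (1 + 1 * (x : ℂ)) * exp (-(2 * Real.pi * I * y) * x) := by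
    refine intervalIntegral.integral_congr fun x hx => ?_
    rw [Set.uIcc_of_le (by norm_num)] at hx
    rw [abs_of_nonpos hx.2]
    push_cast
    congr 1
    · ring
    · congr 1
      ring
  have e2 : ∫ x in (0 : ℝ)..1, ((1 - |x| : ℝ) : ℂ) * exp (-(2 * Real.pi * I * (x * y : ℝ))) =
      ∫ x in (0 : ℝ)..1, (1 + -1 * (x : ℂ)) * exp (-(2 * Real.pi * I * y) * x) := by
    refine intervalIntegral.integral_congr fun x hx => ?_
    rw [Set.uIcc_of_le (by norm_num)] at hx
    rw [abs_of_nonneg hx.1]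
    push_cast
    congr 1
    · ring
    · congr 1
      ring
  rw [e1, e2]
  have hpi : (Real.pi : ℂ) ≠ 0 := by exact_mod_cast Real.pi_ne_zero
  rcases eq_or_ne y 0 with rfl | hy
  · have h1 : ∫ x in (-1 : ℝ)..0, (1 + x) = 1 / 2 := by
      rw [intervalIntegral.integral_add (by simp) (by simp)]
      simp
      norm_num
    have h2 : ∫ x in (0 : ℝ)..1, (1 - x) = 1 / 2 := by
      rw [intervalIntegral.integral_sub (by simp) (by simp)]
      simp
      norm_num
    have h1' : ∫ x in (-1 : ℝ)..0, (1 + (x : ℂ)) = ((1 / 2 : ℝ) : ℂ) := by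
      rw [← h1, ← intervalIntegral.integral_ofReal]
      simp
    have h2' : ∫ x in (0 : ℝ)..1, (1 - (x : ℂ)) = ((1 / 2 : ℝ) : ℂ) := by
      rw [← h2, ← intervalIntegral.integral_ofReal]
      simp
    simp only [ofReal_zero, mul_zero, neg_zero, zero_mul, exp_zero, mul_one, one_mul,
      neg_one_mul, ← sub_eq_add_neg]
    rw [h1', h2', ← ofReal_add]
    norm_num
  · have hyC : (y : ℂ) ≠ 0 := by exact_mod_cast hy
    have hc : -(2 * Real.pi * I * y) ≠ (0 : ℂ) := by simp [hpi, hyC]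
    have hθ : Real.pi * y ≠ 0 := mul_ne_zero Real.pi_ne_zero hy
    have hs : ((Real.sin (Real.pi * y) / (Real.pi * y) : ℝ) : ℂ) =
        (exp (-((Real.pi * y : ℝ) : ℂ) * I) - exp (((Real.pi * y : ℝ) : ℂ) * I)) *
          I / 2 / ((Real.pi * y : ℝ) : ℂ) := by
      rw [ofReal_div, ofReal_sin, Complex.sin]
    have hp : exp (-((Real.pi * y : ℝ) : ℂ) * I) * exp (((Real.pi * y : ℝ) : ℂ) * I) = 1 := by
      rw [← Complex.exp_add, neg_mul, neg_add_cancel, Complex.exp_zero]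
    have x1 : exp (-(2 * Real.pi * I * y) * ((1 : ℝ) : ℂ)) =
        exp (-((Real.pi * y : ℝ) : ℂ) * I) ^ 2 := by
      rw [← Complex.exp_nat_mul]
      congr 1
      push_cast
      ring
    have x2 : exp (-(2 * Real.pi * I * y) * ((-1 : ℝ) : ℂ)) =
        exp (((Real.pi * y : ℝ) : ℂ) * I) ^ 2 := by
      rw [← Complex.exp_nat_mul]
      congr 1
      push_cast
      ring
    rw [integral_affine_mul_exp hc, integral_affine_mul_exp hc, Real.sinc_of_ne_zero hθ,
      ofReal_pow, hs, x1, x2]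
    -- Beyond field arithmetic, the identity uses only that the two exponentials have product `1`.
    generalize exp (-((Real.pi * y : ℝ) : ℂ) * I) = A at hp ⊢
    generalize exp (((Real.pi * y : ℝ) : ℂ) * I) = B at hp ⊢
    simp only [ofReal_zero, mul_zero, exp_zero]
    push_cast
    field_simp
    ring_nf
    simp only [I_pow_four, one_mul]
    linear_combination (2 : ℂ) * hp

theorem integral_log_triangle :
    ∫ x in (-1 : ℝ)..1, ((1 - |x| : ℝ) : ℂ) * ((-Real.log x : ℝ) : ℂ) = 3 / 2 := by
  have hi : ∀ a b : ℝ, IntervalIntegrable (fun x : ℝ => (1 - |x|) * -Real.log x) volume a b :=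
    fun a b => intervalIntegral.intervalIntegrable_log'.neg.continuousOn_mul
      (Continuous.continuousOn (by fun_prop))
  have h1 : ∫ x in (0 : ℝ)..1, (1 - |x|) * -Real.log x = 3 / 4 := by
    -- The primitive of `-(1 - x) log x` is written through `x log x`, so that it is visibly
    -- continuous at `0`.
    rw [intervalIntegral.integral_eq_sub_of_hasDerivAt_of_le zero_le_one
      (f := fun x => x - x * Real.log x + x * (x * Real.log x) / 2 - x ^ 2 / 4) ?_ ?_ (hi 0 1)]
    · norm_num
    · have := Real.continuous_mul_log
      exact Continuous.continuousOn (by fun_prop)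
    · intro x hx
      have hx0 : x ≠ 0 := hx.1.ne'
      have h1 := (hasDerivAt_id x).mul (Real.hasDerivAt_log hx0)
      have h2 := (((hasDerivAt_id x).sub h1).add
        (((hasDerivAt_id x).mul h1).div_const 2)).sub (((hasDerivAt_id x).pow 2).div_const 4)
      refine h2.congr_deriv ?_
      rw [abs_of_pos hx.1]
      simp
      field_simp
      ring
  have h2 : ∫ x in (-1 : ℝ)..0, (1 - |x|) * -Real.log x = 3 / 4 := by
    rw [← h1, ← neg_zero, ← intervalIntegral.integral_comp_neg]
    simp
  have h3 : ∫ x in (-1 : ℝ)..1, (1 - |x|) * -Real.log x = 3 / 2 := by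
    rw [← intervalIntegral.integral_add_adjacent_intervals (hi (-1) 0) (hi 0 1), h1, h2]
    norm_num
  simp only [← ofReal_mul]
  rw [intervalIntegral.integral_ofReal, h3]
  norm_num

theorem G_real_sinc_sq {φ : ℝ → ℂ} (hφ : φ ∈ schwartzTest ℝ) :
    G (archChar ℝ) volume φ = ((1 / 2 : ℝ) : ℂ) *
      P volume (fun x : ℝ => ((Real.sinc (Real.pi * x) ^ 2 : ℝ) : ℂ)) φ + 3 / 2 * φ 0 :=
  G_real_of_window one_pos (by fun_prop) fourier_triangle (by simp)
    (sinc_sq_admissible Real.pi_pos) integral_log_triangle hφ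

end Triangle

/-! ### Assembly at the real place. -/

section RealPlace

theorem exists_hasIntegralOn_real {w φ : ℝ → ℂ} (hw : w 0 = 1) {ε : ℝ}
    (hwa : Admissible volume w ε) (hφ : φ ∈ schwartzTest ℝ) {g : ℂ}
    (hG : G (archChar ℝ) volume φ = ((1 / 2 : ℝ) : ℂ) * P volume w φ + g * φ 0) :
    ∃ a, HasIntegralOn volume Set.univ
        (fun x : ℝ => (φ x - φ 0 * w x) / ((2 * localModule ℝ x : ℝ) : ℂ)) a ∧
      G (archChar ℝ) volume φ = a + g * φ 0 := by
  obtain ⟨ε', h'⟩ := isTestSpace_real.admissible φ hφ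
  exact ⟨_, hasIntegralOn_P (integrable_PIntegrand hw hwa h') 2, hG⟩

theorem sinc_one_sub_inv {u : ℝ} (h0 : u ≠ 0) (h1 : u ≠ 1) :
    Real.sinc (Real.pi * (1 - u⁻¹)) = u / Real.pi * Real.sin (Real.pi / u) / (u - 1) := by
  have h2 : u - 1 ≠ 0 := sub_ne_zero.2 h1
  have h3 : (1 - u⁻¹) ≠ 0 := by
    rw [sub_ne_zero, ne_comm]
    exact fun h => h1 (inv_eq_one.1 h)
  rw [Real.sinc_of_ne_zero (mul_ne_zero Real.pi_ne_zero h3),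
    show Real.pi * (1 - u⁻¹) = Real.pi - Real.pi / u by field_simp, Real.sin_pi_sub]
  have : Real.pi - Real.pi / u = Real.pi * (u - 1) / u := by field_simp
  rw [this]
  field_simp

theorem weil_real {w F : ℝ → ℂ} {S : ℝ → ℂ} {g : ℂ}
    (hS : ∀ u : ℝ, u ≠ 0 → u ≠ 1 → S u = w (1 - u⁻¹))
    (h : ∃ a, HasIntegralOn volume Set.univ
        (fun x : ℝ => (F (1 - x) - F (1 - 0) * w x) / ((2 * localModule ℝ x : ℝ) : ℂ)) a ∧
      weilTerm (archChar ℝ) volume F = a + g * F (1 - 0)) :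
    ∃ a, HasIntegralOn volume Set.univ
        (fun u : ℝ => (F u⁻¹ - S u * F 1) / ((|1 - u| * (2 * |u|) : ℝ) : ℂ)) a ∧
      weilTerm (archChar ℝ) volume F = a + g * F 1 := by
  obtain ⟨a, ha, hG⟩ := h
  rw [sub_zero] at hG ha
  refine ⟨a, ?_, hG⟩
  have h2 := ha.weil_substitution hasModuleResidue_real.measurable
    hasModuleResidue_real.null_zero MeasurableSet.univ
  simp only [Set.mem_univ, Set.ofPred_true] at h2
  refine h2.congr_ae MeasurableSet.univ ?_
  have hne : ∀ᵐ u : ℝ, u ≠ 1 := by simp [ae_iff]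
  filter_upwards [ae_ne_zero volume hasModuleResidue_real.null_zero, hne] with u hu hu1 _
  rw [hS u hu hu1, localModule_real, localModule_real, sub_sub_cancel, mul_comm (F 1)]

theorem realPlace :
    IsSelfDual (archChar ℝ) volume (schwartzTest ℝ) ∧
      UniformFormula (archChar ℝ) volume (schwartzTest ℝ) 2
        (Real.log (2 * Real.pi) + Real.eulerMascheroniConstant) ∧
      (∀ φ ∈ schwartzTest ℝ,
        (∃ a b,
          HasIntegralOn volume {x : ℝ | |x| ≤ 1}
            (fun x => (φ x - φ 0) / ((2 * |x| : ℝ) : ℂ)) a ∧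
          HasIntegralOn volume {x : ℝ | 1 < |x|}
            (fun x => φ x / ((2 * |x| : ℝ) : ℂ)) b ∧
          G (archChar ℝ) volume φ = a + b +
            ((Real.log (2 * Real.pi) + Real.eulerMascheroniConstant : ℝ) : ℂ) * φ 0) ∧
        (∃ a, HasIntegralOn volume Set.univ
            (fun x : ℝ => (φ x - φ 0 * (Real.sinc (Real.pi * x) : ℝ)) /
              ((2 * |x| : ℝ) : ℂ)) a ∧
          G (archChar ℝ) volume φ = a + ((1 + Real.log 2 : ℝ) : ℂ) * φ 0) ∧
        (∃ a, HasIntegralOn volume Set.univ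
            (fun x : ℝ => (φ x - φ 0 * (Real.sinc (2 * Real.pi * Real.exp 1 * x) : ℝ)) /
              ((2 * |x| : ℝ) : ℂ)) a ∧
          G (archChar ℝ) volume φ = a) ∧
        (∃ a, HasIntegralOn volume Set.univ
            (fun x : ℝ => (φ x - φ 0 * ((Real.sinc (Real.pi * x)) ^ 2 : ℝ)) /
              ((2 * |x| : ℝ) : ℂ)) a ∧
          G (archChar ℝ) volume φ = a + (3 / 2 : ℂ) * φ 0)) ∧
      (∀ F ∈ smoothMulTest ℝ,
        (∃ a b,
          HasIntegralOn volume (Set.Ici (1 / 2 : ℝ))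
            (fun u : ℝ => (F u⁻¹ - F 1) / ((|1 - u| * (2 * |u|) : ℝ) : ℂ)) a ∧
          HasIntegralOn volume (Set.Iic (1 / 2 : ℝ))
            (fun u : ℝ => F u⁻¹ / ((|1 - u| * (2 * |u|) : ℝ) : ℂ)) b ∧
          weilTerm (archChar ℝ) volume F = a + b +
            ((Real.log (2 * Real.pi) + Real.eulerMascheroniConstant : ℝ) : ℂ) * F 1) ∧
        (∃ a, HasIntegralOn volume Set.univ
            (fun u : ℝ => (F u⁻¹ -
                ((u / Real.pi * Real.sin (Real.pi / u) / (u - 1) : ℝ) : ℂ) * F 1) /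
              ((|1 - u| * (2 * |u|) : ℝ) : ℂ)) a ∧
          weilTerm (archChar ℝ) volume F = a + ((1 + Real.log 2 : ℝ) : ℂ) * F 1) ∧
        (∃ a, HasIntegralOn volume Set.univ
            (fun u : ℝ => (F u⁻¹ -
                (((u / Real.pi * Real.sin (Real.pi / u) / (u - 1)) ^ 2 : ℝ) : ℂ) * F 1) /
              ((|1 - u| * (2 * |u|) : ℝ) : ℂ)) a ∧
          weilTerm (archChar ℝ) volume F = a + (3 / 2 : ℂ) * F 1)) := by
  have hcut : ∀ φ ∈ schwartzTest ℝ, ∃ a b,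
      HasIntegralOn volume {x : ℝ | localModule ℝ x ≤ 1}
        (fun x => (φ x - φ 0) / ((2 * localModule ℝ x : ℝ) : ℂ)) a ∧
      HasIntegralOn volume {x : ℝ | 1 < localModule ℝ x}
        (fun x => φ x / ((2 * localModule ℝ x : ℝ) : ℂ)) b ∧
      G (archChar ℝ) volume φ = a + b +
        ((Real.log (2 * Real.pi) + Real.eulerMascheroniConstant : ℝ) : ℂ) * φ 0 := by
    intro φ hφ
    obtain ⟨ε, h⟩ := isTestSpace_real.admissible φ hφ
    obtain ⟨a, b, ha, hb, hab⟩ :=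
      exists_hasIntegralOn_cutoff hasModuleResidue_real.measurable h 2
    exact ⟨a, b, ha, hb, by rw [hab, G_real_cutoff hφ]⟩
  have hsinc : ∀ φ ∈ schwartzTest ℝ, ∃ a, HasIntegralOn volume Set.univ
      (fun x : ℝ => (φ x - φ 0 * (Real.sinc (Real.pi * x) : ℝ)) /
        ((2 * localModule ℝ x : ℝ) : ℂ)) a ∧
      G (archChar ℝ) volume φ = a + ((1 + Real.log 2 : ℝ) : ℂ) * φ 0 := by
    intro φ hφ
    refine exists_hasIntegralOn_real (w := fun x => (Real.sinc (Real.pi * x) : ℂ)) (by simp)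
      (sinc_admissible Real.pi_pos) hφ ?_
    have := G_real_sinc one_half_pos hφ
    rwa [show 2 * Real.pi * (1 / 2) = Real.pi by ring, one_div (2 : ℝ), Real.log_inv,
      sub_neg_eq_add, ← one_div] at this
  have hsq : ∀ φ ∈ schwartzTest ℝ, ∃ a, HasIntegralOn volume Set.univ
      (fun x : ℝ => (φ x - φ 0 * ((Real.sinc (Real.pi * x)) ^ 2 : ℝ)) /
        ((2 * localModule ℝ x : ℝ) : ℂ)) a ∧
      G (archChar ℝ) volume φ = a + (3 / 2 : ℂ) * φ 0 := fun φ hφ =>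
    exists_hasIntegralOn_real (w := fun x => ((Real.sinc (Real.pi * x) ^ 2 : ℝ) : ℂ)) (by simp)
      (sinc_sq_admissible Real.pi_pos) hφ (G_real_sinc_sq hφ)
  refine ⟨isSelfDual_real, uniformFormula_real, fun φ hφ => ⟨?_, ?_, ?_, ?_⟩, fun F hF => ?_⟩
  · simpa only [localModule_real] using hcut φ hφ
  · simpa only [localModule_real] using hsinc φ hφ
  · obtain ⟨a, ha, hG⟩ := exists_hasIntegralOn_real
      (w := fun x => (Real.sinc (2 * Real.pi * Real.exp 1 * x) : ℂ)) (by simp)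
      (sinc_admissible (by positivity)) hφ (G_real_sinc (Real.exp_pos 1) hφ)
    refine ⟨a, by simpa only [localModule_real] using ha, ?_⟩
    rw [hG, Real.log_exp, sub_self, ofReal_zero, zero_mul, add_zero]
  · simpa only [localModule_real] using hsq φ hφ
  · have hF' := comp_one_sub_mem_schwartzTest hF
    refine ⟨?_, ?_, ?_⟩
    · obtain ⟨a, b, ha, hb, hG⟩ := hcut _ hF'
      have hm := hasModuleResidue_real.measurable
      have h0 := hasModuleResidue_real.null_zero
      have ha' := ha.weil_substitution hm h0 (measurableSet_le hm measurable_const)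
      have hb' := hb.weil_substitution hm h0 (measurableSet_lt measurable_const hm)
      simp only [sub_sub_cancel, sub_zero, localModule_real] at ha' hb' hG
      -- The condition says `|u - 1| ≤ |u|`: `u` is at least as close to `1` as to `0`.
      have hle : ∀ u : ℝ, u ≠ 0 → (|1 - u⁻¹| ≤ 1 ↔ 1 / 2 ≤ u) := by
        intro u hu
        have := localModule_one_sub_inv hu
        rw [localModule_real, localModule_real, localModule_real] at this
        rw [this, div_le_one (abs_pos.2 hu), ← sq_le_sq]
        constructor <;> intro h <;> nlinarith
      refine ⟨a, b, ha'.congr_set ?_, hb'.congr_set ?_, hG⟩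
      · filter_upwards [ae_ne_zero volume h0] with u hu
        exact propext (hle u hu)
      -- Both half-lines in the statement contain `1/2`, a null set.
      · have hne : ∀ᵐ u : ℝ, u ≠ 1 / 2 := by simp [ae_iff]
        filter_upwards [ae_ne_zero volume h0, hne] with u hu hu2
        refine propext ?_
        change 1 < |1 - u⁻¹| ↔ u ≤ 1 / 2
        rw [← not_le, hle u hu, not_le]
        exact ⟨le_of_lt, fun h => lt_of_le_of_ne h hu2⟩
    · exact weil_real (fun u hu hu1 => by rw [sinc_one_sub_inv hu hu1]) (hsinc _ hF')
    · exact weil_real (fun u hu hu1 => by rw [sinc_one_sub_inv hu hu1]) (hsq _ hF')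

end RealPlace

/-! ### The complex place. -/

section ComplexPlace

/-- Twice Lebesgue measure on `ℂ`. -/
def twiceVolume : Measure ℂ := (2 : ENNReal) • volume

instance : twiceVolume.IsAddHaarMeasure :=
  Measure.IsAddHaarMeasure.smul _ two_ne_zero ENNReal.ofNat_ne_top

theorem integral_twiceVolume (f : ℂ → ℂ) : ∫ z, f z ∂twiceVolume = 2 * ∫ z, f z := by
  rw [twiceVolume, integral_smul_measure, real_smul]
  simp

theorem localModule_complex_eq_norm_pow (z : ℂ) :
    localModule ℂ z = ‖z‖ ^ Module.finrank ℝ ℂ := by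
  rw [localModule_complex, Complex.finrank_real_complex, normSq_eq_norm_sq]

theorem twiceVolume_real_ball : twiceVolume.real (Metric.ball 0 1) = 2 * Real.pi := by
  rw [Measure.real, twiceVolume, Measure.smul_apply, Complex.volume_ball]
  simp

theorem hasModuleResidue_complex : HasModuleResidue twiceVolume (2 * Real.pi) 0 := by
  have := hasModuleResidue_of_norm (μ := twiceVolume) localModule_complex_eq_norm_pow
  rwa [twiceVolume_real_ball] at this

/-- The trace form `2 Re(x y)` is the Euclidean inner product of `x` with `2 ȳ`, which reduces the
transform to the Euclidean one. -/
theorem archChar_complex_mul (x y : ℂ) :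
    archChar ℂ (x * y) = exp (((-2 * Real.pi * inner ℝ x (2 * conjCLE y) : ℝ) : ℂ) * I) := by
  have e : inner ℝ x (2 * conjCLE y) = 2 * (x * y).re := by
    rw [Complex.inner]
    simp
    ring
  rw [archChar, Algebra.trace_complex_apply, e]
  congr 1
  push_cast
  ring

theorem fourier_complex (φ : ℂ → ℂ) (y : ℂ) :
    fourier (archChar ℂ) twiceVolume φ y =
      2 * FourierTransform.fourier φ (2 * conjCLE y) := by
  rw [fourier, integral_twiceVolume, Real.fourier_eq']
  congr 1
  refine integral_congr_ae (Filter.Eventually.of_forall fun x => ?_)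
  dsimp only
  rw [archChar_complex_mul, smul_eq_mul, mul_comm]

theorem integral_comp_two_mul_conj (g : ℂ → ℂ) :
    4 * ∫ z, g (2 * conjCLE z) = ∫ z, g z := by
  have h1 := Measure.integral_comp_smul (volume : Measure ℂ) (fun z => g (conjCLE z)) 2
  have h2 := (conjLIE.measurePreserving).integral_comp
    conjLIE.toHomeomorph.measurableEmbedding g
  have h3 : ∫ z, g (conjCLE z) = ∫ z, g z := h2
  have h4 : ∀ z : ℂ, conjCLE ((2 : ℝ) • z) = 2 * conjCLE z := fun z => by
    rw [map_smul, real_smul, ofReal_ofNat]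
  simp only [h4] at h1
  rw [h1, h3, Complex.finrank_real_complex, real_smul]
  norm_num
  ring

/-- Each of the two transforms brings a factor `2` from the measure. Together they cancel the
Jacobian `4` of `y ↦ 2 ȳ`. -/
theorem isSelfDual_complex : IsSelfDual (archChar ℂ) twiceVolume (schwartzTest ℂ) := by
  rintro _ ⟨f, rfl⟩ x
  have h := integral_comp_two_mul_conj fun z => FourierTransform.fourier (⇑f) z *
    exp (((-2 * Real.pi * inner ℝ z x : ℝ) : ℂ) * I)
  have e : ∀ y : ℂ, archChar ℂ (y * x) =
      exp (((-2 * Real.pi * inner ℝ (2 * conjCLE y) x : ℝ) : ℂ) * I) := by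
    intro y
    rw [mul_comm, archChar_complex_mul, real_inner_comm]
  have hF : ∫ z, FourierTransform.fourier (⇑f) z *
      exp (((-2 * Real.pi * inner ℝ z x : ℝ) : ℂ) * I) = f (-x) := by
    have : f (-x) = FourierTransform.fourier (FourierTransform.fourier ⇑f) x := by
      rw [← neg_neg x, ← Real.fourierInv_eq_fourier_neg, neg_neg,
        ← SchwartzMap.fourier_coe, ← SchwartzMap.fourierInv_coe, FourierPair.fourierInv_fourier_eq]
    rw [this, Real.fourier_eq']
    simp only [smul_eq_mul, mul_comm]
  rw [← hF, ← h, fourier, integral_twiceVolume]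
  simp only [fourier_complex, e, mul_assoc]
  rw [integral_const_mul]
  ring

theorem isTestSpace_complex : IsTestSpace (archChar ℂ) twiceVolume (schwartzTest ℂ) := by
  refine isTestSpace_schwartz localModule_complex_eq_norm_pow (fun f => ?_) isSelfDual_complex
  -- The transform is the Euclidean one composed with the real-linear map `y ↦ 2 ȳ`, which preserves
  -- the Schwartz space.
  let A : ℂ ≃L[ℝ] ℂ := conjCLE.trans
    (ContinuousLinearEquiv.smulLeft (Units.mk0 (2 : ℝ) two_ne_zero))
  refine ⟨(2 : ℂ) • SchwartzMap.compCLMOfContinuousLinearEquiv ℂ A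
    (FourierTransform.fourier f), ?_⟩
  funext y
  have hA : A y = 2 * conjCLE y := by
    change (2 : ℝ) • conjCLE y = _
    rw [real_smul, ofReal_ofNat]
  rw [fourier_complex, smul_apply, SchwartzMap.compCLMOfContinuousLinearEquiv_apply,
    Function.comp_apply, hA, SchwartzMap.fourier_coe, smul_eq_mul]

/-- The Euclidean transform of `e^(-2π|z|²)` is `(1/2) e^(-π|w|²/2)`. At `w = 2 ȳ`, with the factor
`2` of the measure, it is the same Gaussian. -/
theorem fourier_gaussian_complex :
    fourier (archChar ℂ) twiceVolume (gaussian ℂ (2 * Real.pi)) = gaussian ℂ (2 * Real.pi) := by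
  have e : gaussian ℂ (2 * Real.pi) =
      fun v : ℂ => exp (-((2 * Real.pi : ℝ) : ℂ) * (‖v‖ : ℂ) ^ 2) := by
    funext v
    rw [gaussian, neg_mul]
    push_cast
    rfl
  have hpi : (Real.pi : ℂ) ≠ 0 := by exact_mod_cast Real.pi_ne_zero
  funext y
  have hn : ‖2 * conjCLE y‖ = 2 * ‖y‖ := by simp
  rw [fourier_complex, e, fourier_gaussian_innerProductSpace (by simpa using Real.pi_pos), hn,
    Complex.finrank_real_complex, Nat.cast_ofNat, div_self two_ne_zero, cpow_one, ← mul_assoc]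
  have h1 : (2 : ℂ) * (Real.pi / ((2 * Real.pi : ℝ) : ℂ)) = 1 := by
    push_cast
    field_simp
  rw [h1, one_mul]
  congr 1
  push_cast
  field_simp

/-- Now `a = 2π` and `d/2 = 1`, where the digamma value is `-γ_e`. -/
theorem G_complex_cutoff {φ : ℂ → ℂ} (hφ : φ ∈ schwartzTest ℂ) :
    G (archChar ℂ) twiceVolume φ = ((1 / (2 * Real.pi) : ℝ) : ℂ) * P twiceVolume omegaInt φ +
      (2 * (Real.log (2 * Real.pi) + Real.eulerMascheroniConstant) : ℝ) * φ 0 := by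
  have h := isTestSpace_complex.G_eq_cutoff localModule_complex_eq_norm_pow
    (ψ := -Real.eulerMascheroniConstant)
    (τ := 2 * (Real.log (2 * Real.pi) + Real.eulerMascheroniConstant)) Real.two_pi_pos
    fourier_gaussian_complex ?_ ?_ ?_ hφ
  · rwa [twiceVolume_real_ball] at h
  · have : ∫ x, gaussian ℂ (2 * Real.pi) x ∂twiceVolume =
        fourier (archChar ℂ) twiceVolume (gaussian ℂ (2 * Real.pi)) 0 := by
      simp [fourier, archChar]
    rw [this, fourier_gaussian_complex]
    simp [gaussian]
  · rw [Complex.finrank_real_complex, Nat.cast_ofNat, div_self two_ne_zero, Gamma_one, one_mul,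
      ofReal_neg]
    exact hasDerivAt_Gamma_one
  · rw [Complex.finrank_real_complex]
    push_cast
    ring

theorem volume_re_eq (c : ℝ) : volume {z : ℂ | z.re = c} = 0 := by
  have h := Complex.volume_preserving_equiv_real_prod.measure_preimage
    (s := {c} ×ˢ Set.univ) ((measurableSet_singleton c).prod MeasurableSet.univ).nullMeasurableSet
  rw [Measure.volume_eq_prod, Measure.prod_prod, Real.volume_singleton, zero_mul] at h
  convert h using 2
  ext z
  simp [Complex.measurableEquivRealProd_apply]

theorem complexPlace :
    IsSelfDual (archChar ℂ) twiceVolume (schwartzTest ℂ) ∧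
      UniformFormula (archChar ℂ) twiceVolume (schwartzTest ℂ) (2 * Real.pi)
        (2 * (Real.log (2 * Real.pi) + Real.eulerMascheroniConstant)) ∧
      (∀ φ ∈ schwartzTest ℂ, ∃ a b,
        HasIntegralOn twiceVolume {z : ℂ | normSq z ≤ 1}
          (fun z => (φ z - φ 0) / ((2 * Real.pi * normSq z : ℝ) : ℂ)) a ∧
        HasIntegralOn twiceVolume {z : ℂ | 1 < normSq z}
          (fun z => φ z / ((2 * Real.pi * normSq z : ℝ) : ℂ)) b ∧
        G (archChar ℂ) twiceVolume φ = a + b +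
          ((2 * (Real.log (2 * Real.pi) + Real.eulerMascheroniConstant) : ℝ) : ℂ) * φ 0) ∧
      (∀ F ∈ smoothMulTest ℂ, ∃ a b,
        HasIntegralOn twiceVolume {u : ℂ | 1 / 2 ≤ u.re}
          (fun u => (F u⁻¹ - F 1) /
            ((normSq (1 - u) * (2 * Real.pi * normSq u) : ℝ) : ℂ)) a ∧
        HasIntegralOn twiceVolume {u : ℂ | u.re ≤ 1 / 2}
          (fun u => F u⁻¹ / ((normSq (1 - u) * (2 * Real.pi * normSq u) : ℝ) : ℂ)) b ∧
        weilTerm (archChar ℂ) twiceVolume F = a + b +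
          ((2 * (Real.log (2 * Real.pi) + Real.eulerMascheroniConstant) : ℝ) : ℂ) * F 1) := by
  have hm := hasModuleResidue_complex.measurable
  have h0 := hasModuleResidue_complex.null_zero
  have hcut : ∀ φ ∈ schwartzTest ℂ, ∃ a b,
      HasIntegralOn twiceVolume {x : ℂ | localModule ℂ x ≤ 1}
        (fun x => (φ x - φ 0) / ((2 * Real.pi * localModule ℂ x : ℝ) : ℂ)) a ∧
      HasIntegralOn twiceVolume {x : ℂ | 1 < localModule ℂ x}
        (fun x => φ x / ((2 * Real.pi * localModule ℂ x : ℝ) : ℂ)) b ∧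
      G (archChar ℂ) twiceVolume φ = a + b +
        ((2 * (Real.log (2 * Real.pi) + Real.eulerMascheroniConstant) : ℝ) : ℂ) * φ 0 := by
    intro φ hφ
    obtain ⟨ε, h⟩ := isTestSpace_complex.admissible φ hφ
    obtain ⟨a, b, ha, hb, hab⟩ := exists_hasIntegralOn_cutoff hm h (2 * Real.pi)
    exact ⟨a, b, ha, hb, by rw [hab, G_complex_cutoff hφ]⟩
  refine ⟨isSelfDual_complex, ?_, fun φ hφ => ?_, fun F hF => ?_⟩
  · refine isTestSpace_complex.uniformFormula hasModuleResidue_complex (fun φ hφ => ?_)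
      fun X hX => ?_
    · rw [G_complex_cutoff hφ, zero_mul, add_zero]
    · have := mulHaar_shell_of_norm (μ := twiceVolume) localModule_complex_eq_norm_pow X hX
      rwa [twiceVolume_real_ball] at this
  · simpa only [localModule_complex] using hcut φ hφ
  · obtain ⟨a, b, ha, hb, hG⟩ := hcut _ (comp_one_sub_mem_schwartzTest hF)
    have ha' := ha.weil_substitution hm h0 (measurableSet_le hm measurable_const)
    have hb' := hb.weil_substitution hm h0 (measurableSet_lt measurable_const hm)
    simp only [sub_sub_cancel, sub_zero, localModule_complex] at ha' hb' hG
    -- The boundary is the perpendicular bisector of `0` and `1`.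
    have hle : ∀ u : ℂ, u ≠ 0 → (normSq (1 - u⁻¹) ≤ 1 ↔ 1 / 2 ≤ u.re) := by
      intro u hu
      have := localModule_one_sub_inv hu
      rw [localModule_complex, localModule_complex, localModule_complex] at this
      rw [this, div_le_one (normSq_pos.2 hu), normSq_apply, normSq_apply]
      simp only [sub_re, one_re, sub_im, one_im]
      constructor <;> intro h <;> nlinarith
    refine ⟨a, b, ha'.congr_set ?_, hb'.congr_set ?_, hG⟩
    · filter_upwards [ae_ne_zero twiceVolume h0] with u hu
      exact propext (hle u hu)
    -- The line `Re u = 1/2`, common to both closed half-planes, is a null set.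
    · have hne : ∀ᵐ u ∂twiceVolume, u.re ≠ 1 / 2 := by
        rw [ae_iff, twiceVolume, Measure.smul_apply]
        simp only [not_not, volume_re_eq, smul_zero]
      filter_upwards [ae_ne_zero twiceVolume h0, hne] with u hu hu2
      refine propext ?_
      change 1 < normSq (1 - u⁻¹) ↔ u.re ≤ 1 / 2
      rw [← not_le, hle u hu, not_le]
      exact ⟨le_of_lt, fun h => lt_of_le_of_ne h hu2⟩

end ComplexPlace

end

end LocalLog

theorem mainTheorem2 :
    -- finite places
    (∀ (p : ℕ) [Fact p.Prime] (L : Type*) [NormedField L] [NormedAlgebra ℚ_[p] L]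
      [FiniteDimensional ℚ_[p] L] [LocallyCompactSpace L] [MeasurableSpace L] [BorelSpace L]
      (μ : Measure L) [μ.IsAddHaarMeasure] (ϖ : L) (q R : ℝ) (δ : ℤ),
      LocalLog.IsSelfDual (LocalLog.padicChar p L) μ (LocalLog.bruhatTest L) →
      LocalLog.IsUniformizer ϖ →
      q = (LocalLog.localModule L ϖ)⁻¹ →
      LocalLog.IsDifferentExponent p ϖ δ →
      R = q ^ (-(δ : ℝ) / 2) * (1 - 1 / q) / Real.log q →
      -- the volume of the integers, the uniform formula, the volume of the units
      μ {x | LocalLog.localModule L x ≤ 1} = ENNReal.ofReal (q ^ (-(δ : ℝ) / 2)) ∧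
      LocalLog.UniformFormula (LocalLog.padicChar p L) μ (LocalLog.bruhatTest L) R
        (Real.log q / (q - 1) - δ * Real.log q - Real.log q / 2) ∧
      LocalLog.mulHaar μ (1 / R) {x | LocalLog.localModule L x = 1} =
        ENNReal.ofReal (Real.log q) ∧
      -- `ω` the characteristic function of the integers
      LocalLog.G (LocalLog.padicChar p L) μ LocalLog.omegaInt =
        ((Real.log q / (q - 1) - δ * Real.log q : ℝ) : ℂ) ∧
      (∀ φ ∈ LocalLog.bruhatTest L,
        LocalLog.G (LocalLog.padicChar p L) μ φ =
          ((1 / R : ℝ) : ℂ) * (LocalLog.P μ LocalLog.omegaInt φ +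
            ((q ^ (-(δ : ℝ) / 2 - 1) : ℝ) : ℂ) * φ 0) - ((δ * Real.log q : ℝ) : ℂ) * φ 0) ∧
      -- `ω₁`
      (∀ φ ∈ LocalLog.bruhatTest L,
        Integrable (LocalLog.PIntegrand (LocalLog.omegaOne (1 / q)) φ) μ ∧
        LocalLog.G (LocalLog.padicChar p L) μ φ =
          ((1 / R : ℝ) : ℂ) * LocalLog.P μ (LocalLog.omegaOne (1 / q)) φ -
            ((δ * Real.log q : ℝ) : ℂ) * φ 0) ∧
      -- Weil's local term
      (∀ F ∈ LocalLog.bruhatMulTest L,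
        (∃ a, LocalLog.HasIntegralOn μ Set.univ
            (fun x => (F (1 - x) - F 1 * LocalLog.omegaOne (1 / q) x) *
              ((1 / R / LocalLog.localModule L x : ℝ) : ℂ)) a ∧
          LocalLog.weilTerm (LocalLog.padicChar p L) μ F =
            a - ((δ * Real.log q : ℝ) : ℂ) * F 1) ∧
        (∃ a b,
          LocalLog.HasIntegralOn (LocalLog.mulHaar μ (1 / R))
            {u | LocalLog.localModule L u = 1}
            (fun u => (F u⁻¹ - F 1) / (LocalLog.localModule L (1 - u) : ℂ)) a ∧
          LocalLog.HasIntegralOn (LocalLog.mulHaar μ (1 / R))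
            {u | LocalLog.localModule L u ≠ 1}
            (fun u => F u⁻¹ / (LocalLog.localModule L (1 - u) : ℂ)) b ∧
          LocalLog.weilTerm (LocalLog.padicChar p L) μ F =
            a + b - ((δ * Real.log q : ℝ) : ℂ) * F 1)) ∧
      -- for `F(u) = f(|u|) χ(u)⁻¹` only one of the two integrals contributes
      (∀ (f : ℝ → ℂ) (χ : Lˣ →* Circle), ContDiff ℝ ∞ f → HasCompactSupport f →
        tsupport f ⊆ Set.Ioi 0 → Continuous χ →
        ((∀ u : Lˣ, LocalLog.localModule L (u : L) = 1 → χ u = 1) →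
          LocalLog.HasIntegralOn (LocalLog.mulHaar μ (1 / R))
            {u | LocalLog.localModule L u = 1}
            (fun u => (LocalLog.heckeTest f χ u⁻¹ - LocalLog.heckeTest f χ 1) /
              (LocalLog.localModule L (1 - u) : ℂ)) 0) ∧
        ((∃ u : Lˣ, LocalLog.localModule L (u : L) = 1 ∧ χ u ≠ 1) →
          LocalLog.HasIntegralOn (LocalLog.mulHaar μ (1 / R))
            {u | LocalLog.localModule L u ≠ 1}
            (fun u => LocalLog.heckeTest f χ u⁻¹ / (LocalLog.localModule L (1 - u) : ℂ)) 0)))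
    ∧
    -- the real place, with Lebesgue measure
    (LocalLog.IsSelfDual (LocalLog.archChar ℝ) volume (LocalLog.schwartzTest ℝ) ∧
      LocalLog.UniformFormula (LocalLog.archChar ℝ) volume (LocalLog.schwartzTest ℝ) 2
        (Real.log (2 * Real.pi) + Real.eulerMascheroniConstant) ∧
      (∀ φ ∈ LocalLog.schwartzTest ℝ,
        (∃ a b,
          LocalLog.HasIntegralOn volume {x : ℝ | |x| ≤ 1}
            (fun x => (φ x - φ 0) / ((2 * |x| : ℝ) : ℂ)) a ∧
          LocalLog.HasIntegralOn volume {x : ℝ | 1 < |x|}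
            (fun x => φ x / ((2 * |x| : ℝ) : ℂ)) b ∧
          LocalLog.G (LocalLog.archChar ℝ) volume φ = a + b +
            ((Real.log (2 * Real.pi) + Real.eulerMascheroniConstant : ℝ) : ℂ) * φ 0) ∧
        (∃ a, LocalLog.HasIntegralOn volume Set.univ
            (fun x : ℝ => (φ x - φ 0 * (Real.sinc (Real.pi * x) : ℝ)) /
              ((2 * |x| : ℝ) : ℂ)) a ∧
          LocalLog.G (LocalLog.archChar ℝ) volume φ =
            a + ((1 + Real.log 2 : ℝ) : ℂ) * φ 0) ∧
        (∃ a, LocalLog.HasIntegralOn volume Set.univ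
            (fun x : ℝ => (φ x - φ 0 * (Real.sinc (2 * Real.pi * Real.exp 1 * x) : ℝ)) /
              ((2 * |x| : ℝ) : ℂ)) a ∧
          LocalLog.G (LocalLog.archChar ℝ) volume φ = a) ∧
        (∃ a, LocalLog.HasIntegralOn volume Set.univ
            (fun x : ℝ => (φ x - φ 0 * ((Real.sinc (Real.pi * x)) ^ 2 : ℝ)) /
              ((2 * |x| : ℝ) : ℂ)) a ∧
          LocalLog.G (LocalLog.archChar ℝ) volume φ = a + (3 / 2 : ℂ) * φ 0)) ∧
      (∀ F ∈ LocalLog.smoothMulTest ℝ,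
        (∃ a b,
          LocalLog.HasIntegralOn volume (Set.Ici (1 / 2 : ℝ))
            (fun u : ℝ => (F u⁻¹ - F 1) / ((|1 - u| * (2 * |u|) : ℝ) : ℂ)) a ∧
          LocalLog.HasIntegralOn volume (Set.Iic (1 / 2 : ℝ))
            (fun u : ℝ => F u⁻¹ / ((|1 - u| * (2 * |u|) : ℝ) : ℂ)) b ∧
          LocalLog.weilTerm (LocalLog.archChar ℝ) volume F = a + b +
            ((Real.log (2 * Real.pi) + Real.eulerMascheroniConstant : ℝ) : ℂ) * F 1) ∧
        (∃ a, LocalLog.HasIntegralOn volume Set.univ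
            (fun u : ℝ => (F u⁻¹ -
                ((u / Real.pi * Real.sin (Real.pi / u) / (u - 1) : ℝ) : ℂ) * F 1) /
              ((|1 - u| * (2 * |u|) : ℝ) : ℂ)) a ∧
          LocalLog.weilTerm (LocalLog.archChar ℝ) volume F =
            a + ((1 + Real.log 2 : ℝ) : ℂ) * F 1) ∧
        (∃ a, LocalLog.HasIntegralOn volume Set.univ
            (fun u : ℝ => (F u⁻¹ -
                (((u / Real.pi * Real.sin (Real.pi / u) / (u - 1)) ^ 2 : ℝ) : ℂ) * F 1) /
              ((|1 - u| * (2 * |u|) : ℝ) : ℂ)) a ∧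
          LocalLog.weilTerm (LocalLog.archChar ℝ) volume F = a + (3 / 2 : ℂ) * F 1)))
    ∧
    -- the complex place, with twice Lebesgue measure
    (∀ μ : Measure ℂ, μ = (2 : ENNReal) • volume →
      LocalLog.IsSelfDual (LocalLog.archChar ℂ) μ (LocalLog.schwartzTest ℂ) ∧
      LocalLog.UniformFormula (LocalLog.archChar ℂ) μ (LocalLog.schwartzTest ℂ) (2 * Real.pi)
        (2 * (Real.log (2 * Real.pi) + Real.eulerMascheroniConstant)) ∧
      (∀ φ ∈ LocalLog.schwartzTest ℂ, ∃ a b,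
        LocalLog.HasIntegralOn μ {z : ℂ | normSq z ≤ 1}
          (fun z => (φ z - φ 0) / ((2 * Real.pi * normSq z : ℝ) : ℂ)) a ∧
        LocalLog.HasIntegralOn μ {z : ℂ | 1 < normSq z}
          (fun z => φ z / ((2 * Real.pi * normSq z : ℝ) : ℂ)) b ∧
        LocalLog.G (LocalLog.archChar ℂ) μ φ = a + b +
          ((2 * (Real.log (2 * Real.pi) + Real.eulerMascheroniConstant) : ℝ) : ℂ) * φ 0) ∧
      (∀ F ∈ LocalLog.smoothMulTest ℂ, ∃ a b,
        LocalLog.HasIntegralOn μ {u : ℂ | 1 / 2 ≤ u.re}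
          (fun u => (F u⁻¹ - F 1) /
            ((normSq (1 - u) * (2 * Real.pi * normSq u) : ℝ) : ℂ)) a ∧
        LocalLog.HasIntegralOn μ {u : ℂ | u.re ≤ 1 / 2}
          (fun u => F u⁻¹ / ((normSq (1 - u) * (2 * Real.pi * normSq u) : ℝ) : ℂ)) b ∧
        LocalLog.weilTerm (LocalLog.archChar ℂ) μ F = a + b +
          ((2 * (Real.log (2 * Real.pi) + Real.eulerMascheroniConstant) : ℝ) : ℂ) * F 1)) := by
  exact ⟨fun p _ L _ _ _ _ _ _ μ _ ϖ q R δ hs hϖ hq hδ hR =>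
    LocalLog.finitePlace p L μ ϖ q R δ hs hϖ hq hδ hR, LocalLog.realPlace, by
      rintro _ rfl
      exact LocalLog.complexPlace⟩
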